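/- Let $M$ be a connected closed (compact, without boundary) oriented smooth surface, $x_0\in M$, $\pi=\pi_1(M,x_0)$, and let $\tilde\pi$ be the set of conjugacy classes of $\pi$, that is, of free homotopy classes of closed curves in $M$. Let $J\subset\mathbb{R}\pi$ be the augmentation ideal of the real group ring ($J^0=\mathbb{R}\pi$), let $\mathrm{pr}:\mathbb{R}\pi\to\mathbb{R}\tilde\pi$ be the linear projection that sends each $g\in\pi$ to its conjugacy class, and put $\tilde J^p=\mathrm{pr}(J^p)$. The Goldman bracket $[\ ,\ ]$ is the unique bilinear map $\mathbb{R}\tilde\pi\times\mathbb{R}\tilde\pi\to\mathbb{R}\tilde\pi$ such that, for all smooth closed curves $\alpha,\beta$ in $M$ that intersect transversally, $$[\alpha,\beta]=\sum_{m\in\alpha\cap\beta}\varepsilon(m;\alpha,\beta)\,|\alpha_m\beta_m|,$$ where the sum runs over the intersections of $\alpha$ and $\beta$ (pairs of parameters with the same image $m$), $\varepsilon(m;\alpha,\beta)=\pm1$ is the local intersection number, $\alpha_m\beta_m$ is the product of the two curves as loops based at $m$, and $|\cdot|$ denotes the free homotopy class. This bracket exists, and: (1) if $p\ge1$ and $q\ge2$,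 then $[\tilde J^p,\tilde J^q]\subset\tilde J^{p+q-2}$; (2) if $p\ge2$, then $[\tilde J^p,\mathbb{R}\tilde\pi]\subset\tilde J^{p-1}$. (3) The Goldman bracket induces a Lie bracket on the completion $\varprojlim_p\mathbb{R}\tilde\pi/\tilde J^p$: there is a unique bilinear map $B$ on the completion such that, for all $x,y$ in it, all $p\ge0$ and all $a,b\in\mathbb{R}\tilde\pi$ representing the components of $x,y$ in $\mathbb{R}\tilde\pi/\tilde J^{p+1}$, the component of $B(x,y)$ in $\mathbb{R}\tilde\pi/\tilde J^{p}$ is the class of $[a,b]$; and $B$ is alternating and satisfies the Jacobi identity. -/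

import Mathlib

open scoped ContDiff Manifold

noncomputable section

/-! ### The vector space on conjugacy classes and its filtration -/

section Algebra

variable (π : Type*) [Group π]

/-- The augmentation ideal `J` of the real group ring `ℝπ`: the kernel of the augmentation
`ℝπ → ℝ`, `∑ aᵢ gᵢ ↦ ∑ aᵢ`. -/
def augmentationIdeal : Ideal (MonoidAlgebra ℝ π) :=
  RingHom.ker (MonoidAlgebra.lift ℝ ℝ π (1 : π →* ℝ))

/-- The real vector space `ℝπ̃` with basis the set `π̃` of conjugacy classes of `π`. -/
abbrev ClassSpace : Type _ := ConjClasses π →₀ ℝ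

/-- The linear projection `pr : ℝπ → ℝπ̃`, sending a group element to its conjugacy class. -/
def classProj : MonoidAlgebra ℝ π →ₗ[ℝ] ClassSpace π :=
  Finsupp.lmapDomain ℝ ℝ ConjClasses.mk ∘ₗ (MonoidAlgebra.coeffLinearEquiv ℝ).toLinearMap

/-- `J̃^p = pr (J^p)`; for `p = 0` the power `J^0` is the whole group ring. -/
def classFiltration (p : ℕ) : Submodule ℝ (ClassSpace π) :=
  ((augmentationIdeal π ^ p).restrictScalars ℝ).map (classProj π)

lemma classFiltration_antitone : Antitone (classFiltration π) := by
  intro p q h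
  exact Submodule.map_mono fun _ hx => Ideal.pow_le_pow_right h hx

/-- The completion `lim_p ℝπ̃ / J̃^p`: the compatible families in the product of the quotients. -/
def ClassCompletion : Submodule ℝ (∀ p : ℕ, ClassSpace π ⧸ classFiltration π p) where
  carrier := {x | ∀ p q (h : p ≤ q),
    Submodule.factor (classFiltration_antitone π h) (x q) = x p}
  zero_mem' := by intro p q h; simp
  add_mem' := by
    intro x y hx hy p q h
    simp [hx p q h, hy p q h]
  smul_mem' := by
    intro c x hx p q h
    simp [hx p q h]

variable {π}

/-- `B` is the bracket induced on the completion by the bracket `br` on `ℝπ̃`: the component of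
`B x y` in `ℝπ̃ / J̃^p` is the class of `br a b`, for any `a`, `b` in `ℝπ̃` that represent the
components of `x`, `y` in `ℝπ̃ / J̃^(p+1)`. -/
def IsInducedBracket (br : ClassSpace π →ₗ[ℝ] ClassSpace π →ₗ[ℝ] ClassSpace π)
    (B : ClassCompletion π →ₗ[ℝ] ClassCompletion π →ₗ[ℝ] ClassCompletion π) : Prop :=
  ∀ (x y : ClassCompletion π) (p : ℕ) (a b : ClassSpace π),
    x.1 (p + 1) = (classFiltration π (p + 1)).mkQ a →
    y.1 (p + 1) = (classFiltration π (p + 1)).mkQ b →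
    (B x y).1 p = (classFiltration π p).mkQ (br a b)

end Algebra

/-- A bilinear map is a Lie bracket: it is alternating and satisfies the Jacobi identity. -/
structure IsLieBracket {V : Type*} [AddCommMonoid V] [Module ℝ V]
    (B : V →ₗ[ℝ] V →ₗ[ℝ] V) : Prop where
  alternating : ∀ x, B x x = 0
  jacobi : ∀ x y z, B x (B y z) + B y (B z x) + B z (B x y) = 0

/-! ### Oriented surfaces and the Goldman bracket -/

section Surface

/-- The Euclidean plane, on which surfaces are modelled. -/
abbrev Plane : Type := EuclideanSpace ℝ (Fin 2)

variable (M : Type*) [TopologicalSpace M] [ChartedSpace Plane M]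

/-- The atlas of the surface is oriented: all the coordinate changes between its charts have
positive Jacobian determinant. The orientation of the surface is the one for which the charts of
this atlas preserve orientation. -/
def IsOrientedAtlas : Prop :=
  ∀ e ∈ atlas Plane M, ∀ e' ∈ atlas Plane M, ∀ x ∈ e.source ∩ e'.source,
    0 < (fderiv ℝ (fun u => e' (e.symm u)) (e x)).det

/-- A smooth closed curve in the surface, as a smooth map on `ℝ` of period `1`. -/
structure SmoothLoop where
  toFun : ℝ → M
  smooth : ContMDiff 𝓘(ℝ) (𝓡 2) ∞ toFun
  periodic : Function.Periodic toFun 1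

namespace SmoothLoop

variable {M}

instance : CoeFun (SmoothLoop M) (fun _ => ℝ → M) := ⟨toFun⟩

/-- The closed curve `α`, run through once starting from the parameter `s`, as a loop based at
`α s`. -/
def loopAt (α : SmoothLoop M) (s : ℝ) : Path (α s) (α s) where
  toFun t := α (s + t)
  continuous_toFun := α.smooth.continuous.comp (by fun_prop)
  source' := by simp
  target' := by simpa using α.periodic s

/-- For `α s = β t = m`, the determinant `det (α'(s), β'(t))` of the velocities of the two curves
at `m`, in the coordinates of the preferred chart at `m`. -/
def velocityDet (α β : SmoothLoop M) (s t : ℝ) : ℝ :=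
  let v : Plane := deriv (fun u => chartAt Plane (α s) (α u)) s
  let w : Plane := deriv (fun u => chartAt Plane (α s) (β u)) t
  v 0 * w 1 - v 1 * w 0

/-- The closed curves `α` and `β` intersect transversally: at each intersection their velocities
are linearly independent. -/
def Transverse (α β : SmoothLoop M) : Prop :=
  ∀ s t : ℝ, α s = β t → velocityDet α β s t ≠ 0

/-- The intersections of two closed curves, as pairs of parameters in `[0, 1)`. There are only
finitely many of them if the curves intersect transversally and the surface is Hausdorff. -/
def Crossing (α β : SmoothLoop M) : Type :=
  {z : ℝ × ℝ // z.1 ∈ Set.Ico (0 : ℝ) 1 ∧ z.2 ∈ Set.Ico (0 : ℝ) 1 ∧ α z.1 = β z.2}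

/-- The local intersection number `ε(m; α, β) ∈ {1, -1}` at a transverse intersection: the sign of
the basis `(α'(s), β'(t))` of the tangent plane, with respect to the orientation. -/
def crossingSign {α β : SmoothLoop M} (z : Crossing α β) : ℝ :=
  Real.sign (velocityDet α β z.1.1 z.1.2)

/-- The product `α_m · β_m` of the two curves as loops based at their intersection point `m`. -/
def crossingLoop {α β : SmoothLoop M} (z : Crossing α β) : Path (α z.1.1) (α z.1.1) :=
  (α.loopAt z.1.1).trans ((β.loopAt z.1.2).cast z.2.2.2 z.2.2.2)

end SmoothLoop

variable {M} [PathConnectedSpace M] (x₀ : M)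

/-- The free homotopy class of a loop, as a conjugacy class of `π₁(M, x₀)`: the loop is transported
to `x₀` along a path (the conjugacy class does not depend on the path). -/
def freeClass {y : M} (l : Path y y) : ConjClasses (FundamentalGroup M x₀) :=
  ConjClasses.mk (FundamentalGroup.fundamentalGroupMulEquivOfPathConnected y x₀
    (FundamentalGroup.fromPath (Path.Homotopic.Quotient.mk l)))

/-- Goldman's sum `∑ ε(m; α, β) [α_m · β_m]` over the intersections `m` of `α` and `β`. -/
def goldmanSum (α β : SmoothLoop M) : ClassSpace (FundamentalGroup M x₀) :=
  ∑ᶠ z : SmoothLoop.Crossing α β,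
    Finsupp.single (freeClass x₀ (SmoothLoop.crossingLoop z)) (SmoothLoop.crossingSign z)

/-- `br` is the Goldman bracket on `ℝπ̃`, where `π = π₁(M, x₀)`: it is bilinear, and its value on
the free homotopy classes of any two transverse smooth closed curves is Goldman's sum. -/
def IsGoldmanBracket
    (br : ClassSpace (FundamentalGroup M x₀) →ₗ[ℝ] ClassSpace (FundamentalGroup M x₀) →ₗ[ℝ]
      ClassSpace (FundamentalGroup M x₀)) : Prop :=
  ∀ α β : SmoothLoop M, α.Transverse β →
    br (Finsupp.single (freeClass x₀ (α.loopAt 0)) 1)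
      (Finsupp.single (freeClass x₀ (β.loopAt 0)) 1) = goldmanSum x₀ α β

end Surface

end

noncomputable section

/-! ### Crossings of arcs in the plane -/

open MeasureTheory Set Filter Topology Metric

/-- The determinant of two vectors of `ℝ × ℝ`. -/
def det2 (v w : ℝ × ℝ) : ℝ := v.1 * w.2 - v.2 * w.1

/-- The determinant `det2 v c` as a continuous linear form in `v`. -/
def det2L (c : ℝ × ℝ) : ℝ × ℝ →L[ℝ] ℝ :=
  c.2 • ContinuousLinearMap.fst ℝ ℝ ℝ - c.1 • ContinuousLinearMap.snd ℝ ℝ ℝ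

@[simp] lemma det2L_apply (c v : ℝ × ℝ) : det2L c v = det2 v c := by
  simp [det2L, det2]; ring

lemma continuous_det2L : Continuous det2L := by
  unfold det2L; fun_prop

lemma det_clm_columns (u v : ℝ × ℝ) :
    ((ContinuousLinearMap.fst ℝ ℝ ℝ).smulRight u + (ContinuousLinearMap.snd ℝ ℝ ℝ).smulRight v :
      ℝ × ℝ →L[ℝ] ℝ × ℝ).det = det2 u v := by
  rw [ContinuousLinearMap.det, ← LinearMap.det_toMatrix (Module.Basis.finTwoProd ℝ),
    Matrix.det_fin_two]
  simp [LinearMap.toMatrix_apply, det2]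
  ring

/-- A weighted curve `b` in the plane, near the ball of radius `R` about `c`: it is defined on an
open set `O` of times, carries a locally constant weight `w`, and is closed if `0 ∈ O`. -/
structure PlanarStrand (c : ℝ × ℝ) (R : ℝ) where
  b : ℝ → ℝ × ℝ
  O : Set ℝ
  w : ℝ → ℝ
  isOpen : IsOpen O
  smooth : ∀ t ∈ O, ContDiffAt ℝ 1 b t
  w_const : ∀ t ∈ O, ∀ᶠ t' in 𝓝 t, w t' = w t
  closed : IsClosed {t | t ∈ O ∧ b t ∈ closedBall c (2 * R)}
  mem_iff : (0 : ℝ) ∈ O ↔ (1 : ℝ) ∈ O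
  b_eq : (0 : ℝ) ∈ O → b 0 = b 1
  w_eq : (0 : ℝ) ∈ O → w 0 = w 1
  deriv_zero : (0 : ℝ) ∈ O → deriv b 0 = 0
  deriv_one : (1 : ℝ) ∈ O → deriv b 1 = 0

namespace PlanarStrand

variable {c : ℝ × ℝ} {R : ℝ} (S : PlanarStrand c R)

/-- The times in `[0, 1]` at which the strand is near the ball. -/
def T : Set ℝ := {t | t ∈ S.O ∧ S.b t ∈ closedBall c (2 * R)} ∩ Icc 0 1

lemma isCompact_T : IsCompact S.T := isCompact_Icc.inter_left S.closed

lemma T_subset : S.T ⊆ S.O := fun _ h => h.1.1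

lemma continuousAt_b {t : ℝ} (h : t ∈ S.O) : ContinuousAt S.b t := (S.smooth t h).continuousAt

lemma hasDerivAt_b {t : ℝ} (h : t ∈ S.O) : HasDerivAt S.b (deriv S.b t) t :=
  ((S.smooth t h).differentiableAt (by norm_num)).hasDerivAt

lemma _root_.ContDiffAt.continuousAt_deriv_one {E : Type*} [NormedAddCommGroup E]
    [NormedSpace ℝ E] {f : ℝ → E} {t : ℝ} (h : ContDiffAt ℝ 1 f t) :
    ContinuousAt (deriv f) t := by
  have := (h.continuousAt_fderiv (by norm_num)).clm_apply (continuousAt_const (y := (1 : ℝ)))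
  simpa using this

lemma continuousAt_deriv {t : ℝ} (h : t ∈ S.O) : ContinuousAt (deriv S.b) t :=
  (S.smooth t h).continuousAt_deriv_one

lemma continuousAt_w {t : ℝ} (h : t ∈ S.O) : ContinuousAt S.w t :=
  (continuousAt_const (y := S.w t)).congr ((S.w_const t h).mono fun _ h => h.symm)

/-- The 1-form dual to the strand, smeared out with the help of the function `φ`. -/
def smear (φ : ℝ × ℝ → ℝ) (p : ℝ × ℝ) : ℝ × ℝ →L[ℝ] ℝ :=
  ∫ t in S.T, (S.w t * φ (S.b t - p)) • det2L (deriv S.b t)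

/-- The derivative of `smear`. -/
def smearDeriv (φ : ℝ × ℝ → ℝ) (p : ℝ × ℝ) : ℝ × ℝ →L[ℝ] ℝ × ℝ →L[ℝ] ℝ :=
  ∫ t in S.T, ((-S.w t) • fderiv ℝ φ (S.b t - p)).smulRight (det2L (deriv S.b t))

lemma continuousOn_smear_integrand {φ : ℝ × ℝ → ℝ} (hφ : ContDiff ℝ 1 φ) (p : ℝ × ℝ) :
    ContinuousOn (fun t => (S.w t * φ (S.b t - p)) • det2L (deriv S.b t)) S.T := by
  intro t ht
  have h := S.T_subset ht
  apply ContinuousAt.continuousWithinAt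
  have h1 : ContinuousAt (fun t => φ (S.b t - p)) t :=
    hφ.continuous.continuousAt.comp ((S.continuousAt_b h).sub continuousAt_const)
  have h2 : ContinuousAt (fun t => det2L (deriv S.b t)) t :=
    continuous_det2L.continuousAt.comp (S.continuousAt_deriv h)
  exact ((S.continuousAt_w h).mul h1).smul h2

lemma continuousOn_smearDeriv_integrand {φ : ℝ × ℝ → ℝ} (hφ : ContDiff ℝ 1 φ) (p : ℝ × ℝ) :
    ContinuousOn (fun t => ((-S.w t) • fderiv ℝ φ (S.b t - p)).smulRight
      (det2L (deriv S.b t))) S.T := by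
  intro t ht
  have h := S.T_subset ht
  apply ContinuousAt.continuousWithinAt
  have h1 : ContinuousAt (fun t => fderiv ℝ φ (S.b t - p)) t :=
    (hφ.continuous_fderiv (by norm_num)).continuousAt.comp
      ((S.continuousAt_b h).sub continuousAt_const)
  have h2 : ContinuousAt (fun t => det2L (deriv S.b t)) t :=
    continuous_det2L.continuousAt.comp (S.continuousAt_deriv h)
  have h3 := ((S.continuousAt_w h).neg).smul h1
  exact ((ContinuousLinearMap.smulRightL ℝ (ℝ × ℝ) (ℝ × ℝ →L[ℝ] ℝ)).continuous₂.continuousAt).comp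
    (h3.prodMk h2)

lemma hasFDerivAt_smear {φ : ℝ × ℝ → ℝ} (hφ : ContDiff ℝ 1 φ) (hc : HasCompactSupport φ)
    (p : ℝ × ℝ) : HasFDerivAt (S.smear φ) (S.smearDeriv φ p) p := by
  obtain ⟨C, hC⟩ := (hc.fderiv (𝕜 := ℝ)).exists_bound_of_continuous
    (hφ.continuous_fderiv (by norm_num))
  have hw : ContinuousOn (fun t => ‖S.w t‖ * C * ‖det2L (deriv S.b t)‖) S.T := fun t ht =>
    ((((S.continuousAt_w (S.T_subset ht)).norm.mul continuousAt_const).mul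
      (continuous_det2L.continuousAt.comp
        (S.continuousAt_deriv (S.T_subset ht))).norm)).continuousWithinAt
  have hT := S.isCompact_T.measurableSet
  refine hasFDerivAt_integral_of_dominated_of_fderiv_le
    (bound := fun t => ‖S.w t‖ * C * ‖det2L (deriv S.b t)‖) (s := univ)
    (F' := fun p t => ((-S.w t) • fderiv ℝ φ (S.b t - p)).smulRight (det2L (deriv S.b t)))
    univ_mem ?_ ?_ ?_ ?_ ?_ ?_
  · exact Eventually.of_forall fun q =>
      (S.continuousOn_smear_integrand hφ q).aestronglyMeasurable hT
  · exact (S.continuousOn_smear_integrand hφ p).integrableOn_compact S.isCompact_T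
  · exact (S.continuousOn_smearDeriv_integrand hφ p).aestronglyMeasurable hT
  · refine Eventually.of_forall fun t q _ => ?_
    rw [ContinuousLinearMap.norm_smulRight_apply, norm_smul, norm_neg]
    gcongr
    exact hC _
  · exact hw.integrableOn_compact S.isCompact_T
  · refine Eventually.of_forall fun t q _ => ?_
    have h1 : HasFDerivAt (fun q => φ (S.b t - q)) (-(fderiv ℝ φ (S.b t - q))) q := by
      have := ((hφ.differentiable (by norm_num)) (S.b t - q)).hasFDerivAt.comp q
        ((hasFDerivAt_id q).const_sub (S.b t))
      rw [ContinuousLinearMap.comp_neg, ContinuousLinearMap.comp_id] at this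
      exact this
    have h2 := (h1.const_mul (S.w t)).smul_const (det2L (deriv S.b t))
    rwa [smul_neg, ← neg_smul] at h2

lemma integral_fderiv_eq_zero {φ : ℝ × ℝ → ℝ} (hφ : ContDiff ℝ 1 φ)
    (hs : ∀ z, R ≤ ‖z‖ → φ z = 0) {p : ℝ × ℝ} (hp : p ∈ ball c R) :
    ∫ t in S.T, S.w t * fderiv ℝ φ (S.b t - p) (deriv S.b t) = 0 := by
  classical
  set F : ℝ → ℝ := fun t => if t ∈ S.O then S.w t * φ (S.b t - p) else 0 with hF
  set F' : ℝ → ℝ := fun t => if t ∈ S.O then S.w t * fderiv ℝ φ (S.b t - p) (deriv S.b t) else 0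
    with hF'
  have hd : ∀ t ∈ S.O, HasDerivAt (fun t => φ (S.b t - p))
      (fderiv ℝ φ (S.b t - p) (deriv S.b t)) t := fun t ht =>
    ((hφ.differentiable (by norm_num)) (S.b t - p)).hasFDerivAt.comp_hasDerivAt t
      ((S.hasDerivAt_b ht).sub_const p)
  have hderiv : ∀ t ∈ S.O, HasDerivAt F (S.w t * fderiv ℝ φ (S.b t - p) (deriv S.b t)) t := by
    intro t ht
    refine ((hd t ht).const_mul (S.w t)).congr_of_eventuallyEq ?_
    filter_upwards [S.isOpen.mem_nhds ht, S.w_const t ht] with t' h1 h2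
    simp [F, h1, h2]
  have hfar : ∀ t, ¬ (t ∈ S.O ∧ S.b t ∈ closedBall c (2 * R)) → F =ᶠ[𝓝 t] 0 := by
    intro t ht
    filter_upwards [S.closed.isOpen_compl.mem_nhds ht] with t' ht'
    by_cases h : t' ∈ S.O
    · simp only [F, h, if_true, Pi.zero_apply]
      rw [hs, mul_zero]
      have h2 : 2 * R < dist (S.b t') c := by
        by_contra h2
        exact ht' ⟨h, by simpa using h2⟩
      rw [← dist_eq_norm]
      have := dist_triangle (S.b t') p c
      rw [mem_ball] at hp
      linarith
    · simp [F, h]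
  have hzero : ∀ t, ¬ (t ∈ S.O ∧ S.b t ∈ closedBall c (2 * R)) → F' t = 0 := by
    intro t ht
    by_cases h : t ∈ S.O
    · have h1 := (hderiv t h).congr_of_eventuallyEq (hfar t ht).symm
      have h2 := h1.unique (hasDerivAt_const t (0 : ℝ))
      simp [F', h, h2]
    · simp [F', h]
  have hall : ∀ t, HasDerivAt F (F' t) t := by
    intro t
    by_cases h : t ∈ S.O
    · simpa [F', h] using hderiv t h
    · rw [hzero t (fun h' => h h'.1)]
      exact (hasDerivAt_const t (0 : ℝ)).congr_of_eventuallyEq (hfar t fun h' => h h'.1)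
  have hint : IntegrableOn F' S.T := by
    have hc : ContinuousOn (fun t => S.w t * fderiv ℝ φ (S.b t - p) (deriv S.b t)) S.T := by
      intro t ht
      have h := S.T_subset ht
      have h1 : ContinuousAt (fun t => fderiv ℝ φ (S.b t - p)) t :=
        (hφ.continuous_fderiv (by norm_num)).continuousAt.comp
          ((S.continuousAt_b h).sub continuousAt_const)
      exact ((S.continuousAt_w h).mul
        (h1.clm_apply (S.continuousAt_deriv h))).continuousWithinAt
    refine (hc.integrableOn_compact S.isCompact_T).congr_fun ?_ S.isCompact_T.measurableSet
    intro t ht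
    simp [F', S.T_subset ht]
  have hoff : ∀ t ∈ Icc (0 : ℝ) 1 \ S.T, F' t = 0 := fun t ht =>
    hzero t fun h => ht.2 ⟨h, ht.1⟩
  have hint1 : IntegrableOn F' (Icc 0 1) :=
    hint.of_forall_sdiff_eq_zero measurableSet_Icc hoff
  have h01 : ∫ t in (0 : ℝ)..1, F' t = F 1 - F 0 :=
    intervalIntegral.integral_eq_sub_of_hasDerivAt (fun t _ => hall t)
      ((intervalIntegrable_iff_integrableOn_Icc_of_le zero_le_one).2 hint1)
  have hF01 : F 1 = F 0 := by
    by_cases h : (0 : ℝ) ∈ S.O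
    · simp [F, h, S.mem_iff.1 h, S.b_eq h, S.w_eq h]
    · simp [F, h, mt S.mem_iff.2 h]
  rw [hF01, sub_self, intervalIntegral.integral_of_le zero_le_one,
    ← integral_Icc_eq_integral_Ioc,
    setIntegral_eq_of_subset_of_forall_sdiff_eq_zero measurableSet_Icc
      (inter_subset_right : S.T ⊆ Icc 0 1) hoff] at h01
  rw [← h01]
  refine setIntegral_congr_fun S.isCompact_T.measurableSet fun t ht => ?_
  simp [F', S.T_subset ht]

set_option maxSynthPendingDepth 4 in
lemma exists_primitive_smear {φ : ℝ × ℝ → ℝ} (hφ : ContDiff ℝ 1 φ) (hc : HasCompactSupport φ)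
    (hs : ∀ z, R ≤ ‖z‖ → φ z = 0) :
    ∃ G : ℝ × ℝ → ℝ, ∀ p ∈ ball c R, HasFDerivAt G (S.smear φ p) p := by
  refine (convex_ball c R).exists_forall_hasFDerivAt_of_fderiv_symmetric isOpen_ball
    (fun p _ => (S.hasFDerivAt_smear hφ hc p).differentiableAt.differentiableWithinAt) ?_
  intro p hp x y
  rw [(S.hasFDerivAt_smear hφ hc p).fderiv, ← sub_eq_zero]
  have hi : IntegrableOn (fun t => ((-S.w t) • fderiv ℝ φ (S.b t - p)).smulRight
      (det2L (deriv S.b t))) S.T :=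
    (S.continuousOn_smearDeriv_integrand hφ p).integrableOn_compact S.isCompact_T
  have key : ∀ x y, S.smearDeriv φ p x y =
      ∫ t in S.T, -S.w t * fderiv ℝ φ (S.b t - p) x * det2 y (deriv S.b t) := by
    intro x y
    rw [smearDeriv, ContinuousLinearMap.integral_apply hi,
      ContinuousLinearMap.integral_apply (hi.apply_continuousLinearMap x)]
    simp
  have hi2 : ∀ x y, IntegrableOn
      (fun t => -S.w t * fderiv ℝ φ (S.b t - p) x * det2 y (deriv S.b t)) S.T := by
    intro x y
    have := (hi.apply_continuousLinearMap x).apply_continuousLinearMap y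
    simpa [IntegrableOn] using this
  rw [key, key, ← integral_sub (hi2 x y) (hi2 y x)]
  have hz := S.integral_fderiv_eq_zero hφ hs hp
  rw [← mul_zero (det2 x y), ← hz, ← integral_const_mul]
  congr 1
  ext t
  have hlin : ∀ v : ℝ × ℝ, fderiv ℝ φ (S.b t - p) v =
      v.1 * fderiv ℝ φ (S.b t - p) (1, 0) + v.2 * fderiv ℝ φ (S.b t - p) (0, 1) := by
    intro v
    conv_lhs => rw [show v = v.1 • ((1, 0) : ℝ × ℝ) + v.2 • (0, 1) by ext <;> simp]
    rw [map_add, map_smul, map_smul, smul_eq_mul, smul_eq_mul]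
  rw [hlin x, hlin y, hlin (deriv S.b t)]
  simp only [det2]
  ring

end PlanarStrand
end

noncomputable section
open MeasureTheory Set Filter Topology Metric

namespace PlanarStrand

variable {c : ℝ × ℝ} {R : ℝ} (S : PlanarStrand c R)

/-- An arc in the ball that meets the strand transversally and whose ends are off the strand. -/
structure IsTransverseArc (a : ℝ → ℝ × ℝ) (s₀ s₁ : ℝ) : Prop where
  le : s₀ ≤ s₁
  smooth : ∀ s ∈ Icc s₀ s₁, ContDiffAt ℝ 1 a s
  mem_ball : ∀ s ∈ Icc s₀ s₁, a s ∈ ball c R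
  left_ne : ∀ t ∈ S.T, a s₀ ≠ S.b t
  right_ne : ∀ t ∈ S.T, a s₁ ≠ S.b t
  transverse : ∀ s ∈ Icc s₀ s₁, ∀ t ∈ S.T, a s = S.b t → det2 (deriv a s) (deriv S.b t) ≠ 0

/-- The crossings of an arc with the strand. -/
def crossings (a : ℝ → ℝ × ℝ) (s₀ s₁ : ℝ) : Set (ℝ × ℝ) :=
  {z | z.1 ∈ Icc s₀ s₁ ∧ z.2 ∈ S.T ∧ a z.1 = S.b z.2}

variable {S} {a : ℝ → ℝ × ℝ} {s₀ s₁ : ℝ}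

namespace IsTransverseArc

lemma hasStrictFDerivAt (h : S.IsTransverseArc a s₀ s₁) {z : ℝ × ℝ} (h1 : z.1 ∈ Icc s₀ s₁)
    (h2 : z.2 ∈ S.O) :
    HasStrictFDerivAt (fun z : ℝ × ℝ => S.b z.2 - a z.1)
      ((ContinuousLinearMap.fst ℝ ℝ ℝ).smulRight (-deriv a z.1) +
        (ContinuousLinearMap.snd ℝ ℝ ℝ).smulRight (deriv S.b z.2)) z := by
  have ha := ((h.smooth _ h1).hasStrictDerivAt (by norm_num)).hasStrictFDerivAt.comp z
    (hasStrictFDerivAt_fst (𝕜 := ℝ) (p := z))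
  have hb := ((S.smooth _ h2).hasStrictDerivAt (by norm_num)).hasStrictFDerivAt.comp z
    (hasStrictFDerivAt_snd (𝕜 := ℝ) (p := z))
  refine HasStrictFDerivAt.congr_fderiv (hb.sub ha) ?_
  ext <;> simp

lemma det_eq (v w : ℝ × ℝ) : det2 (-v) w = -det2 v w := by
  simp [det2]; ring

lemma mem_interior (h : S.IsTransverseArc a s₀ s₁) {z : ℝ × ℝ} (hz : z ∈ S.crossings a s₀ s₁) :
    ∀ᶠ y : ℝ × ℝ in 𝓝 z, y.1 ∈ Icc s₀ s₁ ∧ y.2 ∈ S.T := by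
  obtain ⟨h1, h2, h3⟩ := hz
  have hd := h.transverse _ h1 _ h2 h3
  have i1 : z.1 ∈ Ioo s₀ s₁ := by
    refine ⟨lt_of_le_of_ne h1.1 fun e => h.left_ne _ h2 (by rw [e, h3]),
      lt_of_le_of_ne h1.2 fun e => h.right_ne _ h2 (by rw [← e, h3])⟩
  have i2 : z.2 ∈ Ioo (0 : ℝ) 1 := by
    refine ⟨lt_of_le_of_ne h2.2.1 fun e => hd ?_, lt_of_le_of_ne h2.2.2 fun e => hd ?_⟩
    · rw [← e, S.deriv_zero (by rw [e]; exact S.T_subset h2)]; simp [det2]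
    · rw [e, S.deriv_one (by rw [← e]; exact S.T_subset h2)]; simp [det2]
  have i3 : S.b z.2 ∈ ball c (2 * R) := by
    have := h.mem_ball _ h1
    rw [h3, Metric.mem_ball] at this
    rw [Metric.mem_ball]
    have := dist_nonneg (x := S.b z.2) (y := c)
    linarith
  have e1 := (continuous_fst.continuousAt (x := z)).eventually (isOpen_Ioo.mem_nhds i1)
  have e2 := (continuous_snd.continuousAt (x := z)).eventually (isOpen_Ioo.mem_nhds i2)
  have e3 := (continuous_snd.continuousAt (x := z)).eventually
    (S.isOpen.mem_nhds (S.T_subset h2))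
  have e4 := (continuous_snd.continuousAt (x := z)).eventually
    ((S.continuousAt_b (S.T_subset h2)).eventually (isOpen_ball.mem_nhds i3))
  filter_upwards [e1, e2, e3, e4] with y y1 y2 y3 y4
  exact ⟨Ioo_subset_Icc_self y1, ⟨y3, ball_subset_closedBall y4⟩, Ioo_subset_Icc_self y2⟩

/-- The local structure at a crossing. -/
lemma exists_nhd (h : S.IsTransverseArc a s₀ s₁) {z : ℝ × ℝ} (hz : z ∈ S.crossings a s₀ s₁) :
    ∃ W : Set (ℝ × ℝ), IsOpen W ∧ z ∈ W ∧ W ⊆ Icc s₀ s₁ ×ˢ S.T ∧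
      InjOn (fun z : ℝ × ℝ => S.b z.2 - a z.1) W ∧
      (∀ y ∈ W, S.w y.2 = S.w z.2) ∧
      ∀ y ∈ W, det2 (deriv a y.1) (deriv S.b y.2) =
        Real.sign (det2 (deriv a z.1) (deriv S.b z.2)) *
          |det2 (deriv a y.1) (deriv S.b y.2)| := by
  have hint := h.mem_interior hz
  obtain ⟨h1, h2, h3⟩ := hz
  have hd := h.transverse _ h1 _ h2 h3
  have hf := h.hasStrictFDerivAt h1 (S.T_subset h2)
  set L := ((ContinuousLinearMap.fst ℝ ℝ ℝ).smulRight (-deriv a z.1) +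
        (ContinuousLinearMap.snd ℝ ℝ ℝ).smulRight (deriv S.b z.2) : ℝ × ℝ →L[ℝ] ℝ × ℝ) with hL
  have hLd : L.det ≠ 0 := by
    rw [hL, det_clm_columns, det_eq]; exact neg_ne_zero.2 hd
  obtain ⟨e, he⟩ : ∃ e : (ℝ × ℝ) ≃L[ℝ] ℝ × ℝ, (e : ℝ × ℝ →L[ℝ] ℝ × ℝ) = L :=
    ⟨L.toContinuousLinearEquivOfDetNeZero hLd, L.coe_toContinuousLinearEquivOfDetNeZero hLd⟩
  rw [← he] at hf
  have hinj : ∀ᶠ y in 𝓝 z, y ∈ (hf.toOpenPartialHomeomorph _).source :=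
    (hf.toOpenPartialHomeomorph _).open_source.mem_nhds hf.mem_toOpenPartialHomeomorph_source
  have hinj2 : InjOn (fun z : ℝ × ℝ => S.b z.2 - a z.1) (hf.toOpenPartialHomeomorph _).source :=
    (hf.toOpenPartialHomeomorph _).injOn
  have hw : ∀ᶠ y : ℝ × ℝ in 𝓝 z, S.w y.2 = S.w z.2 :=
    (continuous_snd.continuousAt (x := z)).eventually (S.w_const _ (S.T_subset h2))
  have hc : ContinuousAt (fun y : ℝ × ℝ => det2 (deriv a y.1) (deriv S.b y.2)) z := by
    have c1 : ContinuousAt (fun y : ℝ × ℝ => deriv a y.1) z :=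
      ((h.smooth _ h1).continuousAt_deriv_one).comp continuous_fst.continuousAt
    have c2 : ContinuousAt (fun y : ℝ × ℝ => deriv S.b y.2) z :=
      (S.continuousAt_deriv (S.T_subset h2)).comp continuous_snd.continuousAt
    exact (c1.fst.mul c2.snd).sub (c1.snd.mul c2.fst)
  have hs : ∀ᶠ y : ℝ × ℝ in 𝓝 z, det2 (deriv a y.1) (deriv S.b y.2) =
        Real.sign (det2 (deriv a z.1) (deriv S.b z.2)) *
          |det2 (deriv a y.1) (deriv S.b y.2)| := by
    rcases lt_or_gt_of_ne hd with hlt | hgt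
    · filter_upwards [hc.eventually (gt_mem_nhds hlt)] with y hy
      rw [Real.sign_of_neg hlt, abs_of_neg hy]; ring
    · filter_upwards [hc.eventually (lt_mem_nhds hgt)] with y hy
      rw [Real.sign_of_pos hgt, abs_of_pos hy]; ring
  obtain ⟨W, hW, hWo, hzW⟩ := _root_.eventually_nhds_iff.1 (hint.and (hinj.and (hw.and hs)))
  exact ⟨W, hWo, hzW, fun y hy => (hW y hy).1, hinj2.mono fun y hy => (hW y hy).2.1,
    fun y hy => (hW y hy).2.2.1, fun y hy => (hW y hy).2.2.2⟩

lemma image_mem_nhds (h : S.IsTransverseArc a s₀ s₁) {z : ℝ × ℝ}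
    (hz : z ∈ S.crossings a s₀ s₁) {W : Set (ℝ × ℝ)} (hW : W ∈ 𝓝 z) :
    (fun z : ℝ × ℝ => S.b z.2 - a z.1) '' W ∈ 𝓝 (0 : ℝ × ℝ) := by
  obtain ⟨h1, h2, h3⟩ := hz
  have hd := h.transverse _ h1 _ h2 h3
  have hf := h.hasStrictFDerivAt h1 (S.T_subset h2)
  set L := ((ContinuousLinearMap.fst ℝ ℝ ℝ).smulRight (-deriv a z.1) +
        (ContinuousLinearMap.snd ℝ ℝ ℝ).smulRight (deriv S.b z.2) : ℝ × ℝ →L[ℝ] ℝ × ℝ) with hL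
  have hLd : L.det ≠ 0 := by
    rw [hL, det_clm_columns, det_eq]; exact neg_ne_zero.2 hd
  obtain ⟨e, he⟩ : ∃ e : (ℝ × ℝ) ≃L[ℝ] ℝ × ℝ, (e : ℝ × ℝ →L[ℝ] ℝ × ℝ) = L :=
    ⟨L.toContinuousLinearEquivOfDetNeZero hLd, L.coe_toContinuousLinearEquivOfDetNeZero hLd⟩
  rw [← he] at hf
  have := hf.map_nhds_eq_of_equiv
  simp only [h3, sub_self] at this
  rw [← this]
  exact image_mem_map hW

lemma continuousOn (h : S.IsTransverseArc a s₀ s₁) :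
    ContinuousOn (fun z : ℝ × ℝ => S.b z.2 - a z.1) (Icc s₀ s₁ ×ˢ S.T) := fun _ hz =>
  (h.hasStrictFDerivAt hz.1 (S.T_subset hz.2)).continuousAt.continuousWithinAt

lemma finite_crossings (h : S.IsTransverseArc a s₀ s₁) : (S.crossings a s₀ s₁).Finite := by
  have hK : IsCompact (Icc s₀ s₁ ×ˢ S.T) := isCompact_Icc.prod S.isCompact_T
  have heq : S.crossings a s₀ s₁ =
      (Icc s₀ s₁ ×ˢ S.T) ∩ (fun z : ℝ × ℝ => S.b z.2 - a z.1) ⁻¹' {0} := by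
    ext z
    simp [crossings, sub_eq_zero, eq_comm (a := a z.1), and_assoc]
  have hcl : IsClosed (S.crossings a s₀ s₁) := by
    rw [heq]; exact h.continuousOn.preimage_isClosed_of_isClosed hK.isClosed isClosed_singleton
  have hc : IsCompact (S.crossings a s₀ s₁) :=
    hK.of_isClosed_subset hcl (by rw [heq]; exact inter_subset_left)
  refine hc.finite (isDiscrete_iff_forall_mem_exists_isOpen.2 ?_)
  intro z hz
  obtain ⟨W, hWo, hzW, -, hinj, -⟩ := h.exists_nhd hz
  refine ⟨W, hWo, ?_⟩
  ext y
  refine ⟨fun hy => hinj hy.1 hzW ?_, fun hy => ?_⟩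
  · simp [hy.2.2.2, hz.2.2]
  · rw [mem_singleton_iff.1 hy]; exact ⟨hzW, hz⟩

/-- Around the crossings, there are disjoint small neighbourhoods, away from which the arc and the
strand keep a positive distance. -/
lemma exists_separation (h : S.IsTransverseArc a s₀ s₁) :
    ∃ (V : ℝ × ℝ → Set (ℝ × ℝ)) (ε : ℝ), 0 < ε ∧
      (S.crossings a s₀ s₁).PairwiseDisjoint V ∧
      (∀ z ∈ S.crossings a s₀ s₁, IsOpen (V z) ∧ V z ⊆ Icc s₀ s₁ ×ˢ S.T ∧
        InjOn (fun z : ℝ × ℝ => S.b z.2 - a z.1) (V z) ∧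
        (∀ y ∈ V z, S.w y.2 = S.w z.2) ∧
        (∀ y ∈ V z, det2 (deriv a y.1) (deriv S.b y.2) =
          Real.sign (det2 (deriv a z.1) (deriv S.b z.2)) *
            |det2 (deriv a y.1) (deriv S.b y.2)|) ∧
        ball 0 ε ⊆ (fun z : ℝ × ℝ => S.b z.2 - a z.1) '' V z) ∧
      ∀ y ∈ Icc s₀ s₁ ×ˢ S.T, S.b y.2 - a y.1 ∈ ball (0 : ℝ × ℝ) ε →
        ∃ z ∈ S.crossings a s₀ s₁, y ∈ V z := by
  classical
  have hfin := h.finite_crossings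
  obtain ⟨U, hU, hdisj⟩ := hfin.t2_separation
  choose! W hWo hzW hWsub hinj hw hs using fun z (hz : z ∈ S.crossings a s₀ s₁) => h.exists_nhd hz
  set V : ℝ × ℝ → Set (ℝ × ℝ) := fun z => W z ∩ U z
  have hVo : ∀ z ∈ S.crossings a s₀ s₁, IsOpen (V z) := fun z hz => (hWo z hz).inter (hU z).2
  have hzV : ∀ z ∈ S.crossings a s₀ s₁, z ∈ V z := fun z hz => ⟨hzW z hz, (hU z).1⟩
  have e1 : ∀ᶠ ε in 𝓝[>] (0 : ℝ), ∀ z ∈ S.crossings a s₀ s₁,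
      ball 0 ε ⊆ (fun z : ℝ × ℝ => S.b z.2 - a z.1) '' V z := by
    rw [Filter.eventually_all_finite hfin]
    intro z hz
    obtain ⟨r, hr, hb⟩ := Metric.mem_nhds_iff.1 (h.image_mem_nhds hz ((hVo z hz).mem_nhds (hzV z hz)))
    filter_upwards [Ioo_mem_nhdsGT hr] with ε hε
    exact (ball_subset_ball hε.2.le).trans hb
  set K := (Icc s₀ s₁ ×ˢ S.T) \ ⋃ z ∈ S.crossings a s₀ s₁, V z with hK
  have hKc : IsCompact K := (isCompact_Icc.prod S.isCompact_T).diff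
    (isOpen_biUnion fun z hz => hVo z hz)
  have hKi : IsCompact ((fun z : ℝ × ℝ => S.b z.2 - a z.1) '' K) :=
    hKc.image_of_continuousOn (h.continuousOn.mono sdiff_subset)
  have h0 : (0 : ℝ × ℝ) ∉ (fun z : ℝ × ℝ => S.b z.2 - a z.1) '' K := by
    rintro ⟨y, hy, hy0⟩
    have hy' : y ∈ S.crossings a s₀ s₁ := ⟨hy.1.1, hy.1.2, (sub_eq_zero.1 hy0).symm⟩
    exact hy.2 (mem_biUnion hy' (hzV y hy'))
  obtain ⟨r, hr, hb⟩ := Metric.mem_nhds_iff.1 (hKi.isClosed.isOpen_compl.mem_nhds h0)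
  obtain ⟨ε, hε1, hε2, hε3⟩ :=
    (e1.and ((Ioo_mem_nhdsGT hr : Ioo 0 r ∈ 𝓝[>] (0 : ℝ)))).exists
  refine ⟨V, ε, hε2, hdisj.mono_on fun z _ => inter_subset_right, fun z hz => ⟨hVo z hz,
    fun y hy => hWsub z hz hy.1, (hinj z hz).mono inter_subset_left, fun y hy => hw z hz y hy.1,
    fun y hy => hs z hz y hy.1, hε1 z hz⟩, fun y hy hyε => ?_⟩
  by_contra hcon
  push Not at hcon
  refine hb (ball_subset_ball hε3.le hyε) ⟨y, ⟨hy, ?_⟩, rfl⟩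
  simpa using hcon

/-- For a smearing of small support, the integral of the smeared form along the arc is the weighted
number of crossings. -/
lemma exists_integral_smear_eq (h : S.IsTransverseArc a s₀ s₁) :
    ∃ ε > 0, ∀ φ : ℝ × ℝ → ℝ, Continuous φ → (∀ z, z ∉ ball (0 : ℝ × ℝ) ε → φ z = 0) →
      ∫ z, φ z = 1 →
      ∫ s in s₀..s₁, S.smear φ (a s) (deriv a s) =
        ∑ᶠ z ∈ S.crossings a s₀ s₁,
          Real.sign (det2 (deriv a z.1) (deriv S.b z.2)) * S.w z.2 := by
  classical
  obtain ⟨V, ε, hε, hdisj, hV, hsep⟩ := h.exists_separation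
  refine ⟨ε, hε, fun φ hφ hsupp hone => ?_⟩
  set g : ℝ × ℝ → ℝ := fun y => S.w y.2 * φ (S.b y.2 - a y.1) * det2 (deriv a y.1) (deriv S.b y.2)
    with hg
  have hgc : ContinuousOn g (Icc s₀ s₁ ×ˢ S.T) := by
    intro y hy
    have hO := S.T_subset hy.2
    have c1 : ContinuousAt (fun y : ℝ × ℝ => deriv a y.1) y :=
      ((h.smooth _ hy.1).continuousAt_deriv_one).comp continuous_fst.continuousAt
    have c2 : ContinuousAt (fun y : ℝ × ℝ => deriv S.b y.2) y :=
      (S.continuousAt_deriv hO).comp continuous_snd.continuousAt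
    have c3 : ContinuousAt (fun y : ℝ × ℝ => det2 (deriv a y.1) (deriv S.b y.2)) y :=
      (c1.fst.mul c2.snd).sub (c1.snd.mul c2.fst)
    have c4 : ContinuousAt (fun y : ℝ × ℝ => S.w y.2) y :=
      (S.continuousAt_w hO).comp continuous_snd.continuousAt
    have c5 : ContinuousAt (fun y : ℝ × ℝ => φ (S.b y.2 - a y.1)) y :=
      hφ.continuousAt.comp (h.hasStrictFDerivAt hy.1 hO).continuousAt
    exact ((c4.mul c5).mul c3).continuousWithinAt
  have hKc : IsCompact (Icc s₀ s₁ ×ˢ S.T) := isCompact_Icc.prod S.isCompact_T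
  have hgi : IntegrableOn g (Icc s₀ s₁ ×ˢ S.T) (volume.prod volume) :=
    hgc.integrableOn_compact hKc
  have hinner : ∀ s ∈ Icc s₀ s₁, S.smear φ (a s) (deriv a s) = ∫ t in S.T, g (s, t) := by
    intro s hs
    have hi : IntegrableOn (fun t => (S.w t * φ (S.b t - a s)) • det2L (deriv S.b t)) S.T := by
      refine ContinuousOn.integrableOn_compact S.isCompact_T ?_
      intro t ht
      have hO := S.T_subset ht
      exact (((S.continuousAt_w hO).mul (hφ.continuousAt.comp
        ((S.continuousAt_b hO).sub continuousAt_const))).smul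
        (continuous_det2L.continuousAt.comp (S.continuousAt_deriv hO))).continuousWithinAt
    rw [smear, ContinuousLinearMap.integral_apply hi]
    simp [g]
  rw [intervalIntegral.integral_of_le h.le, ← integral_Icc_eq_integral_Ioc,
    setIntegral_congr_fun measurableSet_Icc hinner, ← setIntegral_prod g hgi]
  have hfin := h.finite_crossings
  set Z : Finset (ℝ × ℝ) := hfin.toFinset with hZ
  have hmemZ : ∀ z, z ∈ Z ↔ z ∈ S.crossings a s₀ s₁ := fun z => hfin.mem_toFinset
  have hsub : (⋃ z ∈ Z, V z) ⊆ Icc s₀ s₁ ×ˢ S.T :=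
    iUnion₂_subset fun z hz => (hV z ((hmemZ z).1 hz)).2.1
  rw [setIntegral_eq_of_subset_of_forall_sdiff_eq_zero hKc.measurableSet hsub]
  · rw [integral_biUnion_finset]
    · rw [finsum_mem_eq_finite_toFinset_sum _ hfin]
      refine Finset.sum_congr rfl fun z hz => ?_
      obtain ⟨hVo, hVs, hinj, hw, hs, hball⟩ := hV z ((hmemZ z).1 hz)
      have hcv := integral_image_eq_integral_abs_det_fderiv_smul (volume : Measure (ℝ × ℝ))
        hVo.measurableSet (fun y hy => ((h.hasStrictFDerivAt (hVs hy).1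
          (S.T_subset (hVs hy).2)).hasFDerivAt).hasFDerivWithinAt) hinj φ
      have hone' : ∫ x in (fun z : ℝ × ℝ => S.b z.2 - a z.1) '' V z, φ x = 1 := by
        rw [setIntegral_eq_integral_of_forall_compl_eq_zero, hone]
        intro x hx
        exact hsupp x fun hx' => hx (hball hx')
      rw [hone'] at hcv
      rw [← Measure.volume_eq_prod, ← mul_one (Real.sign _ * _), hcv, ← integral_const_mul]
      refine setIntegral_congr_fun hVo.measurableSet fun y hy => ?_
      simp only [g, det_clm_columns, det_eq, abs_neg, smul_eq_mul]
      rw [hw y hy, hs y hy]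
      simp only [abs_mul, abs_abs]
      rcases Real.sign_apply_eq (det2 (deriv a z.1) (deriv S.b z.2)) with e | e | e <;>
        rw [e] <;> simp <;> ring
    · exact fun z hz => (hV z ((hmemZ z).1 hz)).1.measurableSet
    · intro x hx y hy hxy
      exact hdisj ((hmemZ x).1 hx) ((hmemZ y).1 hy) hxy
    · exact fun z hz => hgi.mono_set (hV z ((hmemZ z).1 hz)).2.1
  · rintro y ⟨hy, hy'⟩
    simp only [g]
    rw [hsupp, mul_zero, zero_mul]
    intro hyε
    obtain ⟨z, hz, hyz⟩ := hsep y hy hyε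
    exact hy' (mem_biUnion ((hmemZ z).2 hz) hyz)

/-- The weighted number of crossings only depends on the ends of the arc. -/
theorem sum_crossings_eq (hR : 0 < R) (h : S.IsTransverseArc a s₀ s₁) {a' : ℝ → ℝ × ℝ}
    {s₀' s₁' : ℝ} (h' : S.IsTransverseArc a' s₀' s₁') (h0 : a s₀ = a' s₀') (h1 : a s₁ = a' s₁') :
    ∑ᶠ z ∈ S.crossings a s₀ s₁, Real.sign (det2 (deriv a z.1) (deriv S.b z.2)) * S.w z.2 =
      ∑ᶠ z ∈ S.crossings a' s₀' s₁',
        Real.sign (det2 (deriv a' z.1) (deriv S.b z.2)) * S.w z.2 := by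
  obtain ⟨ε, hε, H⟩ := h.exists_integral_smear_eq
  obtain ⟨ε', hε', H'⟩ := h'.exists_integral_smear_eq
  set r := min R (min ε ε') with hr
  have hrpos : 0 < r := lt_min hR (lt_min hε hε')
  let f : ContDiffBump (0 : ℝ × ℝ) := ⟨r / 2, r, by positivity, by linarith⟩
  set φ : ℝ × ℝ → ℝ := f.normed volume with hφ
  have hsupp : ∀ z, z ∉ ball (0 : ℝ × ℝ) r → φ z = 0 := by
    intro z hz
    rw [← Function.notMem_support, f.support_normed_eq]
    exact hz
  have hsm : ContDiff ℝ 1 φ := f.contDiff_normed (n := 1)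
  have hcs : HasCompactSupport φ := f.hasCompactSupport_normed
  have hint : ∫ z, φ z = 1 := f.integral_normed
  obtain ⟨G, hG⟩ := S.exists_primitive_smear hsm hcs (fun z hz => hsupp z (by
    rw [Metric.mem_ball, dist_zero_right, not_lt]; exact (min_le_left _ _).trans hz))
  have main : ∀ {a : ℝ → ℝ × ℝ} {s₀ s₁ : ℝ}, S.IsTransverseArc a s₀ s₁ →
      ∫ s in s₀..s₁, S.smear φ (a s) (deriv a s) = G (a s₁) - G (a s₀) := by
    intro a s₀ s₁ h
    have hd : ∀ s ∈ uIcc s₀ s₁, HasDerivAt (fun s => G (a s)) (S.smear φ (a s) (deriv a s)) s := by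
      intro s hs
      rw [uIcc_of_le h.le] at hs
      exact (hG _ (h.mem_ball s hs)).comp_hasDerivAt s
        ((h.smooth s hs).differentiableAt (by norm_num)).hasDerivAt
    refine intervalIntegral.integral_eq_sub_of_hasDerivAt hd (ContinuousOn.intervalIntegrable ?_)
    intro s hs
    rw [uIcc_of_le h.le] at hs
    exact (((S.hasFDerivAt_smear hsm hcs (a s)).continuousAt.comp
      (h.smooth s hs).continuousAt).clm_apply
      (h.smooth s hs).continuousAt_deriv_one).continuousWithinAt
  rw [← H φ hsm.continuous (fun z hz => hsupp z fun hz' => hz (ball_subset_ball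
      ((min_le_right _ _).trans (min_le_left _ _)) hz')) hint,
    ← H' φ hsm.continuous (fun z hz => hsupp z fun hz' => hz (ball_subset_ball
      ((min_le_right _ _).trans (min_le_right _ _)) hz')) hint, main h, main h', h0, h1]

end IsTransverseArc
end PlanarStrand
end

noncomputable section

/-! ### Local cocycles and homotopy invariance -/

section Cocycle

open Set Filter Topology unitInterval

variable {Y G : Type*} [Monoid G]

/-- The product of the values of `u` on the consecutive pairs of a sequence. -/
def chainProd (u : Y → Y → G) (x : ℕ → Y) : ℕ → G
  | 0 => 1
  | n + 1 => u (x n) (x (n + 1)) * chainProd u x n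

variable [PseudoMetricSpace Y]

/-- A multiplicative cocycle, defined at scale `δ` on the set `S`. -/
structure IsLocalCocycle (u : Y → Y → G) (S : Set Y) (δ : ℝ) : Prop where
  pos : 0 < δ
  refl : ∀ p ∈ S, u p p = 1
  mul : ∀ p ∈ S, ∀ q ∈ S, ∀ r ∈ S, dist p q < δ → dist q r < δ → dist p r < δ →
    u q r * u p q = u p r

variable {u : Y → Y → G} {δ : ℝ}

lemma IsLocalCocycle.chainProd_comm (hu : IsLocalCocycle u univ δ) {x y : ℕ → Y} {n : ℕ}
    (h : ∀ i < n, dist (x i) (x (i + 1)) < δ ∧ dist (y i) (y (i + 1)) < δ ∧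
      dist (x i) (y (i + 1)) < δ) (h' : ∀ i ≤ n, dist (x i) (y i) < δ) :
    u (x n) (y n) * chainProd u x n = chainProd u y n * u (x 0) (y 0) := by
  induction n with
  | zero => simp [chainProd]
  | succ n ih =>
    have ih := ih (fun i hi => h i (by omega)) (fun i hi => h' i (by omega))
    obtain ⟨h1, h2, h3⟩ := h n (by omega)
    simp only [chainProd]
    rw [← mul_assoc, hu.mul _ trivial _ trivial _ trivial h1 (h' _ le_rfl) h3,
      ← hu.mul _ trivial _ trivial _ trivial (h' n (by omega)) h2 h3, mul_assoc, ih, mul_assoc]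

lemma IsLocalCocycle.exists_extension {S : Set Y} (hu : IsLocalCocycle u S δ) (hS : Dense S) :
    ∃ u' : Y → Y → G, IsLocalCocycle u' univ (δ / 3) ∧ ∀ p ∈ S, ∀ q ∈ S, u' p q = u p q := by
  classical
  have hδ := hu.pos
  have : ∀ y : Y, ∃ p ∈ S, dist y p < δ / 3 ∧ (y ∈ S → p = y) := by
    intro y
    by_cases hy : y ∈ S
    · exact ⟨y, hy, by simpa using hδ, fun _ => rfl⟩
    · obtain ⟨p, hp, h⟩ := Metric.dense_iff.1 hS y (δ / 3) (by positivity)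
      exact ⟨p, h, by rw [dist_comm]; exact hp, fun h => absurd h hy⟩
  choose ρ h1 h2 h3 using this
  have key : ∀ p q, dist p q < δ / 3 → dist (ρ p) (ρ q) < δ := fun p q h => by
    have a1 := dist_triangle (ρ p) p (ρ q)
    have a2 := dist_triangle p q (ρ q)
    have a3 := h2 p
    rw [dist_comm] at a3
    have := h2 q
    linarith
  refine ⟨fun p q => u (ρ p) (ρ q), ⟨by positivity, fun p _ => hu.refl _ (h1 p),
    fun p _ q _ r _ hpq hqr hpr => hu.mul _ (h1 p) _ (h1 q) _ (h1 r) (key _ _ hpq) (key _ _ hqr)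
      (key _ _ hpr)⟩, fun p hp q hq => by simp only [h3 p hp, h3 q hq]⟩

lemma IsLocalCocycle.chainProd_homotopy (hu : IsLocalCocycle u univ δ) {p q : Y}
    {γ γ' : Path p q} (h : γ.Homotopic γ') :
    ∀ᶠ n : ℕ in atTop, chainProd u (fun i => γ.extend (i / n)) n =
      chainProd u (fun i => γ'.extend (i / n)) n := by
  obtain ⟨H⟩ := h
  set K : ℝ × ℝ → Y := fun z => H (projIcc 0 1 zero_le_one z.1, projIcc 0 1 zero_le_one z.2) with hK
  have hKu : UniformContinuous K :=
    (CompactSpace.uniformContinuous_of_continuous H.continuous).comp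
      ((LipschitzWith.projIcc zero_le_one).uniformContinuous.comp uniformContinuous_fst |>.prodMk
        ((LipschitzWith.projIcc zero_le_one).uniformContinuous.comp uniformContinuous_snd))
  obtain ⟨η, hη, hKη⟩ := Metric.uniformContinuous_iff.1 hKu δ hu.pos
  have hlim : ∀ᶠ n : ℕ in atTop, (1 : ℝ) / n < η :=
    (tendsto_const_div_atTop_nhds_zero_nat (1 : ℝ)).eventually (gt_mem_nhds hη)
  filter_upwards [hlim, eventually_gt_atTop 0] with n hn hn0
  have hn0' : (0 : ℝ) < n := by exact_mod_cast hn0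
  have hstep : ∀ k : ℕ, |((k : ℝ) / n) - ((k + 1 : ℕ) : ℝ) / n| < η := by
    intro k
    have : ((k : ℝ) / n) - ((k + 1 : ℕ) : ℝ) / n = -(1 / n) := by push_cast; ring
    rw [this, abs_neg, abs_of_pos (by positivity)]
    exact hn
  have hd : ∀ a b a' b' : ℝ, |a - a'| < η → |b - b'| < η → dist (K (a, b)) (K (a', b')) < δ := by
    intro a b a' b' h1 h2
    apply hKη
    rw [Prod.dist_eq]
    exact max_lt h1 h2
  have hself : ∀ a : ℝ, |a - a| < η := by simpa using hη
  have hall : ∀ k : ℕ, chainProd u (fun i => K (((k : ℕ) : ℝ) / n, i / n)) n =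
      chainProd u (fun i => K (0, i / n)) n := by
    intro k
    induction k with
    | zero => simp
    | succ k ih =>
      rw [← ih]
      have := hu.chainProd_comm (x := fun i => K ((k : ℝ) / n, i / n))
        (y := fun i => K (((k + 1 : ℕ) : ℝ) / n, i / n)) (n := n)
        (fun i _ => ⟨hd _ _ _ _ (hself _) (hstep i), hd _ _ _ _ (hself _) (hstep i),
          hd _ _ _ _ (hstep k) (hstep i)⟩) (fun i _ => hd _ _ _ _ (hstep k) (hself _))
      have e1 : ∀ a : ℝ, K (a, ((n : ℕ) : ℝ) / n) = q := by
        intro a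
        simp [K, div_self hn0'.ne', projIcc_right]
      have e0 : ∀ a : ℝ, K (a, ((0 : ℕ) : ℝ) / n) = p := by
        intro a
        simp [K, projIcc_left]
      rw [e1, e1, e0, e0, hu.refl _ trivial, hu.refl _ trivial, one_mul, mul_one] at this
      exact this.symm
  have h0 : ∀ b : ℝ, K (0, b) = γ.extend b := by
    intro b
    simp [K, projIcc_left, Path.extend, IccExtend]
  have h1 : ∀ b : ℝ, K (1, b) = γ'.extend b := by
    intro b
    simp [K, projIcc_right, Path.extend, IccExtend]
  have := hall n
  rw [div_self hn0'.ne'] at this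
  simp only [h0, h1] at this
  exact this.symm

/-- A functional `V` on the subintervals of `[0, 1]` with ends in `A` that is given, on short
intervals, by the values of `u` at the ends of the curve `c`. -/
structure IsHolonomy (u : Y → Y → G) (c : ℝ → Y) (A : Set ℝ) (V : ℝ → ℝ → G) : Prop where
  zero_mem : (0 : ℝ) ∈ A
  one_mem : (1 : ℝ) ∈ A
  dense : ∀ a b : ℝ, 0 ≤ a → b ≤ 1 → a < b → ∃ s ∈ A, a < s ∧ s < b
  refl : ∀ s ∈ A, V s s = 1
  mul : ∀ s ∈ A, ∀ s' ∈ A, ∀ s'' ∈ A, 0 ≤ s → s ≤ s' → s' ≤ s'' → s'' ≤ 1 →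
    V s' s'' * V s s' = V s s''
  short : ∃ η > 0, ∀ s ∈ A, ∀ s' ∈ A, 0 ≤ s → s ≤ s' → s' ≤ 1 → s' - s < η →
    V s s' = u (c s) (c s')

lemma IsLocalCocycle.holonomy_eq (hu : IsLocalCocycle u univ δ) {p q : Y} {γ : Path p q}
    {A : Set ℝ} {V : ℝ → ℝ → G} (hV : IsHolonomy u γ.extend A V) :
    ∀ᶠ n : ℕ in atTop, V 0 1 = chainProd u (fun i => γ.extend (i / n)) n := by
  obtain ⟨η, hη, hshort⟩ := hV.short
  have hcu : UniformContinuous γ.extend :=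
    (CompactSpace.uniformContinuous_of_continuous γ.continuous).comp
      (LipschitzWith.projIcc zero_le_one).uniformContinuous
  obtain ⟨η', hη', hc⟩ := Metric.uniformContinuous_iff.1 hcu δ hu.pos
  have hlim : ∀ᶠ n : ℕ in atTop, (2 : ℝ) / n < min η η' :=
    (tendsto_const_div_atTop_nhds_zero_nat (2 : ℝ)).eventually (gt_mem_nhds (lt_min hη hη'))
  filter_upwards [hlim, eventually_gt_atTop 0] with n hn hn0
  have hn0' : (0 : ℝ) < n := by exact_mod_cast hn0
  have hdiv : ∀ i : ℕ, ((i + 1 : ℕ) : ℝ) / n = i / n + 1 / n := fun i => by push_cast; ring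
  have hone : (1 : ℝ) / n > 0 := by positivity
  have htwo : (2 : ℝ) / n = 1 / n + 1 / n := by ring
  have hex : ∀ i : ℕ, ∃ s, i ≤ n → s ∈ A ∧ (i : ℝ) / n - 1 / n < s ∧ s ≤ i / n ∧ 0 ≤ s ∧ s ≤ 1 ∧
      (i = 0 → s = 0) ∧ (i = n → s = 1) := by
    intro i
    by_cases h0 : i = 0
    · refine ⟨0, fun _ => ⟨hV.zero_mem, by simp [h0, hn0], by simp [h0], le_rfl, zero_le_one,
        fun _ => rfl, fun h => by omega⟩⟩
    by_cases h1 : i = n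
    · refine ⟨1, fun _ => ⟨hV.one_mem, ?_, ?_, zero_le_one, le_rfl, fun h => absurd h h0,
        fun _ => rfl⟩⟩
      · rw [h1, div_self hn0'.ne']; linarith
      · rw [h1, div_self hn0'.ne']
    by_cases hi : i ≤ n
    · have hi1 : (1 : ℝ) ≤ i := by exact_mod_cast Nat.one_le_iff_ne_zero.2 h0
      have hin : (i : ℝ) ≤ n := by exact_mod_cast hi
      have a1 : (1 : ℝ) / n ≤ i / n := by gcongr
      have a2 : (i : ℝ) / n ≤ 1 := (div_le_one hn0').2 hin
      obtain ⟨s, hs, hs1, hs2⟩ := hV.dense ((i : ℝ) / n - 1 / n) (i / n) (by linarith) a2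
        (by linarith)
      exact ⟨s, fun _ => ⟨hs, hs1, hs2.le, by linarith, by linarith, fun h => absurd h h0,
        fun h => absurd h h1⟩⟩
    · exact ⟨0, fun h => absurd h hi⟩
  choose τ hτ using hex
  have hmono : ∀ i < n, τ i ≤ τ (i + 1) ∧ τ (i + 1) - τ i < 2 / n := by
    intro i hi
    obtain ⟨-, a1, a2, -, -, -, -⟩ := hτ i hi.le
    obtain ⟨-, b1, b2, -, -, -, -⟩ := hτ (i + 1) hi
    rw [hdiv] at b1 b2
    constructor <;> linarith
  have hprod : ∀ k ≤ n, V 0 (τ k) = chainProd u (fun i => γ.extend (τ i)) k := by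
    intro k
    induction k with
    | zero =>
      intro h
      rw [(hτ 0 h).2.2.2.2.2.1 rfl, hV.refl _ hV.zero_mem]
      rfl
    | succ k ih =>
      intro h
      obtain ⟨m1, m2⟩ := hmono k h
      have a := hτ k (by omega)
      have b := hτ (k + 1) h
      rw [chainProd, ← ih (by omega), ← hshort _ a.1 _ b.1 a.2.2.2.1 m1 b.2.2.2.2.1
        (m2.trans (hn.trans_le (min_le_left _ _))), hV.mul _ hV.zero_mem _ a.1 _ b.1 le_rfl
        a.2.2.2.1 m1 b.2.2.2.2.1]
  have hclose : ∀ a b : ℝ, |a - b| < 2 / n → dist (γ.extend a) (γ.extend b) < δ := fun a b h =>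
    hc (h.trans (hn.trans_le (min_le_right _ _)))
  have hfin := hu.chainProd_comm (x := fun i => γ.extend (τ i)) (y := fun i => γ.extend (i / n))
    (n := n) (fun i hi => by
      obtain ⟨m1, m2⟩ := hmono i hi
      have a := hτ i hi.le
      refine ⟨hclose _ _ ?_, hclose _ _ ?_, hclose _ _ ?_⟩
      · rw [abs_sub_comm, abs_of_nonneg (by linarith)]; exact m2
      · rw [hdiv, abs_sub_comm, abs_of_nonneg (by linarith)]; linarith
      · rw [hdiv, abs_sub_comm, abs_of_nonneg (by linarith [a.2.2.1])]; linarith [a.2.1])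
    (fun i hi => by
      have a := hτ i hi
      refine hclose _ _ ?_
      rw [abs_sub_comm, abs_of_nonneg (by linarith [a.2.2.1])]; linarith [a.2.1])
  have h1 := (hτ n le_rfl).2.2.2.2.2.2 rfl
  have h0 := (hτ 0 (by omega)).2.2.2.2.2.1 rfl
  have hp := hprod n le_rfl
  rw [h1] at hp
  rw [hp]
  simp only [h1, h0, div_self hn0'.ne', Nat.cast_zero, zero_div, hu.refl _ (mem_univ _), one_mul,
    mul_one] at hfin
  exact hfin

/-- Functionals on paths which are locally given by a cocycle on a dense set are homotopy
invariant. -/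
theorem IsLocalCocycle.holonomy_homotopy_invariant {S : Set Y} (hu : IsLocalCocycle u S δ)
    (hS : Dense S) {p q : Y} {γ γ' : Path p q} (h : γ.Homotopic γ') {A A' : Set ℝ}
    {V V' : ℝ → ℝ → G} (hV : IsHolonomy u γ.extend A V) (hV' : IsHolonomy u γ'.extend A' V')
    (hA : ∀ s ∈ A, γ.extend s ∈ S) (hA' : ∀ s ∈ A', γ'.extend s ∈ S) : V 0 1 = V' 0 1 := by
  obtain ⟨u', hu', heq⟩ := hu.exists_extension hS
  have h1 : IsHolonomy u' γ.extend A V := { hV with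
    short := hV.short.imp fun η hη => ⟨hη.1, fun s hs s' hs' a b c d => by
      rw [heq _ (hA s hs) _ (hA s' hs'), hη.2 s hs s' hs' a b c d]⟩ }
  have h2 : IsHolonomy u' γ'.extend A' V' := { hV' with
    short := hV'.short.imp fun η hη => ⟨hη.1, fun s hs s' hs' a b c d => by
      rw [heq _ (hA' s hs) _ (hA' s' hs'), hη.2 s hs s' hs' a b c d]⟩ }
  obtain ⟨n, e1, e2, e3⟩ := ((hu'.holonomy_eq h1).and ((hu'.holonomy_eq h2).and
    (hu'.chainProd_homotopy h))).exists
  rw [e1, e2, e3]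

end Cocycle

/-! ### Transport of paths to the base point -/

section Transport

open Set

variable {M : Type*} [TopologicalSpace M]

/-- Any two paths in the set `N` with the same ends are homotopic in the whole space. -/
def IsThin (N : Set M) : Prop :=
  ∀ ⦃p q : M⦄ (γ γ' : Path p q), (∀ t, γ t ∈ N) → (∀ t, γ' t ∈ N) → γ.Homotopic γ'

lemma isThin_preimage {E : Type*} [NormedAddCommGroup E] [NormedSpace ℝ E]
    (e : OpenPartialHomeomorph M E) {C : Set E} (hC : Convex ℝ C) (hCe : C ⊆ e.target) :
    IsThin (e.source ∩ e ⁻¹' C) := by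
  intro p q γ γ' h h'
  have : Nonempty C := ⟨⟨e p, by simpa using (h 0).2⟩⟩
  have : ContractibleSpace C := hC.contractibleSpace ⟨_, this.some.2⟩
  let g : C(C, M) := ⟨fun y => e.symm y, e.continuousOn_symm.comp_continuous
    continuous_subtype_val fun y => hCe y.2⟩
  have hp : e p ∈ C := by simpa using (h 0).2
  have hq : e q ∈ C := by simpa using (h 1).2
  have lift : ∀ γ : Path p q, (∀ t, γ t ∈ e.source ∩ e ⁻¹' C) →
      ∃ δ : Path (⟨e p, hp⟩ : C) ⟨e q, hq⟩, ∀ t, g (δ t) = γ t := by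
    intro γ h
    refine ⟨⟨⟨fun t => ⟨e (γ t), (h t).2⟩, ?_⟩, ?_, ?_⟩, fun t => e.left_inv (h t).1⟩
    · exact (e.continuousOn.comp_continuous γ.continuous fun t => (h t).1).subtype_mk _
    · simp
    · simp
  obtain ⟨δ, hδ⟩ := lift γ h
  obtain ⟨δ', hδ'⟩ := lift γ' h'
  have hp' : p = g ⟨e p, hp⟩ := by simpa using (hδ 0).symm
  have hq' : q = g ⟨e q, hq⟩ := by simpa using (hδ 1).symm
  have hm := ((SimplyConnectedSpace.paths_homotopic δ δ').map g).pathCast hp' hq'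
  convert hm using 1
  · ext t; exact (hδ t).symm
  · ext t; exact (hδ' t).symm

variable [PathConnectedSpace M] (x₀ : M)

/-- The element of the fundamental group at `x₀` defined by a path, with the help of a choice
of paths from `x₀` to all the points. -/
def elt {p q : M} (γ : Path p q) : FundamentalGroup M x₀ :=
  FundamentalGroup.fromPath (((Path.Homotopic.Quotient.mk (PathConnectedSpace.somePath x₀ p)).trans
    (Path.Homotopic.Quotient.mk γ)).trans (Path.Homotopic.Quotient.mk (PathConnectedSpace.somePath x₀ q)).symm)

lemma elt_eq_of_homotopic {p q : M} {γ γ' : Path p q} (h : γ.Homotopic γ') :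
    elt x₀ γ = elt x₀ γ' := by
  unfold elt; rw [Path.Homotopic.Quotient.eq.2 h]

lemma elt_trans {p q r : M} (γ : Path p q) (γ' : Path q r) :
    elt x₀ (γ.trans γ') = elt x₀ γ' * elt x₀ γ := by
  rw [FundamentalGroup.mul_def]
  have hc' : ∀ {a b c : M} (P : Path.Homotopic.Quotient a b) (A : Path.Homotopic.Quotient b c),
      P.symm.trans (P.trans A) = A := fun P A => by
    rw [← Path.Homotopic.Quotient.trans_assoc, Path.Homotopic.Quotient.symm_trans,
      Path.Homotopic.Quotient.refl_trans]
  simp only [elt, Path.Homotopic.Quotient.mk_trans, Path.Homotopic.Quotient.trans_assoc, hc']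

lemma elt_refl (p : M) : elt x₀ (Path.refl p) = 1 := by
  rw [FundamentalGroup.one_def]
  simp only [elt, Path.Homotopic.Quotient.mk_refl, Path.Homotopic.Quotient.trans_refl, Path.Homotopic.Quotient.trans_symm]

@[simp] lemma elt_cast {p q p' q' : M} (γ : Path p q) (hp : p' = p) (hq : q' = q) :
    elt x₀ (γ.cast hp hq) = elt x₀ γ := by
  subst hp hq; rfl

lemma elt_congr {p q p' q' : M} {γ : Path p q} {γ' : Path p' q'} (h : ∀ t, γ t = γ' t) :
    elt x₀ γ = elt x₀ γ' := by
  obtain rfl : p = p' := by simpa using h 0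
  obtain rfl : q = q' := by simpa using h 1
  congr 1
  ext t; exact h t

lemma homotopic_of_elt_eq {p q : M} {γ γ' : Path p q} (h : elt x₀ γ = elt x₀ γ') :
    γ.Homotopic γ' := by
  rw [← Path.Homotopic.Quotient.eq]
  unfold elt at h
  have h1 := congrArg (fun a : Path.Homotopic.Quotient x₀ x₀ =>
    ((Path.Homotopic.Quotient.mk (PathConnectedSpace.somePath x₀ p)).symm.trans a).trans
      (Path.Homotopic.Quotient.mk (PathConnectedSpace.somePath x₀ q))) h
  simpa [Path.Homotopic.Quotient.trans_assoc, ← Path.Homotopic.Quotient.trans_assoc _ _ (Path.Homotopic.Quotient.trans _ _)] using h1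

lemma exists_elt_eq (p q : M) (g : FundamentalGroup M x₀) : ∃ γ : Path p q, elt x₀ γ = g := by
  obtain ⟨γ, hγ⟩ := Path.Homotopic.Quotient.mk_surjective
    (((Path.Homotopic.Quotient.mk (PathConnectedSpace.somePath x₀ p)).symm.trans
      (FundamentalGroup.toPath g)).trans (Path.Homotopic.Quotient.mk (PathConnectedSpace.somePath x₀ q)))
  refine ⟨γ, ?_⟩
  unfold elt
  rw [hγ]
  simp [Path.Homotopic.Quotient.trans_assoc, ← Path.Homotopic.Quotient.trans_assoc _ _ (Path.Homotopic.Quotient.trans _ _)]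

lemma freeClass_eq {y : M} (l : Path y y) : freeClass x₀ l = ConjClasses.mk (elt x₀ l) := by
  unfold freeClass
  rw [ConjClasses.mk_eq_mk_iff_isConj, isConj_iff]
  have hc : ∀ {a b c : M} (P : Path.Homotopic.Quotient a b) (A : Path.Homotopic.Quotient a c),
      P.trans (P.symm.trans A) = A := fun P A => by
    rw [← Path.Homotopic.Quotient.trans_assoc, Path.Homotopic.Quotient.trans_symm,
      Path.Homotopic.Quotient.refl_trans]
  set P := Path.Homotopic.Quotient.mk (PathConnectedSpace.somePath y x₀) with hP
  set τ := Path.Homotopic.Quotient.mk (PathConnectedSpace.somePath x₀ y) with hτ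
  refine ⟨FundamentalGroup.fromPath (P.symm.trans τ.symm), ?_⟩
  rw [mul_inv_eq_iff_eq_mul, FundamentalGroup.mul_def, FundamentalGroup.mul_def]
  have h1 : (FundamentalGroup.fundamentalGroupMulEquivOfPathConnected y x₀)
      (FundamentalGroup.fromPath (Path.Homotopic.Quotient.mk l)) =
      P.symm.trans ((Path.Homotopic.Quotient.mk l).trans P) := rfl
  rw [h1, elt]
  simp only [Path.Homotopic.Quotient.trans_assoc, hc]
  rw [← hτ, ← Path.Homotopic.Quotient.trans_assoc τ.symm,
    Path.Homotopic.Quotient.symm_trans, Path.Homotopic.Quotient.refl_trans]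

/-- The element of the fundamental group defined by the part of a curve between two times. -/
def tr (f : C(ℝ, M)) (s t : ℝ) : FundamentalGroup M x₀ :=
  elt x₀ ((PathConnectedSpace.somePath s t).map f.continuous)

lemma elt_map_eq_tr (f : C(ℝ, M)) {s t : ℝ} (γ : Path s t) :
    elt x₀ (γ.map f.continuous) = tr x₀ f s t :=
  elt_eq_of_homotopic x₀ ((SimplyConnectedSpace.paths_homotopic _ _).map f)

lemma tr_mul (f : C(ℝ, M)) (s t u : ℝ) : tr x₀ f t u * tr x₀ f s t = tr x₀ f s u := by
  rw [tr, tr, ← elt_trans, ← Path.map_trans, elt_map_eq_tr]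

@[simp] lemma tr_self (f : C(ℝ, M)) (s : ℝ) : tr x₀ f s s = 1 := by
  exact mul_eq_left.1 (tr_mul x₀ f s s s)

lemma tr_inv (f : C(ℝ, M)) (s t : ℝ) : (tr x₀ f s t)⁻¹ = tr x₀ f t s := by
  rw [inv_eq_iff_mul_eq_one, tr_mul, tr_self]

lemma tr_comp (f : C(ℝ, M)) (σ : C(ℝ, ℝ)) (s t : ℝ) :
    tr x₀ (f.comp σ) s t = tr x₀ f (σ s) (σ t) := by
  rw [← elt_map_eq_tr x₀ f ((PathConnectedSpace.somePath s t).map σ.continuous)]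
  rfl

lemma tr_periodic {f : C(ℝ, M)} (hf : Function.Periodic f 1) (s t : ℝ) :
    tr x₀ f (s + 1) (t + 1) = tr x₀ f s t := by
  have h : f.comp ⟨fun s => s + 1, by fun_prop⟩ = f := by ext s; exact hf s
  conv_rhs => rw [← h, tr_comp]
  rfl

end Transport
end

noncomputable section

/-! ### Curves in the surface and their crossings -/

open Set Filter Topology

/-- The identification of the Euclidean plane with `ℝ × ℝ`. -/
def planeEquiv : Plane ≃L[ℝ] ℝ × ℝ :=
  (EuclideanSpace.equiv (Fin 2) ℝ).trans (ContinuousLinearEquiv.finTwoArrow ℝ ℝ)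

lemma planeEquiv_apply (v : Plane) : planeEquiv v = (v 0, v 1) := rfl

lemma det2_planeEquiv_map (D : Plane →L[ℝ] Plane) (v w : Plane) :
    det2 (planeEquiv (D v)) (planeEquiv (D w)) = D.det * det2 (planeEquiv v) (planeEquiv w) := by
  have key : ∀ v : Plane, D v = v 0 • D (EuclideanSpace.single 0 1) +
      v 1 • D (EuclideanSpace.single 1 1) := by
    intro v
    rw [← map_smul, ← map_smul, ← map_add]
    congr 1
    ext i
    fin_cases i <;> simp
  rw [ContinuousLinearMap.det,
    ← LinearMap.det_toMatrix (EuclideanSpace.basisFun (Fin 2) ℝ).toBasis, Matrix.det_fin_two,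
    key v, key w]
  simp [LinearMap.toMatrix_apply, det2, planeEquiv_apply]
  ring

/-- A smooth curve in the surface, parametrised by the real line. -/
structure Curve (M : Type*) [TopologicalSpace M] [ChartedSpace Plane M] where
  toFun : ℝ → M
  smooth : ContMDiff 𝓘(ℝ) (𝓡 2) ∞ toFun

section

variable {M : Type*} [TopologicalSpace M] [ChartedSpace Plane M]

namespace Curve

instance : CoeFun (Curve M) (fun _ => ℝ → M) := ⟨toFun⟩

lemma continuous (f : Curve M) : Continuous f := f.smooth.continuous

/-- The underlying continuous map. -/
def cont (f : Curve M) : C(ℝ, M) := ⟨f, f.continuous⟩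

@[simp] lemma cont_apply (f : Curve M) (s : ℝ) : f.cont s = f s := rfl

/-- The constant curve. -/
def const (x : M) : Curve M := ⟨fun _ => x, contMDiff_const⟩

/-- Reparametrisation of a curve. -/
def comp (f : Curve M) {σ : ℝ → ℝ} (hσ : ContDiff ℝ ∞ σ) : Curve M :=
  ⟨f ∘ σ, f.smooth.comp hσ.contMDiff⟩

@[simp] lemma comp_apply (f : Curve M) {σ : ℝ → ℝ} (hσ : ContDiff ℝ ∞ σ) (s : ℝ) :
    f.comp hσ s = f (σ s) := rfl

end Curve

/-- The curve underlying a smooth closed curve. -/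
def SmoothLoop.curve (α : SmoothLoop M) : Curve M := ⟨α, α.smooth⟩

/-- The preferred chart at a point, with values in `ℝ × ℝ`. -/
def crd (x : M) : OpenPartialHomeomorph M (ℝ × ℝ) :=
  (chartAt Plane x).transHomeomorph planeEquiv.toHomeomorph

lemma mem_crd_source (x : M) : x ∈ (crd x).source := mem_chart_source Plane x

/-- The determinant of the velocities of two curves in the preferred chart at `x`. -/
def cdet (x : M) (f h : Curve M) (s t : ℝ) : ℝ :=
  det2 (deriv (fun u => crd x (f u)) s) (deriv (fun u => crd x (h u)) t)

/-- The determinant of the velocities of two curves at an intersection point. -/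
def vdet (f h : Curve M) (s t : ℝ) : ℝ := cdet (f s) f h s t

/-- The sign of a crossing. -/
def csign (f h : Curve M) (s t : ℝ) : ℝ := Real.sign (vdet f h s t)

/-- Two curves are transverse: their velocities are independent at all the intersection points. -/
def IsTransverse (f h : Curve M) : Prop := ∀ s t, f s = h t → vdet f h s t ≠ 0

section Manifold

variable [IsManifold (𝓡 2) ∞ M]

namespace Curve

lemma contDiffAt_chart (f : Curve M) {x : M} {s : ℝ} (h : f s ∈ (crd x).source) :
    ContDiffAt ℝ ∞ (fun u => chartAt Plane x (f u)) s := by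
  have h1 := contMDiffAt_of_mem_maximalAtlas (I := 𝓡 2) (n := ∞)
    (IsManifold.subset_maximalAtlas (chart_mem_atlas Plane x)) h
  exact contMDiffAt_iff_contDiffAt.1 (h1.comp s (f.smooth s))

lemma contDiffAt_crd (f : Curve M) {x : M} {s : ℝ} (h : f s ∈ (crd x).source) :
    ContDiffAt ℝ ∞ (fun u => crd x (f u)) s :=
  planeEquiv.contDiff.contDiffAt.comp s (f.contDiffAt_chart h)

lemma differentiableAt_crd (f : Curve M) {x : M} {s : ℝ} (h : f s ∈ (crd x).source) :
    DifferentiableAt ℝ (fun u => crd x (f u)) s :=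
  (f.contDiffAt_crd h).differentiableAt (by simp)

lemma deriv_crd (f : Curve M) {x : M} {s : ℝ} (h : f s ∈ (crd x).source) :
    deriv (fun u => crd x (f u)) s = planeEquiv (deriv (fun u => chartAt Plane x (f u)) s) :=
  (planeEquiv.hasFDerivAt.comp_hasDerivAt s
    ((f.contDiffAt_chart h).differentiableAt (by simp)).hasDerivAt).deriv

end Curve

lemma velocityDet_eq (α β : SmoothLoop M) {s t : ℝ} (h : α s = β t) :
    SmoothLoop.velocityDet α β s t = vdet α.curve β.curve s t := by
  have h1 : α.curve s ∈ (crd (α s)).source := mem_crd_source _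
  have h2 : β.curve t ∈ (crd (α s)).source := by
    change β t ∈ _
    rw [← h]; exact h1
  have e1 := α.curve.deriv_crd h1
  have e2 := β.curve.deriv_crd h2
  simp only [vdet, cdet]
  change _ = det2 (deriv (fun u => crd (α s) (α.curve u)) s)
    (deriv (fun u => crd (α s) (β.curve u)) t)
  rw [e1, e2]
  rfl

/-- The determinants in two charts differ by a positive factor. -/
lemma cdet_change (hM : IsOrientedAtlas M) (x y : M) (f h : Curve M) {s t : ℝ}
    (hx : f s ∈ (crd x).source) (hy : f s ∈ (crd y).source) (hst : f s = h t) :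
    ∃ k > 0, cdet y f h s t = k * cdet x f h s t := by
  set e := chartAt Plane x
  set e' := chartAt Plane y
  set D := fderiv ℝ (fun u => e' (e.symm u)) (e (f s)) with hD
  have hpos : 0 < D.det := hM e (chart_mem_atlas _ _) e' (chart_mem_atlas _ _) _ ⟨hx, hy⟩
  have hdiff : DifferentiableAt ℝ (fun u => e' (e.symm u)) (e (f s)) := by
    by_contra hcon
    rw [hD, fderiv_zero_of_not_differentiableAt hcon] at hpos
    simp [ContinuousLinearMap.det] at hpos
  have key : ∀ (g : Curve M) (r : ℝ), g r = f s →
      deriv (fun u => e' (g u)) r = D (deriv (fun u => e (g u)) r) := by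
    intro g r hg
    have hgx : g r ∈ (crd x).source := by rw [hg]; exact hx
    have h1 : HasDerivAt (fun u => e (g u)) (deriv (fun u => e (g u)) r) r :=
      ((g.contDiffAt_chart hgx).differentiableAt (by simp)).hasDerivAt
    have h2 : HasFDerivAt (fun u => e' (e.symm u)) D (e (g r)) := by
      rw [hg]; exact hdiff.hasFDerivAt
    have h3 := h2.comp_hasDerivAt r h1
    have h4 : (fun u => e' (g u)) =ᶠ[𝓝 r] (fun u => e' (e.symm u)) ∘ fun u => e (g u) := by
      filter_upwards [g.continuous.continuousAt.preimage_mem_nhds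
        (e.open_source.mem_nhds hgx)] with u hu
      simp [e.left_inv hu]
    exact (h3.congr_of_eventuallyEq h4).deriv
  refine ⟨D.det, hpos, ?_⟩
  have hx' : h t ∈ (crd x).source := hst ▸ hx
  have hy' : h t ∈ (crd y).source := hst ▸ hy
  rw [cdet, cdet, f.deriv_crd hx, f.deriv_crd hy, h.deriv_crd hx', h.deriv_crd hy']
  change det2 (planeEquiv (deriv (fun u => e' (f u)) s)) (planeEquiv (deriv (fun u => e' (h u)) t))
    = _
  rw [key f s rfl, key h t hst.symm, det2_planeEquiv_map]

lemma sign_mul_of_pos {k a : ℝ} (hk : 0 < k) : Real.sign (k * a) = Real.sign a := by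
  rcases lt_trichotomy a 0 with h | h | h
  · rw [Real.sign_of_neg h, Real.sign_of_neg (mul_neg_of_pos_of_neg hk h)]
  · simp [h]
  · rw [Real.sign_of_pos h, Real.sign_of_pos (mul_pos hk h)]

lemma csign_eq (hM : IsOrientedAtlas M) (x : M) (f h : Curve M) {s t : ℝ}
    (hx : f s ∈ (crd x).source) (hst : f s = h t) :
    csign f h s t = Real.sign (cdet x f h s t) := by
  obtain ⟨k, hk, e⟩ := cdet_change hM x (f s) f h hx (mem_crd_source _) hst
  rw [csign, vdet, e, sign_mul_of_pos hk]

lemma vdet_ne_zero_iff (hM : IsOrientedAtlas M) (x : M) (f h : Curve M) {s t : ℝ}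
    (hx : f s ∈ (crd x).source) (hst : f s = h t) :
    vdet f h s t ≠ 0 ↔ cdet x f h s t ≠ 0 := by
  obtain ⟨k, hk, e⟩ := cdet_change hM x (f s) f h hx (mem_crd_source _) hst
  rw [vdet, e]
  simp [hk.ne']

lemma det2_swap (v w : ℝ × ℝ) : det2 v w = -det2 w v := by simp [det2]; ring

lemma vdet_swap {f h : Curve M} {s t : ℝ} (hst : f s = h t) : vdet h f t s = -vdet f h s t := by
  rw [vdet, vdet, ← hst, cdet, cdet, det2_swap]

lemma csign_swap {f h : Curve M} {s t : ℝ} (hst : f s = h t) :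
    csign h f t s = -csign f h s t := by
  rw [csign, csign, vdet_swap hst]
  exact Real.sign_neg

lemma IsTransverse.symm {f h : Curve M} (H : IsTransverse f h) : IsTransverse h f := by
  intro t s hst
  rw [vdet_swap hst.symm]
  exact neg_ne_zero.2 (H s t hst.symm)

/-- Behaviour under reparametrisation of the first curve. -/
lemma vdet_reparam {f g h : Curve M} {σ : ℝ → ℝ} {s t k : ℝ} (hf : ∀ᶠ u in 𝓝 s, f u = g (σ u))
    (hσ : HasDerivAt σ k s) : vdet f h s t = k * vdet g h (σ s) t := by
  have hs : f s = g (σ s) := hf.self_of_nhds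
  have h1 : HasDerivAt (fun u => crd (g (σ s)) (g u))
      (deriv (fun u => crd (g (σ s)) (g u)) (σ s)) (σ s) :=
    (g.differentiableAt_crd (mem_crd_source _)).hasDerivAt
  have h2 : HasDerivAt (fun u => crd (g (σ s)) (f u))
      (k • deriv (fun u => crd (g (σ s)) (g u)) (σ s)) s := by
    refine (h1.scomp s hσ).congr_of_eventuallyEq ?_
    filter_upwards [hf] with u hu
    simp [hu]
  rw [vdet, hs, vdet, cdet, cdet, h2.deriv]
  simp [det2]; ring

lemma csign_reparam {f g h : Curve M} {σ : ℝ → ℝ} {s t k : ℝ} (hf : ∀ᶠ u in 𝓝 s, f u = g (σ u))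
    (hσ : HasDerivAt σ k s) (hk : 0 < k) : csign f h s t = csign g h (σ s) t := by
  rw [csign, vdet_reparam hf hσ, sign_mul_of_pos hk, csign]

lemma vdet_eq_zero_of_eventually_const {f h : Curve M} {s t : ℝ} {x : M}
    (hf : ∀ᶠ u in 𝓝 s, f u = x) : vdet f h s t = 0 := by
  have h2 : (fun u => crd (f s) (f u)) =ᶠ[𝓝 s] fun _ => crd (f s) x := by
    filter_upwards [hf] with u hu
    rw [hu]
  rw [vdet, cdet, h2.deriv_eq]
  simp [det2]

/-- Transverse crossings are isolated. -/
lemma eventually_ne_of_vdet_ne_zero {f h : Curve M} {s t : ℝ} (hst : f s = h t)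
    (hd : vdet f h s t ≠ 0) : ∀ᶠ y in 𝓝[≠] (s, t), f y.1 ≠ h y.2 := by
  set x := f s with hx
  have hs : f s ∈ (crd x).source := mem_crd_source _
  have ht : h t ∈ (crd x).source := hst ▸ hs
  have ha := (f.differentiableAt_crd hs).hasDerivAt.hasFDerivAt.comp (s, t)
    (hasFDerivAt_fst (𝕜 := ℝ) (p := (s, t)))
  have hb := (h.differentiableAt_crd ht).hasDerivAt.hasFDerivAt.comp (s, t)
    (hasFDerivAt_snd (𝕜 := ℝ) (p := (s, t)))
  set L := ((ContinuousLinearMap.fst ℝ ℝ ℝ).smulRight (-deriv (fun u => crd x (f u)) s) +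
        (ContinuousLinearMap.snd ℝ ℝ ℝ).smulRight (deriv (fun u => crd x (h u)) t) :
        ℝ × ℝ →L[ℝ] ℝ × ℝ) with hL
  have hf : HasFDerivAt (fun z : ℝ × ℝ => crd x (h z.2) - crd x (f z.1)) L (s, t) := by
    refine HasFDerivAt.congr_fderiv (hb.sub ha) ?_
    ext <;> simp [L]
  have hLd : L.det ≠ 0 := by
    rw [hL, det_clm_columns]
    intro h0
    apply hd
    rw [vdet, cdet]
    simp only [det2] at h0 ⊢
    simp only [Prod.fst_neg, Prod.snd_neg] at h0
    linarith
  have hanti : ∃ C, AntilipschitzWith C L := by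
    have := (L.toContinuousLinearEquivOfDetNeZero hLd).antilipschitz
    exact ⟨_, this⟩
  filter_upwards [hf.eventually_ne (c := 0) hanti] with y hy he
  apply hy
  rw [he, sub_self]

lemma finite_crossings [T2Space M] {f h : Curve M} {K : Set (ℝ × ℝ)} (hK : IsCompact K)
    (H : ∀ z ∈ K, f z.1 = h z.2 → vdet f h z.1 z.2 ≠ 0) :
    {z | z ∈ K ∧ f z.1 = h z.2}.Finite := by
  have hcl : IsClosed {z : ℝ × ℝ | f z.1 = h z.2} :=
    isClosed_eq (f.continuous.comp continuous_fst) (h.continuous.comp continuous_snd)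
  have hc : IsCompact {z | z ∈ K ∧ f z.1 = h z.2} := hK.inter_right hcl
  refine hc.finite (isDiscrete_iff_forall_mem_exists_isOpen.2 ?_)
  intro z hz
  have := eventually_ne_of_vdet_ne_zero hz.2 (H z hz.1 hz.2)
  obtain ⟨W, hW, hWo, hzW⟩ := _root_.eventually_nhds_iff.1 (eventually_nhdsWithin_iff.1 this)
  refine ⟨W, hWo, ?_⟩
  ext y
  refine ⟨fun hy => ?_, fun hy => ?_⟩
  · by_contra hne
    exact hW y hy.1 hne hy.2.2
  · rw [mem_singleton_iff.1 hy]; exact ⟨hzW, hz⟩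

end Manifold

/-- A smooth curve from `x` to `y` which is constant outside a compact part of `(0, 1)`. -/
structure FlatArc (x y : M) extends Curve M where
  flat : ∃ ε > 0, (∀ t ≤ ε, toFun t = x) ∧ ∀ t ≥ 1 - ε, toFun t = y

namespace FlatArc

variable {x y z : M}

instance : CoeFun (FlatArc x y) (fun _ => ℝ → M) := ⟨fun a => a.toCurve⟩

lemma eq_left (a : FlatArc x y) {t : ℝ} (ht : t ≤ 0) : a t = x := by
  obtain ⟨ε, hε, h, -⟩ := a.flat
  exact h t (by linarith)

lemma eq_right (a : FlatArc x y) {t : ℝ} (ht : 1 ≤ t) : a t = y := by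
  obtain ⟨ε, hε, -, h⟩ := a.flat
  exact h t (by linarith)

@[simp] lemma zero (a : FlatArc x y) : a 0 = x := a.eq_left le_rfl

@[simp] lemma one (a : FlatArc x y) : a 1 = y := a.eq_right le_rfl

lemma eventually_left (a : FlatArc x y) {t : ℝ} (ht : t ≤ 0) : ∀ᶠ u in 𝓝 t, a u = x := by
  obtain ⟨ε, hε, h, -⟩ := a.flat
  filter_upwards [Iic_mem_nhds (show t < ε by linarith)] with u hu using h u hu

lemma eventually_right (a : FlatArc x y) {t : ℝ} (ht : 1 ≤ t) : ∀ᶠ u in 𝓝 t, a u = y := by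
  obtain ⟨ε, hε, -, h⟩ := a.flat
  filter_upwards [Ici_mem_nhds (show 1 - ε < t by linarith)] with u hu using h u hu

/-- The path defined by a flat arc. -/
def path (a : FlatArc x y) : Path x y where
  toFun t := a t
  continuous_toFun := a.continuous.comp continuous_subtype_val
  source' := by simp
  target' := by simp

section Manifold

variable [IsManifold (𝓡 2) ∞ M]

lemma mem_Ioo_of_vdet_ne_zero (a : FlatArc x y) {h : Curve M} {s t : ℝ}
    (H : vdet a.toCurve h s t ≠ 0) : s ∈ Ioo (0 : ℝ) 1 := by
  refine ⟨not_le.1 fun hs => H ?_, not_le.1 fun hs => H ?_⟩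
  · exact vdet_eq_zero_of_eventually_const (a.eventually_left hs)
  · exact vdet_eq_zero_of_eventually_const (a.eventually_right hs)

lemma mem_Ioo_of_vdet_ne_zero' (a : FlatArc x y) {h : Curve M} {s t : ℝ} (hst : h t = a s)
    (H : vdet h a.toCurve t s ≠ 0) : s ∈ Ioo (0 : ℝ) 1 := by
  apply a.mem_Ioo_of_vdet_ne_zero (h := h) (t := t)
  rw [vdet_swap hst]
  exact neg_ne_zero.2 H

end Manifold

end FlatArc

end
end

noncomputable section

/-! ### The derivation defined by a closed curve: local invariance -/

open Set Filter Topology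

section

variable {M : Type*} [TopologicalSpace M] [ChartedSpace Plane M]

/-- The part of the domain of the preferred chart at `x` with coordinates in a ball. -/
def box (x : M) (r : ℝ) : Set M := (crd x).source ∩ crd x ⁻¹' Metric.ball (crd x x) r

lemma isOpen_box (x : M) (r : ℝ) : IsOpen (box x r) :=
  (crd x).isOpen_inter_preimage Metric.isOpen_ball

lemma mem_box (x : M) {r : ℝ} (hr : 0 < r) : x ∈ box x r :=
  ⟨mem_crd_source x, Metric.mem_ball_self hr⟩

lemma box_mono (x : M) {r r' : ℝ} (h : r ≤ r') : box x r ⊆ box x r' :=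
  inter_subset_inter_right _ (preimage_mono (Metric.ball_subset_ball h))

/-- The chart at `x` covers the ball of radius `r`. -/
def IsRadius (x : M) (r : ℝ) : Prop := 0 < r ∧ Metric.ball (crd x x) r ⊆ (crd x).target

lemma exists_isRadius (x : M) : ∃ r, IsRadius x r := by
  obtain ⟨r, hr, h⟩ := Metric.isOpen_iff.1 (crd x).open_target (crd x x)
    ((crd x).map_source (mem_crd_source x))
  exact ⟨r, hr, h⟩

lemma IsRadius.mono {x : M} {r r' : ℝ} (h : IsRadius x r) (h0 : 0 < r') (h1 : r' ≤ r) :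
    IsRadius x r' := ⟨h0, (Metric.ball_subset_ball h1).trans h.2⟩

lemma exists_box_subset (x : M) {O : Set M} (hO : O ∈ 𝓝 x) : ∃ r, IsRadius x r ∧ box x r ⊆ O := by
  obtain ⟨r, hr⟩ := exists_isRadius x
  have h1 : (crd x).target ∩ (crd x).symm ⁻¹' O ∈ 𝓝 (crd x x) :=
    inter_mem ((crd x).open_target.mem_nhds ((crd x).map_source (mem_crd_source x)))
      (((crd x).continuousAt_symm ((crd x).map_source (mem_crd_source x))).preimage_mem_nhds
        (by rwa [(crd x).left_inv (mem_crd_source x)]))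
  obtain ⟨r', hr', h⟩ := Metric.mem_nhds_iff.1 h1
  refine ⟨min r r', hr.mono (lt_min hr.1 hr') (min_le_left _ _), fun y hy => ?_⟩
  have h2 := (h (Metric.ball_subset_ball (min_le_right r r') hy.2)).2
  rwa [mem_preimage, (crd x).left_inv hy.1] at h2

lemma isThin_box {x : M} {r : ℝ} (h : IsRadius x r) : IsThin (box x r) :=
  isThin_preimage (crd x) (convex_ball _ _) h.2

lemma exists_path_box {x : M} {r : ℝ} (h : IsRadius x r) {p q : M} (hp : p ∈ box x r)
    (hq : q ∈ box x r) : ∃ γ : Path p q, ∀ t, γ t ∈ box x r := by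
  let L : Path (crd x p) (crd x q) := Path.segment _ _
  have hL : ∀ t, L t ∈ Metric.ball (crd x x) r := fun t =>
    (convex_ball _ _).segment_subset hp.2 hq.2 (by
      rw [← Path.range_segment (crd x p) (crd x q)]
      exact mem_range_self t)
  refine ⟨⟨⟨fun t => (crd x).symm (L t), ?_⟩, ?_, ?_⟩, fun t => ?_⟩
  · exact (crd x).continuousOn_symm.comp_continuous L.continuous fun t => h.2 (hL t)
  · simp [(crd x).left_inv hp.1]
  · simp [(crd x).left_inv hq.1]
  · refine ⟨(crd x).map_target (h.2 (hL t)), ?_⟩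
    rw [mem_preimage]
    change crd x ((crd x).symm (L t)) ∈ _
    rw [(crd x).right_inv (h.2 (hL t))]
    exact hL t

variable [PathConnectedSpace M] (x₀ : M)

/-- The element of the fundamental group defined by a path in a box from its center to `y`. -/
def ray (x : M) (r : ℝ) (y : M) : FundamentalGroup M x₀ := by
  classical
  exact if h : ∃ γ : Path x y, ∀ t, γ t ∈ box x r then elt x₀ h.choose else 1

lemma ray_eq {x : M} {r : ℝ} (hr : IsRadius x r) {y : M} (γ : Path x y)
    (h : ∀ t, γ t ∈ box x r) : ray x₀ x r y = elt x₀ γ := by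
  have hex : ∃ γ : Path x y, ∀ t, γ t ∈ box x r := ⟨γ, h⟩
  rw [ray, dif_pos hex]
  exact elt_eq_of_homotopic x₀ (isThin_box hr _ _ hex.choose_spec h)

lemma elt_eq_ray {x : M} {r : ℝ} (hr : IsRadius x r) {p q : M} (γ : Path p q)
    (h : ∀ t, γ t ∈ box x r) : elt x₀ γ = ray x₀ x r q * (ray x₀ x r p)⁻¹ := by
  obtain ⟨δ, hδ⟩ := exists_path_box hr (mem_box x hr.1) (by simpa using h 0 : p ∈ box x r)
  rw [ray_eq x₀ hr δ hδ, ray_eq x₀ hr (δ.trans γ), elt_trans, mul_inv_cancel_right]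
  intro t
  have : (δ.trans γ) t ∈ range (δ.trans γ) := mem_range_self t
  rw [Path.trans_range] at this
  rcases this with ⟨u, hu⟩ | ⟨u, hu⟩
  · rw [← hu]; exact hδ u
  · rw [← hu]; exact h u

lemma tr_eq_ray {x : M} {r : ℝ} (hr : IsRadius x r) (f : Curve M) {s t : ℝ}
    (h : ∀ u ∈ uIcc s t, f u ∈ box x r) :
    tr x₀ f.cont s t = ray x₀ x r (f t) * (ray x₀ x r (f s))⁻¹ := by
  rw [← elt_map_eq_tr x₀ f.cont (Path.segment s t)]
  refine elt_eq_ray x₀ hr _ fun u => h _ ?_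
  rw [← segment_eq_uIcc, ← Path.range_segment]
  exact mem_range_self u

/-- The closed curve `b`, inserted at the time `t`. -/
def ins (b : Curve M) (t : ℝ) : FundamentalGroup M x₀ := tr x₀ b.cont 0 t * tr x₀ b.cont t 1

lemma ins_change (b : Curve M) (t t' : ℝ) :
    ins x₀ b t' = tr x₀ b.cont t t' * ins x₀ b t * (tr x₀ b.cont t t')⁻¹ := by
  rw [ins, ins, tr_inv, ← tr_mul x₀ b.cont 0 t t', ← tr_mul x₀ b.cont t' t 1]
  group

/-- The value of the derivation defined by the closed curve `b` on the curve `f`, restricted to an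
interval: at each crossing, the curve `b` is inserted. -/
def der (b f : Curve M) (s s' : ℝ) : MonoidAlgebra ℝ (FundamentalGroup M x₀) :=
  ∑ᶠ z ∈ {z : ℝ × ℝ | z.1 ∈ Icc s s' ∧ f z.1 = b z.2},
    MonoidAlgebra.single (tr x₀ f.cont z.1 s' * ins x₀ b z.2 * tr x₀ f.cont s z.1)
      (csign f b z.1 z.2)

/-- A curve, restricted to an interval, is transverse to `b` and has its ends off `b`. -/
structure IsGood (b f : Curve M) (s s' : ℝ) : Prop where
  le : s ≤ s'
  transverse : ∀ σ ∈ Icc s s', ∀ t, f σ = b t → vdet f b σ t ≠ 0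
  left_ne : ∀ t, f s ≠ b t
  right_ne : ∀ t, f s' ≠ b t

variable [IsManifold (𝓡 2) ∞ M] [T2Space M]

lemma IsGood.finite {y y' : M} {b : FlatArc y y'} {f : Curve M} {s s' : ℝ}
    (h : IsGood b.toCurve f s s') :
    {z : ℝ × ℝ | z.1 ∈ Icc s s' ∧ f z.1 = b z.2}.Finite := by
  refine (finite_crossings (f := f) (h := b.toCurve) (isCompact_Icc.prod isCompact_Icc :
    IsCompact (Icc s s' ×ˢ Icc (0 : ℝ) 1)) fun z hz he => h.transverse _ hz.1 _ he).subset ?_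
  intro z hz
  exact ⟨⟨hz.1, Ioo_subset_Icc_self
    (b.mem_Ioo_of_vdet_ne_zero' hz.2 (h.transverse _ hz.1 _ hz.2))⟩, hz.2⟩

variable {y : M} (b : FlatArc y y)

/-- The closed curve in a box, with the weight that detects a given element of the group. -/
def boxStrand {x : M} {R : ℝ} (hR : IsRadius x (3 * R)) (A B g : FundamentalGroup M x₀) :
    PlanarStrand (crd x x) R := by
  classical
  have hR0 : 0 < R := by have := hR.1; linarith
  let κ : ℝ → FundamentalGroup M x₀ := fun t =>
    (ray x₀ x (3 * R) (b t))⁻¹ * ins x₀ b.toCurve t * ray x₀ x (3 * R) (b t)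
  exact {
    b := fun t => crd x (b t)
    O := b ⁻¹' box x (3 * R)
    w := fun t => if A * κ t * B = g then 1 else 0
    isOpen := (isOpen_box _ _).preimage b.continuous
    smooth := fun t ht => (b.toCurve.contDiffAt_crd ht.1).of_le (by simp)
    w_const := by
      intro t ht
      obtain ⟨ε, hε, hb⟩ := Metric.isOpen_iff.1
        ((isOpen_box x (3 * R)).preimage b.continuous) t ht
      filter_upwards [Metric.ball_mem_nhds t hε] with t' ht'
      have hκ : κ t' = κ t := by
        have h1 : ∀ u ∈ uIcc t t', b u ∈ box x (3 * R) := fun u hu => hb (by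
          have hc := (convex_ball t ε).ordConnected
          exact hc.uIcc_subset (Metric.mem_ball_self hε) ht' hu)
        simp only [κ]
        rw [ins_change x₀ b.toCurve t t', tr_eq_ray x₀ hR b.toCurve h1]
        group
      simp only [hκ]
    closed := by
      have hK : IsCompact ((crd x).symm '' Metric.closedBall (crd x x) (2 * R)) :=
        (isCompact_closedBall _ _).image_of_continuousOn ((crd x).continuousOn_symm.mono
          ((Metric.closedBall_subset_ball (by linarith)).trans hR.2))
      have : {t | t ∈ b ⁻¹' box x (3 * R) ∧ crd x (b t) ∈ Metric.closedBall (crd x x) (2 * R)} =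
          b ⁻¹' ((crd x).symm '' Metric.closedBall (crd x x) (2 * R)) := by
        ext t
        constructor
        · rintro ⟨h1, h2⟩
          exact ⟨_, h2, (crd x).left_inv h1.1⟩
        · rintro ⟨z, hz, hzt⟩
          have hz' : z ∈ Metric.ball (crd x x) (3 * R) :=
            Metric.closedBall_subset_ball (by linarith) hz
          have hb : crd x (b t) = z := by rw [← hzt, (crd x).right_inv (hR.2 hz')]
          refine ⟨⟨?_, ?_⟩, ?_⟩
          · rw [← hzt]; exact (crd x).map_target (hR.2 hz')
          · rw [mem_preimage, hb]; exact hz'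
          · rw [hb]; exact hz
      rw [this]
      exact hK.isClosed.preimage b.continuous
    mem_iff := by simp [mem_preimage]
    b_eq := fun _ => by simp
    w_eq := fun _ => by
      have : κ 0 = κ 1 := by
        simp only [κ, ins]
        simp only [FlatArc.zero, FlatArc.one, tr_self, mul_one, one_mul]
      simp only [this]
    deriv_zero := fun _ => by
      have : (fun t => crd x (b t)) =ᶠ[𝓝 0] fun _ => crd x y := by
        filter_upwards [b.eventually_left le_rfl] with u hu
        rw [hu]
      rw [this.deriv_eq]; simp
    deriv_one := fun _ => by
      have : (fun t => crd x (b t)) =ᶠ[𝓝 1] fun _ => crd x y := by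
        filter_upwards [b.eventually_right le_rfl] with u hu
        rw [hu]
      rw [this.deriv_eq]; simp }

variable {b}

lemma IsGood.isTransverseArc (hM : IsOrientedAtlas M) {x : M} {R : ℝ} (hR : IsRadius x (3 * R))
    (A B g : FundamentalGroup M x₀) {f : Curve M} {s s' : ℝ} (h : IsGood b.toCurve f s s')
    (hf : ∀ u ∈ Icc s s', f u ∈ box x R) :
    (boxStrand x₀ b hR A B g).IsTransverseArc (fun u => crd x (f u)) s s' where
  le := h.le
  smooth u hu := (f.contDiffAt_crd (hf u hu).1).of_le (by simp)
  mem_ball u hu := (hf u hu).2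
  left_ne t ht he := h.left_ne t ((crd x).injOn (hf _ (left_mem_Icc.2 h.le)).1
    ((boxStrand x₀ b hR A B g).T_subset ht).1 he)
  right_ne t ht he := h.right_ne t ((crd x).injOn (hf _ (right_mem_Icc.2 h.le)).1
    ((boxStrand x₀ b hR A B g).T_subset ht).1 he)
  transverse σ hσ t ht he := by
    have hst : f σ = b t := (crd x).injOn (hf _ hσ).1
      ((boxStrand x₀ b hR A B g).T_subset ht).1 he
    exact (vdet_ne_zero_iff hM x f b.toCurve (hf _ hσ).1 hst).1 (h.transverse σ hσ t hst)

/-- The coefficients of `der` as weighted numbers of crossings in the plane. -/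
lemma IsGood.coeff_der (hM : IsOrientedAtlas M) {x : M} {R : ℝ} (hR : IsRadius x (3 * R))
    (g : FundamentalGroup M x₀) {f : Curve M} {s s' : ℝ} (h : IsGood b.toCurve f s s')
    (hf : ∀ u ∈ Icc s s', f u ∈ box x R) :
    (der x₀ b.toCurve f s s').coeff g =
      ∑ᶠ z ∈ (boxStrand x₀ b hR (ray x₀ x (3 * R) (f s')) (ray x₀ x (3 * R) (f s))⁻¹ g).crossings
        (fun u => crd x (f u)) s s',
        Real.sign (det2 (deriv (fun u => crd x (f u)) z.1)
          (deriv (fun u => crd x (b u)) z.2)) *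
        (boxStrand x₀ b hR (ray x₀ x (3 * R) (f s')) (ray x₀ x (3 * R) (f s))⁻¹ g).w z.2 := by
  classical
  have hR0 : 0 < R := by have := hR.1; linarith
  set S := boxStrand x₀ b hR (ray x₀ x (3 * R) (f s')) (ray x₀ x (3 * R) (f s))⁻¹ g with hS
  let ev : MonoidAlgebra ℝ (FundamentalGroup M x₀) →+ ℝ :=
    (Finsupp.applyAddHom g).comp MonoidAlgebra.coeffAddEquiv.toAddMonoidHom
  have hev : ∀ a, ev a = a.coeff g := fun a => rfl
  rw [← hev, der, AddMonoidHom.map_finsum_mem _ _ h.finite]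
  refine finsum_mem_congr ?_ ?_
  · ext z
    constructor
    · rintro ⟨h1, h2⟩
      refine ⟨h1, ⟨⟨?_, ?_⟩, ?_⟩, ?_⟩
      · change b z.2 ∈ box x (3 * R)
        rw [← h2]
        exact box_mono x (by linarith) (hf _ h1)
      · change crd x (b z.2) ∈ _
        have := (hf _ h1).2
        rw [mem_preimage, h2] at this
        exact Metric.ball_subset_closedBall (Metric.ball_subset_ball (by linarith) this)
      · exact Ioo_subset_Icc_self (b.mem_Ioo_of_vdet_ne_zero' h2 (h.transverse _ h1 _ h2))
      · change crd x (f z.1) = crd x (b z.2)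
        rw [h2]
    · rintro ⟨h1, h2, h3⟩
      exact ⟨h1, (crd x).injOn (hf _ h1).1 (S.T_subset h2).1 h3⟩
  · rintro z ⟨h1, h2, h3⟩
    have hst : f z.1 = b z.2 := (crd x).injOn (hf _ h1).1 (S.T_subset h2).1 h3
    have hf' : ∀ u ∈ Icc s s', f u ∈ box x (3 * R) := fun u hu =>
      box_mono x (by linarith) (hf u hu)
    rw [csign_eq hM x f b.toCurve (hf _ h1).1 hst, hev, MonoidAlgebra.coeff_single,
      tr_eq_ray x₀ hR f (s := s) (t := z.1), tr_eq_ray x₀ hR f (s := z.1) (t := s'), hst,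
      Finsupp.single_apply]
    · have : (S.w z.2 : ℝ) = if ray x₀ x (3 * R) (f s') * ((ray x₀ x (3 * R) (b z.2))⁻¹ *
          ins x₀ b.toCurve z.2 * ray x₀ x (3 * R) (b z.2)) * (ray x₀ x (3 * R) (f s))⁻¹ = g
          then 1 else 0 := rfl
      rw [this]
      simp only [mul_assoc, mul_ite, mul_one, mul_zero]
      rfl
    · intro u hu
      rw [uIcc_of_le h1.2] at hu
      exact hf' u ⟨h1.1.trans hu.1, hu.2⟩
    · intro u hu
      rw [uIcc_of_le h1.1] at hu
      exact hf' u ⟨hu.1, hu.2.trans h1.2⟩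

/-- In a small box, the derivation `der` only depends on the ends of the curve. -/
theorem IsGood.der_eq (hM : IsOrientedAtlas M) {x : M} {R : ℝ} (hR : IsRadius x (3 * R))
    {f f' : Curve M} {s₀ s₁ s₀' s₁' : ℝ} (h : IsGood b.toCurve f s₀ s₁)
    (h' : IsGood b.toCurve f' s₀' s₁') (hf : ∀ u ∈ Icc s₀ s₁, f u ∈ box x R)
    (hf' : ∀ u ∈ Icc s₀' s₁', f' u ∈ box x R) (e0 : f s₀ = f' s₀') (e1 : f s₁ = f' s₁') :
    der x₀ b.toCurve f s₀ s₁ = der x₀ b.toCurve f' s₀' s₁' := by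
  have hR0 : 0 < R := by have := hR.1; linarith
  rw [← MonoidAlgebra.coeff_inj]
  ext g
  rw [h.coeff_der x₀ hM hR g hf, h'.coeff_der x₀ hM hR g hf', e0, e1]
  refine PlanarStrand.IsTransverseArc.sum_crossings_eq hR0
    (h.isTransverseArc x₀ hM hR _ _ g hf) (h'.isTransverseArc x₀ hM hR _ _ g hf') ?_ ?_
  · simp only [e0]
  · simp only [e1]

end
end

noncomputable section

/-! ### Transverse arcs with prescribed homotopy class -/

open Set Filter Topology MeasureTheory

/-- A smooth function which is `0` on `(-∞, 1/3]` and `1` on `[2/3, ∞)`. -/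
def step (t : ℝ) : ℝ := Real.smoothTransition (3 * t - 1)

lemma contDiff_step : ContDiff ℝ ∞ step := by
  have : ContDiff ℝ ∞ Real.smoothTransition := Real.smoothTransition.contDiff
  exact this.comp (by fun_prop)

lemma step_eq_zero {t : ℝ} (h : t ≤ 1 / 3) : step t = 0 :=
  Real.smoothTransition.zero_of_nonpos (by linarith)

lemma step_eq_one {t : ℝ} (h : 2 / 3 ≤ t) : step t = 1 :=
  Real.smoothTransition.one_of_one_le (by linarith)

lemma step_nonneg (t : ℝ) : 0 ≤ step t := Real.smoothTransition.nonneg _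

lemma step_le_one (t : ℝ) : step t ≤ 1 := Real.smoothTransition.le_one _

lemma expNegInvGlue_hasDerivAt_pos {x : ℝ} (hx : 0 < x) :
    ∃ k > 0, HasDerivAt expNegInvGlue k x := by
  refine ⟨(x⁻¹) ^ 2 * expNegInvGlue x, ?_, ?_⟩
  · have := expNegInvGlue.pos_of_pos hx
    positivity
  · simpa using expNegInvGlue.hasDerivAt_polynomial_eval_inv_mul 1 x

lemma step_hasDerivAt_pos {t : ℝ} (h0 : 1 / 3 < t) (h1 : t < 2 / 3) :
    ∃ k > 0, HasDerivAt step k t := by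
  obtain ⟨k, hk, hkd⟩ := expNegInvGlue_hasDerivAt_pos (x := 3 * t - 1) (by linarith)
  obtain ⟨l, hl, hld⟩ := expNegInvGlue_hasDerivAt_pos (x := 1 - (3 * t - 1)) (by linarith)
  have i1 : HasDerivAt (fun t : ℝ => 3 * t - 1) 3 t := by
    simpa using ((hasDerivAt_id t).const_mul 3).sub_const 1
  have i2 : HasDerivAt (fun t : ℝ => 1 - (3 * t - 1)) (-3) t := i1.const_sub 1
  have d1 := hkd.comp t i1
  have d2 := hld.comp t i2
  have p1 := expNegInvGlue.pos_of_pos (x := 3 * t - 1) (by linarith)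
  have p2 := expNegInvGlue.pos_of_pos (x := 1 - (3 * t - 1)) (by linarith)
  have hd := d1.div (d1.add d2) (by simp only [Pi.add_apply, Function.comp]; positivity)
  refine ⟨_, ?_, hd⟩
  simp only [Pi.add_apply, Function.comp]
  apply div_pos _ (by positivity)
  have : k * 3 * (expNegInvGlue (3 * t - 1) + expNegInvGlue (1 - (3 * t - 1))) -
      expNegInvGlue (3 * t - 1) * (k * 3 + l * -3) =
      3 * k * expNegInvGlue (1 - (3 * t - 1)) + 3 * l * expNegInvGlue (3 * t - 1) := by ring
  rw [this]
  positivity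

lemma ae_forall_ne_of_differentiableAt {c : ℝ → ℝ × ℝ} {O : Set ℝ}
    (hc : ∀ t ∈ O, DifferentiableAt ℝ c t) : ∀ᵐ r : ℝ × ℝ, ∀ t ∈ O, c t ≠ r := by
  have n1 : volume ((fun z : ℝ × ℝ => c z.2) '' {z | z.2 ∈ O}) = 0 := by
    refine addHaar_image_eq_zero_of_det_fderivWithin_eq_zero volume (f' := fun z =>
      (ContinuousLinearMap.fst ℝ ℝ ℝ).smulRight 0 +
        (ContinuousLinearMap.snd ℝ ℝ ℝ).smulRight (deriv c z.2)) (fun z hz => ?_) fun z hz => ?_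
    · refine HasFDerivAt.hasFDerivWithinAt ?_
      refine ((hc z.2 hz).hasDerivAt.hasFDerivAt.comp z
        (hasFDerivAt_snd (𝕜 := ℝ) (p := z))).congr_fderiv ?_
      ext <;> simp
    · rw [det_clm_columns]; simp [det2]
  rw [ae_iff]
  refine measure_mono_null (fun r hr => ?_) n1
  obtain ⟨t, hr⟩ := not_forall.1 hr
  obtain ⟨ht, hr⟩ := Classical.not_imp.1 hr
  exact ⟨(0, t), ht, not_not.1 hr⟩

/-- Almost all the lines through a point outside of a curve are transverse to the curve. -/
lemma ae_transverse_lines {c : ℝ → ℝ × ℝ} {O : Set ℝ} (hc : ∀ t ∈ O, DifferentiableAt ℝ c t)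
    {p : ℝ × ℝ} (hp : ∀ t ∈ O, c t ≠ p) :
    ∀ᵐ r : ℝ × ℝ, ∀ t ∈ O, ∀ μ : ℝ, c t = p + μ • (r - p) →
      det2 (r - p) (deriv c t) ≠ 0 := by
  have n2 : volume ((fun z : ℝ × ℝ => p + z.1 • (c z.2 - p)) ''
      {z | z.2 ∈ O ∧ det2 (c z.2 - p) (z.1 • deriv c z.2) = 0}) = 0 := by
    refine addHaar_image_eq_zero_of_det_fderivWithin_eq_zero volume (f' := fun z =>
      (ContinuousLinearMap.fst ℝ ℝ ℝ).smulRight (c z.2 - p) +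
        (ContinuousLinearMap.snd ℝ ℝ ℝ).smulRight (z.1 • deriv c z.2)) (fun z hz => ?_)
        fun z hz => ?_
    · refine HasFDerivAt.hasFDerivWithinAt ?_
      have h1 := (hc z.2 hz.1).hasDerivAt.hasFDerivAt.comp z
        (hasFDerivAt_snd (𝕜 := ℝ) (p := z))
      refine (((hasFDerivAt_fst (𝕜 := ℝ) (p := z)).smul (h1.sub_const p)).const_add
        p).congr_fderiv ?_
      ext <;> simp
    · rw [det_clm_columns]; exact hz.2
  rw [ae_iff]
  refine measure_mono_null (fun r hr => ?_) n2
  obtain ⟨t, hr⟩ := not_forall.1 hr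
  obtain ⟨ht, hr⟩ := Classical.not_imp.1 hr
  obtain ⟨μ, hr⟩ := not_forall.1 hr
  obtain ⟨he, hr⟩ := Classical.not_imp.1 hr
  have h0 := not_not.1 hr
  have hμ : μ ≠ 0 := by
    rintro rfl
    exact hp t ht (by simpa using he)
  have e1 : c t - p = μ • (r - p) := by rw [he]; abel
  refine ⟨(μ⁻¹, t), ⟨ht, ?_⟩, ?_⟩
  · simp only
    rw [e1]
    simp only [det2, Prod.smul_fst, Prod.smul_snd, smul_eq_mul, Prod.fst_sub, Prod.snd_sub]
      at h0 ⊢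
    have : μ * μ⁻¹ * ((r.1 - p.1) * (deriv c t).2 - (r.2 - p.2) * (deriv c t).1) = 0 := by
      rw [h0, mul_zero]
    linarith
  · simp only
    rw [e1, smul_smul, inv_mul_cancel₀ hμ, one_smul]
    abel

section

variable {M : Type*} [TopologicalSpace M] [ChartedSpace Plane M]

namespace FlatArc

variable {x y z : M}

/-- The constant arc. -/
def const (x : M) : FlatArc x x where
  toCurve := Curve.const x
  flat := ⟨1, one_pos, fun _ _ => rfl, fun _ _ => rfl⟩

@[simp] lemma const_apply (x : M) (t : ℝ) : const x t = x := rfl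

/-- The reparametrisation of a curve from `s` to `t` as a flat arc. -/
def flatten (f : Curve M) (s t : ℝ) : FlatArc (f s) (f t) where
  toCurve := f.comp (σ := fun u => s + step u * (t - s))
    (contDiff_const.add (contDiff_step.mul contDiff_const))
  flat := by
    refine ⟨1 / 3, by norm_num, fun u hu => ?_, fun u hu => ?_⟩
    · change f (s + step u * (t - s)) = f s
      simp [step_eq_zero hu]
    · change f (s + step u * (t - s)) = f t
      simp [step_eq_one (show 2 / 3 ≤ u by linarith)]

/-- The values of the concatenation of two arcs. -/
def transFun (a : FlatArc x y) (a' : FlatArc y z) (t : ℝ) : M :=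
  if t ≤ 1 / 2 then a (2 * t) else a' (2 * t - 1)

lemma transFun_eventually_left (a : FlatArc x y) (a' : FlatArc y z) {t : ℝ} (ht : t ≤ 1 / 2) :
    ∀ᶠ u in 𝓝 t, transFun a a' u = a (2 * u) := by
  have h1 : ∀ᶠ u in 𝓝 (2 * (1 / 2) - 1 : ℝ), a' u = y := a'.eventually_left (by norm_num)
  rcases ht.lt_or_eq with h | rfl
  · filter_upwards [Iio_mem_nhds h] with u hu
    rw [transFun, if_pos (le_of_lt hu)]
  · have hc : ContinuousAt (fun u : ℝ => 2 * u - 1) (1 / 2) := by fun_prop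
    filter_upwards [hc.eventually h1] with u hu
    rw [transFun]
    split_ifs with h
    · rfl
    · rw [hu, a.eq_right (by linarith)]

lemma transFun_eventually_right (a : FlatArc x y) (a' : FlatArc y z) {t : ℝ} (ht : 1 / 2 ≤ t) :
    ∀ᶠ u in 𝓝 t, transFun a a' u = a' (2 * u - 1) := by
  have h1 : ∀ᶠ u in 𝓝 (2 * (1 / 2) : ℝ), a u = y := a.eventually_right (by norm_num)
  rcases ht.lt_or_eq with h | rfl
  · filter_upwards [Ioi_mem_nhds h] with u hu
    rw [transFun, if_neg (not_le.2 hu)]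
  · have hc : ContinuousAt (fun u : ℝ => 2 * u) (1 / 2) := by fun_prop
    filter_upwards [hc.eventually h1] with u hu
    rw [transFun]
    split_ifs with h
    · rw [hu, a'.eq_left (by linarith)]
    · rfl

/-- The concatenation of two arcs. -/
def trans (a : FlatArc x y) (a' : FlatArc y z) : FlatArc x z where
  toFun := transFun a a'
  smooth := by
    intro t
    rcases le_total t (1 / 2) with ht | ht
    · refine ContMDiffAt.congr_of_eventuallyEq ?_ (transFun_eventually_left a a' ht)
      exact (a.smooth.comp (f := fun u : ℝ => 2 * u) (ContDiff.contMDiff (by fun_prop))).contMDiffAt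
    · refine ContMDiffAt.congr_of_eventuallyEq ?_ (transFun_eventually_right a a' ht)
      exact (a'.smooth.comp (f := fun u : ℝ => 2 * u - 1)
        (ContDiff.contMDiff (by fun_prop))).contMDiffAt
  flat := by
    obtain ⟨ε, hε, h, -⟩ := a.flat
    obtain ⟨ε', hε', -, h'⟩ := a'.flat
    have h0 := lt_min (lt_min hε hε') (one_pos (α := ℝ))
    have i1 : min (min ε ε') 1 ≤ ε := (min_le_left _ _).trans (min_le_left _ _)
    have i2 : min (min ε ε') 1 ≤ ε' := (min_le_left _ _).trans (min_le_right _ _)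
    have i3 : min (min ε ε') 1 ≤ 1 := min_le_right _ _
    refine ⟨min (min ε ε') 1 / 3, by linarith, fun t ht => ?_, fun t ht => ?_⟩
    · rw [transFun, if_pos (by linarith)]
      exact h _ (by linarith)
    · rw [transFun, if_neg (by linarith)]
      exact h' _ (by linarith)

lemma trans_of_le (a : FlatArc x y) (a' : FlatArc y z) {t : ℝ} (h : t ≤ 1 / 2) :
    a.trans a' t = a (2 * t) := if_pos h

lemma trans_of_ge (a : FlatArc x y) (a' : FlatArc y z) {t : ℝ} (h : 1 / 2 ≤ t) :
    a.trans a' t = a' (2 * t - 1) := (transFun_eventually_right a a' h).self_of_nhds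

lemma trans_mem {a : FlatArc x y} {a' : FlatArc y z} {N : Set M} (h : ∀ t, a t ∈ N)
    (h' : ∀ t, a' t ∈ N) (t : ℝ) : a.trans a' t ∈ N := by
  rcases le_total t (1 / 2) with ht | ht
  · rw [trans_of_le a a' ht]; exact h _
  · rw [trans_of_ge a a' ht]; exact h' _

section Manifold

variable [IsManifold (𝓡 2) ∞ M]

lemma vdet_trans_left (a : FlatArc x y) (a' : FlatArc y z) (f : Curve M) {t : ℝ} (s : ℝ)
    (h : t ≤ 1 / 2) : vdet (a.trans a').toCurve f t s = 2 * vdet a.toCurve f (2 * t) s :=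
  vdet_reparam (transFun_eventually_left a a' h) (by simpa using (hasDerivAt_id t).const_mul 2)

lemma vdet_trans_right (a : FlatArc x y) (a' : FlatArc y z) (f : Curve M) {t : ℝ} (s : ℝ)
    (h : 1 / 2 ≤ t) :
    vdet (a.trans a').toCurve f t s = 2 * vdet a'.toCurve f (2 * t - 1) s := by
  have hσ : HasDerivAt (fun u : ℝ => 2 * u - 1) 2 t := by
    simpa using ((hasDerivAt_id t).const_mul 2).sub_const 1
  have hf : ∀ᶠ u in 𝓝 t, (a.trans a').toCurve u = a'.toCurve ((fun u : ℝ => 2 * u - 1) u) :=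
    transFun_eventually_right a a' h
  rw [vdet_reparam (h := f) (t := s) hf hσ]

lemma isTransverse_trans {a : FlatArc x y} {a' : FlatArc y z} {f : Curve M}
    (h : IsTransverse a.toCurve f) (h' : IsTransverse a'.toCurve f) :
    IsTransverse (a.trans a').toCurve f := by
  intro t s hst
  rcases le_total t (1 / 2) with ht | ht
  · rw [vdet_trans_left a a' f s ht]
    exact mul_ne_zero two_ne_zero (h _ _ ((trans_of_le a a' ht).symm.trans hst))
  · rw [vdet_trans_right a a' f s ht]
    exact mul_ne_zero two_ne_zero (h' _ _ ((trans_of_ge a a' ht).symm.trans hst))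

lemma isTransverse_const {f : Curve M} (h : ∀ t, f t ≠ x) :
    IsTransverse (const x).toCurve f := fun _ t e => absurd e.symm (h t)

end Manifold

variable [PathConnectedSpace M] (x₀ : M)

lemma elt_path (a : FlatArc x y) : elt x₀ a.path = tr x₀ a.cont 0 1 := by
  let γ : Path (0 : ℝ) 1 := ⟨⟨fun t => t, continuous_subtype_val⟩, rfl, rfl⟩
  rw [← elt_map_eq_tr x₀ a.cont γ]
  exact elt_congr x₀ fun t => rfl

lemma tr_trans_left (a : FlatArc x y) (a' : FlatArc y z) {s t : ℝ} (hs : s ≤ 1 / 2)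
    (ht : t ≤ 1 / 2) : tr x₀ (a.trans a').cont s t = tr x₀ a.cont (2 * s) (2 * t) := by
  have h := tr_comp x₀ a.cont ⟨fun u => 2 * u, by fun_prop⟩ s t
  rw [← elt_map_eq_tr x₀ _ (Path.segment s t)] at h ⊢
  refine (elt_congr x₀ fun u => ?_).trans h
  refine trans_of_le a a' ?_
  have : Path.segment s t u ∈ uIcc s t := by
    rw [← segment_eq_uIcc, ← Path.range_segment]; exact mem_range_self u
  exact this.2.trans (sup_le hs ht)

lemma tr_trans_right (a : FlatArc x y) (a' : FlatArc y z) {s t : ℝ} (hs : 1 / 2 ≤ s)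
    (ht : 1 / 2 ≤ t) :
    tr x₀ (a.trans a').cont s t = tr x₀ a'.cont (2 * s - 1) (2 * t - 1) := by
  have h := tr_comp x₀ a'.cont ⟨fun u => 2 * u - 1, by fun_prop⟩ s t
  rw [← elt_map_eq_tr x₀ _ (Path.segment s t)] at h ⊢
  refine (elt_congr x₀ fun u => ?_).trans h
  refine trans_of_ge a a' ?_
  have : Path.segment s t u ∈ uIcc s t := by
    rw [← segment_eq_uIcc, ← Path.range_segment]; exact mem_range_self u
  exact (le_inf hs ht).trans this.1

lemma tr_trans (a : FlatArc x y) (a' : FlatArc y z) :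
    tr x₀ (a.trans a').cont 0 1 = tr x₀ a'.cont 0 1 * tr x₀ a.cont 0 1 := by
  rw [← tr_mul x₀ _ 0 (1 / 2) 1, tr_trans_left x₀ a a' (by norm_num) le_rfl,
    tr_trans_right x₀ a a' le_rfl (by norm_num)]
  norm_num

@[simp] lemma tr_const (s t : ℝ) : tr x₀ (const x).cont s t = 1 := by
  rw [← elt_map_eq_tr x₀ _ (Path.segment s t)]
  exact (elt_congr x₀ (γ' := Path.refl x) fun u => rfl).trans (elt_refl x₀ x)

end FlatArc

end
end

noncomputable section

/-! ### Existence of transverse arcs -/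

open Set Filter Topology MeasureTheory

section

variable {M : Type*} [TopologicalSpace M] [ChartedSpace Plane M]

/-- The point `p` lies on none of the curves. -/
def IsOff (𝓑 : Set (Curve M)) (p : M) : Prop := ∀ b ∈ 𝓑, ∀ t, b t ≠ p

/-- The curve `f` is transverse to all the curves of a family. -/
def IsTransverseTo (f : Curve M) (𝓑 : Set (Curve M)) : Prop := ∀ b ∈ 𝓑, IsTransverse f b

variable [IsManifold (𝓡 2) ∞ M]

/-- A segment in a chart, as a flat arc. -/
def segArc {x : M} {r : ℝ} (hr : IsRadius x r) {p q : M} (hp : p ∈ box x r) (hq : q ∈ box x r) :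
    FlatArc p q where
  toFun t := (crd x).symm (crd x p + step t • (crd x q - crd x p))
  smooth := by
    have h1 : ContDiff ℝ ∞ fun t => planeEquiv.symm (crd x p + step t • (crd x q - crd x p)) :=
      planeEquiv.symm.contDiff.comp (contDiff_const.add (contDiff_step.smul contDiff_const))
    have h2 := contMDiffOn_chart_symm (I := 𝓡 2) (n := ∞) (x := x)
    refine h2.comp_contMDiff h1.contMDiff fun t => ?_
    have h3 : crd x p + step t • (crd x q - crd x p) ∈ (crd x).target :=
      hr.2 ((convex_ball _ _).add_smul_sub_mem hp.2 hq.2 ⟨step_nonneg t, step_le_one t⟩)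
    have h4 := (crd x).map_target h3
    simpa [crd] using h3
  flat := by
    refine ⟨1 / 3, by norm_num, fun t ht => ?_, fun t ht => ?_⟩
    · simp [step_eq_zero ht, (crd x).left_inv hp.1]
    · simp [step_eq_one (show 2 / 3 ≤ t by linarith), (crd x).left_inv hq.1]

lemma segArc_mem {x : M} {r : ℝ} (hr : IsRadius x r) {p q : M} (hp : p ∈ box x r)
    (hq : q ∈ box x r) (t : ℝ) : segArc hr hp hq t ∈ box x r ∧
      crd x (segArc hr hp hq t) = crd x p + step t • (crd x q - crd x p) := by
  have h3 : crd x p + step t • (crd x q - crd x p) ∈ Metric.ball (crd x x) r :=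
    (convex_ball _ _).add_smul_sub_mem hp.2 hq.2 ⟨step_nonneg t, step_le_one t⟩
  have h4 : crd x (segArc hr hp hq t) = crd x p + step t • (crd x q - crd x p) :=
    (crd x).right_inv (hr.2 h3)
  exact ⟨⟨(crd x).map_target (hr.2 h3), by rw [mem_preimage, h4]; exact h3⟩, h4⟩

lemma segArc_transverse (hM : IsOrientedAtlas M) {x : M} {r : ℝ} (hr : IsRadius x r) {p q : M}
    (hp : p ∈ box x r) (hq : q ∈ box x r) (b : Curve M) (hbp : ∀ t, b t ≠ p) (hbq : ∀ t, b t ≠ q)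
    (H : ∀ t, b t ∈ (crd x).source → ∀ μ : ℝ, crd x (b t) = crd x p + μ • (crd x q - crd x p) →
      det2 (crd x q - crd x p) (deriv (fun u => crd x (b u)) t) ≠ 0) :
    IsTransverse (segArc hr hp hq).toCurve b := by
  intro s t hst
  obtain ⟨h1, h2⟩ := segArc_mem hr hp hq s
  have hs : s ∈ Ioo (1 / 3 : ℝ) (2 / 3) := by
    refine ⟨not_le.1 fun h => ?_, not_le.1 fun h => ?_⟩
    · refine hbp t (hst.symm.trans ?_)
      apply (crd x).injOn h1.1 hp.1
      rw [h2, step_eq_zero h, zero_smul, add_zero]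
    · refine hbq t (hst.symm.trans ?_)
      apply (crd x).injOn h1.1 hq.1
      rw [h2, step_eq_one h, one_smul, add_sub_cancel]
  obtain ⟨k, hk, hd⟩ := step_hasDerivAt_pos hs.1 hs.2
  rw [vdet_ne_zero_iff hM x _ b h1.1 hst, cdet]
  have h3 : (fun u => crd x ((segArc hr hp hq).toCurve u)) =
      fun u => crd x p + step u • (crd x q - crd x p) := by
    ext1 u; exact (segArc_mem hr hp hq u).2
  rw [h3, ((hd.smul_const (crd x q - crd x p)).const_add (crd x p)).deriv]
  have h4 := H t (hst ▸ h1.1) (step s) (by rw [← h2, ← hst])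
  rw [show det2 (k • (crd x q - crd x p)) (deriv (fun u => crd x (b u)) t) =
    k * det2 (crd x q - crd x p) (deriv (fun u => crd x (b u)) t) by simp [det2]; ring]
  exact mul_ne_zero hk.ne' h4

variable {𝓑 : Set (Curve M)}

lemma exists_point_box (h𝓑 : 𝓑.Countable) {x : M} {r : ℝ} (hr : IsRadius x r) {P : ℝ × ℝ → Prop}
    (hP : ∀ᵐ w, P w) : ∃ p ∈ box x r, IsOff 𝓑 p ∧ P (crd x p) := by
  have h1 : ∀ᵐ w : ℝ × ℝ, ∀ b ∈ 𝓑, ∀ t ∈ b ⁻¹' (crd x).source, crd x (b t) ≠ w := by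
    rw [ae_ball_iff h𝓑]
    exact fun b _ => ae_forall_ne_of_differentiableAt fun t ht => b.differentiableAt_crd ht
  obtain ⟨w, hw, h2, h3⟩ := ((frequently_ae_mem_iff.2
    (Metric.measure_ball_pos volume (crd x x) hr.1).ne').and_eventually (h1.and hP)).exists
  have e := (crd x).right_inv (hr.2 hw)
  have hs := (crd x).map_target (hr.2 hw)
  refine ⟨(crd x).symm w, ⟨hs, by rwa [mem_preimage, e]⟩, fun b hb t ht => ?_, by rwa [e]⟩
  refine h2 b hb t (by rwa [mem_preimage, ht]) (by rw [ht, e])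

lemma dense_isOff (h𝓑 : 𝓑.Countable) : Dense {p : M | IsOff 𝓑 p} := by
  intro x
  rw [mem_closure_iff_nhds]
  intro O hO
  obtain ⟨r, hr, h⟩ := exists_box_subset x hO
  obtain ⟨p, hp, hp', -⟩ := exists_point_box h𝓑 hr (P := fun _ => True) (by simp)
  exact ⟨p, h hp, hp'⟩

lemma exists_arc_box (hM : IsOrientedAtlas M) (h𝓑 : 𝓑.Countable) {x : M} {r : ℝ}
    (hr : IsRadius x r) {p q : M} (hp : p ∈ box x r) (hq : q ∈ box x r) (hp' : IsOff 𝓑 p)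
    (hq' : IsOff 𝓑 q) :
    ∃ a : FlatArc p q, (∀ t, a t ∈ box x r) ∧ IsTransverseTo a.toCurve 𝓑 := by
  have key : ∀ p ∈ box x r, IsOff 𝓑 p → ∀ᵐ w : ℝ × ℝ, ∀ b ∈ 𝓑, ∀ t ∈ b ⁻¹' (crd x).source,
      ∀ μ : ℝ, crd x (b t) = crd x p + μ • (w - crd x p) →
      det2 (w - crd x p) (deriv (fun u => crd x (b u)) t) ≠ 0 := by
    intro p hp hp'
    rw [ae_ball_iff h𝓑]
    intro b hb
    exact ae_transverse_lines (fun t ht => b.differentiableAt_crd ht) fun t ht e =>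
      hp' b hb t ((crd x).injOn ht hp.1 e)
  obtain ⟨w, hw, hw', h1, h2⟩ := exists_point_box h𝓑 hr ((key p hp hp').and (key q hq hq'))
  refine ⟨(segArc hr hp hw).trans (segArc hr hw hq), FlatArc.trans_mem
    (fun t => (segArc_mem hr hp hw t).1) (fun t => (segArc_mem hr hw hq t).1), fun b hb =>
    FlatArc.isTransverse_trans ?_ ?_⟩
  · exact segArc_transverse hM hr hp hw b (hp' b hb) (hw' b hb) (h1 b hb)
  · refine segArc_transverse hM hr hw hq b (hw' b hb) (hq' b hb) fun t ht μ e h0 => ?_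
    refine h2 b hb t ht (1 - μ) ?_ ?_
    · rw [e, sub_smul, ← sub_eq_zero]
      simp only [smul_sub, one_smul]
      abel
    · simp only [det2, Prod.fst_sub, Prod.snd_sub] at h0 ⊢
      linarith

variable [PathConnectedSpace M] (x₀ : M)

/-- All the homotopy classes of paths between two points contain transverse arcs. -/
theorem exists_arc (hM : IsOrientedAtlas M) (h𝓑 : 𝓑.Countable) {p q : M} (hp : IsOff 𝓑 p)
    (hq : IsOff 𝓑 q) (g : FundamentalGroup M x₀) :
    ∃ a : FlatArc p q, IsTransverseTo a.toCurve 𝓑 ∧ tr x₀ a.cont 0 1 = g := by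
  obtain ⟨γ, rfl⟩ := exists_elt_eq x₀ p q g
  set f : C(ℝ, M) := ⟨γ.extend, γ.continuous_extend⟩ with hf
  have hγ : elt x₀ γ = tr x₀ f 0 1 := by
    let δ : Path (0 : ℝ) 1 := ⟨⟨fun t => t, continuous_subtype_val⟩, rfl, rfl⟩
    rw [← elt_map_eq_tr x₀ f δ]
    exact elt_congr x₀ fun t => (γ.extend_apply t.2).symm
  have f0 : f 0 = p := γ.extend_zero
  have f1 : f 1 = q := γ.extend_one
  -- arcs which end near `f s`, with a short path in `W` from their end to `f s`
  let S : ℝ → Prop := fun s => ∀ (x : M) (r : ℝ), IsRadius x r → f s ∈ box x r →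
    ∀ q' ∈ box x r, IsOff 𝓑 q' → ∃ a : FlatArc p q', IsTransverseTo a.toCurve 𝓑 ∧
      tr x₀ a.cont 0 1 = ray x₀ x r q' * (ray x₀ x r (f s))⁻¹ * tr x₀ f 0 s
  have arc_tr : ∀ {x : M} {r : ℝ} (_ : IsRadius x r) {p q : M} (a : FlatArc p q),
      (∀ t, a t ∈ box x r) → tr x₀ a.cont 0 1 = ray x₀ x r q * (ray x₀ x r p)⁻¹ := by
    intro x r hr p q a ha
    have := tr_eq_ray x₀ hr a.toCurve (s := 0) (t := 1) fun u _ => ha u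
    rwa [a.zero, a.one] at this
  have ray_change : ∀ {x x' : M} {r r' : ℝ} (_ : IsRadius x r) (_ : IsRadius x' r'),
      box x' r' ⊆ box x r → ∀ y ∈ box x' r', ∀ z ∈ box x' r',
      ray x₀ x r y * (ray x₀ x r z)⁻¹ = ray x₀ x' r' y * (ray x₀ x' r' z)⁻¹ := by
    intro x x' r r' hr hr' hsub y hy z hz
    obtain ⟨δ, hδ⟩ := exists_path_box hr' hz hy
    rw [← elt_eq_ray x₀ hr δ fun t => hsub (hδ t), elt_eq_ray x₀ hr' δ hδ]
  have local_const : ∀ x r s s', IsRadius x r → (∀ u ∈ uIcc s s', f u ∈ box x r) → S s → S s' := by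
    intro x r s s' hr hI hs x' r' hr' hs' q' hq1 hq2
    have hbox : box x' r' ∩ box x r ∈ 𝓝 (f s') :=
      inter_mem ((isOpen_box _ _).mem_nhds hs') ((isOpen_box _ _).mem_nhds (hI _ right_mem_uIcc))
    obtain ⟨r₂, hr₂, hsub⟩ := exists_box_subset _ hbox
    obtain ⟨w, hw, hw', -⟩ := exists_point_box h𝓑 hr₂ (P := fun _ => True) (by simp)
    obtain ⟨a, ha, ha'⟩ := hs x r hr (hI _ left_mem_uIcc) w (hsub hw).2 hw'
    obtain ⟨e, he, he'⟩ := exists_arc_box hM h𝓑 hr' (hsub hw).1 hq1 hw' hq2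
    refine ⟨a.trans e, fun b hb => FlatArc.isTransverse_trans (ha b hb) (he' b hb), ?_⟩
    have c1 : tr x₀ f s s' = ray x₀ x r (f s') * (ray x₀ x r (f s))⁻¹ := by
      rw [← elt_map_eq_tr x₀ f (Path.segment s s')]
      refine elt_eq_ray x₀ hr _ fun u => hI _ ?_
      rw [← segment_eq_uIcc, ← Path.range_segment]
      exact mem_range_self u
    have m := mem_box (f s') hr₂.1
    have c2 := ray_change hr hr₂ (fun y hy => (hsub hy).2) w hw _ m
    have c3 := ray_change hr' hr₂ (fun y hy => (hsub hy).1) w hw _ m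
    rw [FlatArc.tr_trans, ha', arc_tr hr' e he, ← tr_mul x₀ f 0 s s', c1]
    rw [← c3] at c2
    have c4 : ray x₀ x r w = ray x₀ x' r' w * (ray x₀ x' r' (f s'))⁻¹ * ray x₀ x r (f s') := by
      rw [← c2]; group
    rw [c4]
    group
  have h0 : S 0 := by
    intro x r hr hx q' hq1 hq2
    rw [f0] at hx
    obtain ⟨e, he, he'⟩ := exists_arc_box hM h𝓑 hr hx hq1 hp hq2
    exact ⟨e, he', by rw [arc_tr hr e he, f0, tr_self, mul_one]⟩
  have h1 : S 0 ↔ S 1 := by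
    refine isPreconnected_univ.induction₂ (fun s s' : ℝ => S s ↔ S s') (fun s _ => ?_)
      (fun _ _ _ _ _ _ h h' => h.trans h') (fun _ _ _ _ h => h.symm) (mem_univ 0) (mem_univ 1)
    obtain ⟨r, hr⟩ := exists_isRadius (f s)
    have : f ⁻¹' box (f s) r ∈ 𝓝 s := f.continuous.continuousAt.preimage_mem_nhds
      ((isOpen_box _ _).mem_nhds (mem_box _ hr.1))
    obtain ⟨ε, hε, hb⟩ := Metric.mem_nhds_iff.1 this
    rw [nhdsWithin_univ]
    filter_upwards [Metric.ball_mem_nhds s hε] with s' hs'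
    have hu := (convex_ball s ε).ordConnected.uIcc_subset (Metric.mem_ball_self hε) hs'
    have hu' := (convex_ball s ε).ordConnected.uIcc_subset hs' (Metric.mem_ball_self hε)
    exact ⟨local_const _ r s s' hr fun u h => hb (hu h), local_const _ r s' s hr
      fun u h => hb (hu' h)⟩
  obtain ⟨r, hr⟩ := exists_isRadius q
  have hm := mem_box q hr.1
  obtain ⟨a, ha, ha'⟩ := h1.1 h0 q r hr (by rwa [f1]) q hm hq
  refine ⟨a, ha, ?_⟩
  rw [ha', f1, mul_inv_cancel, one_mul, hγ]

end
end

noncomputable section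

/-! ### The derivation defined by a closed curve: homotopy invariance -/

open Set Filter Topology

section

variable {M : Type*} [TopologicalSpace M] [ChartedSpace Plane M]

lemma IsTransverse.isGood {b f : Curve M} (h : IsTransverse f b) {s s' : ℝ} (hs : s ≤ s')
    (h0 : ∀ t, f s ≠ b t) (h1 : ∀ t, f s' ≠ b t) : IsGood b f s s' :=
  ⟨hs, fun _ _ _ he => h _ _ he, h0, h1⟩

variable [PathConnectedSpace M] (x₀ : M)

lemma der_self {b f : Curve M} {s : ℝ} (h : ∀ t, f s ≠ b t) : der x₀ b f s s = 0 := by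
  rw [der]
  apply finsum_mem_eq_zero_of_forall_eq_zero
  rintro z ⟨h1, h2⟩
  rw [Icc_self, mem_singleton_iff] at h1
  exact absurd (h1 ▸ h2) (h _)

lemma der_const {b : Curve M} {p : M} (h : ∀ t, p ≠ b t) (s s' : ℝ) :
    der x₀ b (FlatArc.const p).toCurve s s' = 0 := by
  rw [der]
  apply finsum_mem_eq_zero_of_forall_eq_zero
  rintro z ⟨h1, h2⟩
  exact absurd h2 (h _)

variable [IsManifold (𝓡 2) ∞ M] [T2Space M] {y : M} {b : FlatArc y y}

lemma der_add {f : Curve M} {s s' s'' : ℝ} (h : IsGood b.toCurve f s s')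
    (h' : IsGood b.toCurve f s' s'') :
    der x₀ b.toCurve f s s'' =
      der x₀ b.toCurve f s' s'' * MonoidAlgebra.single (tr x₀ f.cont s s') 1 +
      MonoidAlgebra.single (tr x₀ f.cont s' s'') 1 * der x₀ b.toCurve f s s' := by
  have hset : {z : ℝ × ℝ | z.1 ∈ Icc s s'' ∧ f z.1 = b z.2} =
      {z : ℝ × ℝ | z.1 ∈ Icc s' s'' ∧ f z.1 = b z.2} ∪
      {z : ℝ × ℝ | z.1 ∈ Icc s s' ∧ f z.1 = b z.2} := by
    ext z
    have e := Icc_union_Icc_eq_Icc h.le h'.le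
    constructor
    · rintro ⟨h1, h2⟩
      rw [← e] at h1
      exact h1.elim (fun h1 => Or.inr ⟨h1, h2⟩) fun h1 => Or.inl ⟨h1, h2⟩
    · rintro (⟨h1, h2⟩ | ⟨h1, h2⟩)
      · exact ⟨e ▸ Or.inr h1, h2⟩
      · exact ⟨e ▸ Or.inl h1, h2⟩
  have hdisj : Disjoint {z : ℝ × ℝ | z.1 ∈ Icc s' s'' ∧ f z.1 = b z.2}
      {z : ℝ × ℝ | z.1 ∈ Icc s s' ∧ f z.1 = b z.2} := by
    rw [disjoint_left]
    rintro z ⟨h1, h2⟩ ⟨h3, -⟩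
    have : z.1 = s' := le_antisymm h3.2 h1.1
    rw [this] at h2
    exact h.right_ne _ h2
  rw [der, hset, finsum_mem_union hdisj h'.finite h.finite]
  congr 1
  · have := (AddMonoidHom.mulRight (MonoidAlgebra.single (tr x₀ f.cont s s') (1 : ℝ))).map_finsum_mem
      (fun z : ℝ × ℝ => MonoidAlgebra.single (tr x₀ f.cont z.1 s'' * ins x₀ b.toCurve z.2 *
        tr x₀ f.cont s' z.1) (csign f b.toCurve z.1 z.2)) h'.finite
    refine (finsum_mem_congr rfl fun z _ => ?_).trans this.symm
    rw [AddMonoidHom.coe_mulRight]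
    dsimp only
    rw [MonoidAlgebra.single_mul_single, mul_one, mul_assoc _ (tr x₀ f.cont s' z.1),
      tr_mul]
  · have := (AddMonoidHom.mulLeft (MonoidAlgebra.single (tr x₀ f.cont s' s'') (1 : ℝ))).map_finsum_mem
      (fun z : ℝ × ℝ => MonoidAlgebra.single (tr x₀ f.cont z.1 s' * ins x₀ b.toCurve z.2 *
        tr x₀ f.cont s z.1) (csign f b.toCurve z.1 z.2)) h.finite
    refine (finsum_mem_congr rfl fun z _ => ?_).trans this.symm
    rw [AddMonoidHom.coe_mulLeft, MonoidAlgebra.single_mul_single, one_mul, ← mul_assoc, ← mul_assoc,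
      tr_mul]

/-- The transport along a curve together with the derivation. -/
def dtr (b f : Curve M) (s s' : ℝ) : TrivSqZeroExt (MonoidAlgebra ℝ (FundamentalGroup M x₀))
    (MonoidAlgebra ℝ (FundamentalGroup M x₀)) :=
  TrivSqZeroExt.inl (MonoidAlgebra.single (tr x₀ f.cont s s') 1) +
    TrivSqZeroExt.inr (der x₀ b f s s')

lemma dtr_eq_iff {b f f' : Curve M} {s s' t t' : ℝ} : dtr x₀ b f s s' = dtr x₀ b f' t t' ↔
    tr x₀ f.cont s s' = tr x₀ f'.cont t t' ∧ der x₀ b f s s' = der x₀ b f' t t' := by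
  constructor
  · intro h
    refine ⟨?_, by simpa [dtr] using congrArg TrivSqZeroExt.snd h⟩
    have := congrArg TrivSqZeroExt.fst h
    simp only [dtr, TrivSqZeroExt.fst_add, TrivSqZeroExt.fst_inl, TrivSqZeroExt.fst_inr,
      add_zero] at this
    exact MonoidAlgebra.single_left_injective one_ne_zero this
  · rintro ⟨h1, h2⟩
    rw [dtr, dtr, h1, h2]

lemma dtr_mul {f : Curve M} {s s' s'' : ℝ} (h : IsGood b.toCurve f s s')
    (h' : IsGood b.toCurve f s' s'') :
    dtr x₀ b.toCurve f s' s'' * dtr x₀ b.toCurve f s s' = dtr x₀ b.toCurve f s s'' := by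
  ext1
  · simp only [dtr, TrivSqZeroExt.fst_mul, TrivSqZeroExt.fst_add, TrivSqZeroExt.fst_inl,
      TrivSqZeroExt.fst_inr, add_zero]
    rw [MonoidAlgebra.single_mul_single, tr_mul, mul_one]
  · rw [TrivSqZeroExt.snd_mul]
    simp only [dtr, TrivSqZeroExt.fst_add, TrivSqZeroExt.fst_inl, TrivSqZeroExt.snd_add,
      TrivSqZeroExt.fst_inr, add_zero, TrivSqZeroExt.snd_inl, TrivSqZeroExt.snd_inr, zero_add]
    rw [der_add x₀ h h', add_comm]
    rfl

lemma dtr_self {f : Curve M} {s : ℝ} (h : ∀ t, f s ≠ b t) : dtr x₀ b.toCurve f s s = 1 := by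
  rw [dtr, der_self x₀ h, tr_self, TrivSqZeroExt.inr_zero, add_zero]
  rfl

lemma dtr_const {p : M} (h : ∀ t, p ≠ b t) (s s' : ℝ) :
    dtr x₀ b.toCurve (FlatArc.const p).toCurve s s' = 1 := by
  rw [dtr, der_const x₀ h, FlatArc.tr_const, TrivSqZeroExt.inr_zero, add_zero]
  rfl

lemma dtr_eq_of_box (hM : IsOrientedAtlas M) {x : M} {R : ℝ} (hR : IsRadius x (3 * R))
    {f f' : Curve M} {s₀ s₁ s₀' s₁' : ℝ} (h : IsGood b.toCurve f s₀ s₁)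
    (h' : IsGood b.toCurve f' s₀' s₁') (hf : ∀ u ∈ Icc s₀ s₁, f u ∈ box x R)
    (hf' : ∀ u ∈ Icc s₀' s₁', f' u ∈ box x R) (e0 : f s₀ = f' s₀') (e1 : f s₁ = f' s₁') :
    dtr x₀ b.toCurve f s₀ s₁ = dtr x₀ b.toCurve f' s₀' s₁' := by
  rw [dtr_eq_iff]
  refine ⟨?_, h.der_eq x₀ hM hR h' hf hf' e0 e1⟩
  have h3 : R ≤ 3 * R := by have := hR.1; linarith
  rw [tr_eq_ray x₀ hR f, tr_eq_ray x₀ hR f', e0, e1]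
  · intro u hu
    rw [uIcc_of_le h'.le] at hu
    exact box_mono x h3 (hf' u hu)
  · intro u hu
    rw [uIcc_of_le h.le] at hu
    exact box_mono x h3 (hf u hu)

lemma exists_notCrossing {p q : M} {a : FlatArc p q} (h : IsTransverse a.toCurve b.toCurve)
    {s s' : ℝ} (hs : s < s') : ∃ u, s < u ∧ u < s' ∧ ∀ t, a u ≠ b t := by
  have hfin : {z : ℝ × ℝ | a z.1 = b z.2}.Finite := by
    refine (finite_crossings (f := a.toCurve) (h := b.toCurve) (isCompact_Icc.prod isCompact_Icc :
      IsCompact (Icc (0 : ℝ) 1 ×ˢ Icc (0 : ℝ) 1)) fun z _ he => h _ _ he).subset ?_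
    intro z hz
    exact ⟨⟨Ioo_subset_Icc_self (a.mem_Ioo_of_vdet_ne_zero (h _ _ hz)),
      Ioo_subset_Icc_self (b.mem_Ioo_of_vdet_ne_zero' hz (h _ _ hz))⟩, hz⟩
  obtain ⟨u, hu, hu'⟩ := (Ioo_infinite hs).exists_notMem_finite (hfin.image Prod.fst)
  exact ⟨u, hu.1, hu.2, fun t e => hu' ⟨(u, t), e, rfl⟩⟩

lemma FlatArc.path_extend {p q : M} (a : FlatArc p q) (s : ℝ) : a.path.extend s = a s := by
  rcases le_total s 0 with h | h
  · rw [Path.extend_of_le_zero _ h, a.eq_left h]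
  · rcases le_total s 1 with h' | h'
    · rw [Path.extend_apply _ ⟨h, h'⟩]; rfl
    · rw [Path.extend_of_one_le _ h', a.eq_right h']

/-- The derivation defined by `b`, evaluated on transverse arcs, only depends on the homotopy
class of the arc. -/
theorem der_eq_of_tr_eq [CompactSpace M] (hM : IsOrientedAtlas M) {p q : M} (hp : ∀ t, p ≠ b t)
    (hq : ∀ t, q ≠ b t) {a a' : FlatArc p q} (ha : IsTransverse a.toCurve b.toCurve)
    (ha' : IsTransverse a'.toCurve b.toCurve) (h : tr x₀ a.cont 0 1 = tr x₀ a'.cont 0 1) :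
    der x₀ b.toCurve a.toCurve 0 1 = der x₀ b.toCurve a'.toCurve 0 1 := by
  classical
  have hhom : a.path.Homotopic a'.path :=
    homotopic_of_elt_eq x₀ (by rw [FlatArc.elt_path, FlatArc.elt_path, h])
  have : SecondCountableTopology M := ChartedSpace.secondCountable_of_sigmaCompact Plane M
  let _ := TopologicalSpace.metrizableSpaceMetric M
  have h1 : ∀ x : M, ∃ R, IsRadius x (3 * R) := fun x => by
    obtain ⟨r, hr⟩ := exists_isRadius x
    exact ⟨r / 3, by rwa [mul_div_cancel₀ _ (by norm_num : (3 : ℝ) ≠ 0)]⟩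
  choose R hR using h1
  have hR0 : ∀ x, 0 < R x := fun x => by have := (hR x).1; linarith
  obtain ⟨δ, hδ, hbox⟩ := lebesgue_number_lemma_of_metric (isCompact_univ (X := M))
    (fun x : M => isOpen_box x (R x)) fun x _ => mem_iUnion.2 ⟨x, mem_box x (hR0 x)⟩
  have h2 : ∀ x : M, ∃ r, IsRadius x r ∧ box x r ⊆ Metric.ball x (δ / 4) := fun x =>
    exists_box_subset x (Metric.ball_mem_nhds x (by positivity))
  choose r hr hrb using h2
  obtain ⟨δ', hδ', hbox'⟩ := lebesgue_number_lemma_of_metric (isCompact_univ (X := M))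
    (fun x : M => isOpen_box x (r x)) fun x _ => mem_iUnion.2 ⟨x, mem_box x (hr x).1⟩
  set S : Set M := {p : M | IsOff {b.toCurve} p} with hS
  have hoff : ∀ {p : M}, p ∈ S → ∀ t, p ≠ b t := fun hp t => (hp _ rfl t).symm
  have hex : ∀ p ∈ S, ∀ q ∈ S, dist p q < δ' → ∃ c : FlatArc p q,
      (∀ t, c t ∈ Metric.ball p (δ / 2)) ∧ IsTransverse c.toCurve b.toCurve := by
    intro p hp q hq hpq
    obtain ⟨x, hx⟩ := hbox' p trivial
    have hpx := hx (Metric.mem_ball_self hδ')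
    have hqx := hx (Metric.mem_ball'.2 hpq)
    obtain ⟨c, hc, hc'⟩ := exists_arc_box hM (countable_singleton b.toCurve) (hr x) hpx hqx hp hq
    refine ⟨c, fun t => ?_, hc' _ rfl⟩
    have i1 := Metric.mem_ball.1 (hrb x (hc t))
    have i2 := Metric.mem_ball'.1 (hrb x hpx)
    have := dist_triangle (c t) x p
    rw [Metric.mem_ball]; linarith
  let u : M → M → TrivSqZeroExt (MonoidAlgebra ℝ (FundamentalGroup M x₀))
      (MonoidAlgebra ℝ (FundamentalGroup M x₀)) := fun p q =>
    if H : ∃ c : FlatArc p q, (∀ t, c t ∈ Metric.ball p (δ / 2)) ∧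
      IsTransverse c.toCurve b.toCurve then dtr x₀ b.toCurve H.choose.toCurve 0 1 else 1
  have hu : ∀ p ∈ S, ∀ q ∈ S, dist p q < δ' → ∀ (f : Curve M) (s s' : ℝ), IsGood b.toCurve f s s' →
      (∀ t ∈ Icc s s', f t ∈ Metric.ball p δ) → f s = p → f s' = q →
      u p q = dtr x₀ b.toCurve f s s' := by
    intro p hp q hq hpq f s s' hf hfb e0 e1
    have H := hex p hp q hq hpq
    simp only [u]
    rw [dif_pos H]
    obtain ⟨hc, hc'⟩ := H.choose_spec
    obtain ⟨x, hx⟩ := hbox p trivial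
    refine dtr_eq_of_box x₀ hM (hR x) (hc'.isGood zero_le_one ?_ ?_) hf
      (fun t _ => hx (Metric.ball_subset_ball (by linarith) (hc t))) (fun t ht => hx (hfb t ht)) ?_ ?_
    · rw [H.choose.zero]; exact hoff hp
    · rw [H.choose.one]; exact hoff hq
    · rw [H.choose.zero, e0]
    · rw [H.choose.one, e1]
  have hcoc : IsLocalCocycle u S (min δ' (δ / 2)) := by
    refine ⟨lt_min hδ' (by positivity), fun p hp => ?_, fun p hp q hq w hw i1 i2 i3 => ?_⟩
    · have := hoff hp
      rw [hu p hp p hp (by simpa using hδ') (FlatArc.const p).toCurve 0 0 ⟨le_rfl,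
        fun _ _ t e => absurd e (this t), this, this⟩ (fun t _ => Metric.mem_ball_self hδ) rfl rfl,
        dtr_const x₀ this]
    · have j1 := i1.trans_le (min_le_left _ _)
      have j2 := i2.trans_le (min_le_left _ _)
      have j3 := i3.trans_le (min_le_left _ _)
      have j4 := i1.trans_le (min_le_right _ _)
      obtain ⟨c, hc, hct⟩ := hex p hp q hq j1
      obtain ⟨d, hd, hdt⟩ := hex q hq w hw j2
      have hcd := FlatArc.isTransverse_trans hct hdt
      have hd' : ∀ t, d t ∈ Metric.ball p δ := fun t => by
        have := Metric.mem_ball.1 (hd t)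
        have h3 := dist_triangle (d t) q p
        rw [dist_comm q p] at h3
        rw [Metric.mem_ball]; linarith
      have hc2 : ∀ t, c t ∈ Metric.ball p δ := fun t =>
        Metric.ball_subset_ball (by linarith) (hc t)
      have v1 : c.trans d (1 / 2) = q := by rw [FlatArc.trans_of_le c d le_rfl]; norm_num
      have g1 : IsGood b.toCurve (c.trans d).toCurve 0 (1 / 2) := by
        refine hcd.isGood (by norm_num) ?_ ?_
        · rw [FlatArc.zero]; exact hoff hp
        · rw [v1]; exact hoff hq
      have g2 : IsGood b.toCurve (c.trans d).toCurve (1 / 2) 1 := by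
        refine hcd.isGood (by norm_num) ?_ ?_
        · rw [v1]; exact hoff hq
        · rw [FlatArc.one]; exact hoff hw
      have g3 : IsGood b.toCurve (c.trans d).toCurve 0 1 := by
        refine hcd.isGood (by norm_num) ?_ ?_
        · rw [FlatArc.zero]; exact hoff hp
        · rw [FlatArc.one]; exact hoff hw
      rw [hu p hp q hq j1 _ _ _ g1 (fun t _ => FlatArc.trans_mem hc2 hd' t) (FlatArc.zero _) v1,
        hu q hq w hw j2 _ _ _ g2 (fun t ht => by
          rw [FlatArc.trans_of_ge c d ht.1]
          exact Metric.ball_subset_ball (by linarith) (hd _)) v1 (FlatArc.one _),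
        hu p hp w hw j3 _ _ _ g3 (fun t _ => FlatArc.trans_mem hc2 hd' t) (FlatArc.zero _)
          (FlatArc.one _), dtr_mul x₀ g1 g2]
  have hpS : p ∈ S := fun _ hb t => by rw [mem_singleton_iff.1 hb]; exact (hp t).symm
  have hqS : q ∈ S := fun _ hb t => by rw [mem_singleton_iff.1 hb]; exact (hq t).symm
  have hol : ∀ {c : FlatArc p q}, IsTransverse c.toCurve b.toCurve →
      IsHolonomy u c.path.extend {s | s ∈ Icc (0 : ℝ) 1 ∧ c s ∈ S} (dtr x₀ b.toCurve c.toCurve) := by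
    intro c hc
    have hS' : ∀ {s : ℝ}, (∀ t, c s ≠ b t) → c s ∈ S := fun h _ hb t => by
      rw [mem_singleton_iff.1 hb]; exact (h t).symm
    refine ⟨⟨by simp, by simpa using hpS⟩, ⟨by simp, by simpa using hqS⟩, fun s s' h0 h1 hs => ?_,
      fun s hs => dtr_self x₀ (hoff hs.2), fun s hs s' hs' s'' hs'' _ i1 i2 _ =>
      dtr_mul x₀ (hc.isGood i1 (hoff hs.2) (hoff hs'.2)) (hc.isGood i2 (hoff hs'.2) (hoff hs''.2)),
      ?_⟩
    · obtain ⟨v, v1, v2, hv⟩ := exists_notCrossing hc hs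
      exact ⟨v, ⟨⟨by linarith, by linarith⟩, hS' hv⟩, v1, v2⟩
    · have huc := isCompact_Icc (a := (0 : ℝ)) (b := 1) |>.uniformContinuousOn_of_continuous
        c.continuous.continuousOn
      obtain ⟨η, hη, hηc⟩ := Metric.uniformContinuousOn_iff.1 huc (min δ δ') (lt_min hδ hδ')
      refine ⟨η, hη, fun s hs s' hs' i0 i1 i2 i3 => ?_⟩
      rw [FlatArc.path_extend, FlatArc.path_extend]
      have hd : ∀ t ∈ Icc s s', dist (c t) (c s) < min δ δ' := fun t ht => by
        refine hηc t ⟨i0.trans ht.1, ht.2.trans i2⟩ s hs.1 ?_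
        rw [Real.dist_eq, abs_of_nonneg (by linarith [ht.1])]
        linarith [ht.2]
      refine (hu _ hs.2 _ hs'.2 ?_ c.toCurve s s' (hc.isGood i1 (hoff hs.2) (hoff hs'.2))
        (fun t ht => (hd t ht).trans_le (min_le_left _ _)) rfl rfl).symm
      rw [dist_comm]
      exact (hd s' ⟨i1, le_rfl⟩).trans_le (min_le_right _ _)
  have := hcoc.holonomy_homotopy_invariant (dense_isOff (countable_singleton b.toCurve)) hhom
    (hol ha) (hol ha') (fun s hs => by rw [FlatArc.path_extend]; exact hs.2)
    (fun s hs => by rw [FlatArc.path_extend]; exact hs.2)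
  exact ((dtr_eq_iff x₀).1 this).2

end
end

noncomputable section

/-! ### Signed weighted sums over the crossings of two curves -/

open Set Filter Topology

lemma one_third_lt_of_step_ne_zero {t : ℝ} (h : step t ≠ 0) : 1 / 3 < t :=
  not_le.1 fun h' => h (step_eq_zero h')

lemma lt_two_thirds_of_step_ne_one {t : ℝ} (h : step t ≠ 1) : t < 2 / 3 :=
  not_le.1 fun h' => h (step_eq_one h')

lemma strictMonoOn_step : StrictMonoOn step (Icc (1 / 3) (2 / 3)) := by
  refine strictMonoOn_of_deriv_pos (convex_Icc _ _) contDiff_step.continuous.continuousOn ?_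
  intro t ht
  rw [interior_Icc] at ht
  obtain ⟨k, hk, hd⟩ := step_hasDerivAt_pos ht.1 ht.2
  rwa [hd.deriv]

lemma exists_step_eq {v : ℝ} (h : v ∈ Icc (0 : ℝ) 1) : ∃ u ∈ Icc (1 / 3 : ℝ) (2 / 3), step u = v := by
  have := intermediate_value_Icc (by norm_num : (1 / 3 : ℝ) ≤ 2 / 3)
    contDiff_step.continuous.continuousOn (f := step)
  rw [step_eq_zero le_rfl, step_eq_one le_rfl] at this
  exact this h

section

variable {M : Type*} [TopologicalSpace M] [ChartedSpace Plane M]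

/-- The crossings of two curves, with the parameters restricted to two sets. -/
def crossingSet (f h : Curve M) (I I' : Set ℝ) : Set (ℝ × ℝ) :=
  {z | z.1 ∈ I ∧ z.2 ∈ I' ∧ f z.1 = h z.2}

variable {V : Type*} [AddCommGroup V] [Module ℝ V]

/-- The sum of the signs of the crossings of two curves, with weights. -/
def pairing (f h : Curve M) (I I' : Set ℝ) (W : ℝ → ℝ → V) : V :=
  ∑ᶠ z ∈ crossingSet f h I I', csign f h z.1 z.2 • W z.1 z.2

lemma pairing_congr {f h : Curve M} {I I' : Set ℝ} {W W' : ℝ → ℝ → V}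
    (H : ∀ s ∈ I, ∀ t ∈ I', f s = h t → W s t = W' s t) :
    pairing f h I I' W = pairing f h I I' W' :=
  finsum_mem_congr rfl fun z hz => by rw [H _ hz.1 _ hz.2.1 hz.2.2]

lemma pairing_map {V' : Type*} [AddCommGroup V'] [Module ℝ V'] {f h : Curve M} {I I' : Set ℝ}
    (hfin : (crossingSet f h I I').Finite) (W : ℝ → ℝ → V) (φ : V →ₗ[ℝ] V') :
    φ (pairing f h I I' W) = pairing f h I I' fun s t => φ (W s t) := by
  have := φ.toAddMonoidHom.map_finsum_mem (fun z : ℝ × ℝ => csign f h z.1 z.2 • W z.1 z.2) hfin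
  exact this.trans (finsum_mem_congr rfl fun z _ => φ.map_smul _ _)

lemma pairing_add {f h : Curve M} {I I' : Set ℝ} (hfin : (crossingSet f h I I').Finite)
    (W W' : ℝ → ℝ → V) : pairing f h I I' (fun s t => W s t + W' s t) =
      pairing f h I I' W + pairing f h I I' W' := by
  rw [pairing, pairing, pairing, ← finsum_mem_add_distrib hfin]
  exact finsum_mem_congr rfl fun z _ => smul_add _ _ _

lemma pairing_mem {f h : Curve M} {I I' : Set ℝ} {W : ℝ → ℝ → V} {N : Submodule ℝ V}
    (H : ∀ s ∈ I, ∀ t ∈ I', W s t ∈ N) : pairing f h I I' W ∈ N :=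
  finsum_mem_induction (· ∈ N) N.zero_mem (fun _ _ => N.add_mem)
    fun _ hz => N.smul_mem _ (H _ hz.1 _ hz.2.1)

lemma pairing_union_right {f h : Curve M} {I I₁ I₂ : Set ℝ} (W : ℝ → ℝ → V)
    (h1 : (crossingSet f h I I₁).Finite) (h2 : (crossingSet f h I I₂).Finite)
    (hd : ∀ s ∈ I, ∀ t ∈ I₁ ∩ I₂, f s ≠ h t) :
    pairing f h I (I₁ ∪ I₂) W = pairing f h I I₁ W + pairing f h I I₂ W := by
  have hU : crossingSet f h I (I₁ ∪ I₂) = crossingSet f h I I₁ ∪ crossingSet f h I I₂ := by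
    ext z
    constructor
    · rintro ⟨h3, h4 | h4, h5⟩
      exacts [Or.inl ⟨h3, h4, h5⟩, Or.inr ⟨h3, h4, h5⟩]
    · rintro (⟨h3, h4, h5⟩ | ⟨h3, h4, h5⟩)
      exacts [⟨h3, Or.inl h4, h5⟩, ⟨h3, Or.inr h4, h5⟩]
  rw [pairing, pairing, pairing, hU, finsum_mem_union _ h1 h2]
  rw [disjoint_left]
  exact fun z hz hz' => hd _ hz.1 _ ⟨hz.2.1, hz'.2.1⟩ hz.2.2

section Manifold

variable [IsManifold (𝓡 2) ∞ M]

lemma pairing_swap (f h : Curve M) (I I' : Set ℝ) (W : ℝ → ℝ → V) :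
    pairing f h I I' W = -pairing h f I' I fun t s => W s t := by
  have hneg : -pairing h f I' I (fun t s => W s t) =
      ∑ᶠ z ∈ crossingSet h f I' I, -(csign h f z.1 z.2 • W z.2 z.1) := by
    rw [pairing, ← AddEquiv.neg_apply, AddEquiv.map_finsum]
    exact finsum_congr fun z => (AddEquiv.neg V).map_finsum _
  rw [hneg, pairing]
  refine finsum_mem_eq_of_bijOn Prod.swap ⟨?_, Prod.swap_injective.injOn, ?_⟩ ?_
  · exact fun z hz => ⟨hz.2.1, hz.1, hz.2.2.symm⟩
  · exact fun z hz => ⟨z.swap, ⟨hz.2.1, hz.1, hz.2.2.symm⟩, rfl⟩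
  · intro z hz
    simp only [Prod.fst_swap, Prod.snd_swap]
    rw [csign_swap hz.2.2, neg_smul, neg_neg]

lemma pairing_reindex {f h h' : Curve M} {I I₁ I₂ : Set ℝ} {σ : ℝ → ℝ} (W : ℝ → ℝ → V)
    (heq : ∀ u ∈ I₁, ∀ᶠ v in 𝓝 u, h' v = h (σ v))
    (hmap : ∀ u ∈ I₁, σ u ∈ I₂)
    (hder : ∀ u ∈ I₁, (∃ s ∈ I, f s = h (σ u)) → ∃ k > 0, HasDerivAt σ k u)
    (hinj : InjOn σ {u | u ∈ I₁ ∧ ∃ s ∈ I, f s = h (σ u)})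
    (hsurj : ∀ t ∈ I₂, (∃ s ∈ I, f s = h t) → ∃ u ∈ I₁, σ u = t) :
    pairing f h' I I₁ (fun s u => W s (σ u)) = pairing f h I I₂ W := by
  have heq' : ∀ u ∈ I₁, h' u = h (σ u) := fun u hu => (heq u hu).self_of_nhds
  refine finsum_mem_eq_of_bijOn (fun z : ℝ × ℝ => (z.1, σ z.2)) ⟨?_, ?_, ?_⟩ ?_
  · exact fun z hz => ⟨hz.1, hmap _ hz.2.1, hz.2.2.trans (heq' _ hz.2.1)⟩
  · intro z hz w hw e
    obtain ⟨e1, e2⟩ := Prod.mk.inj e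
    exact Prod.ext e1 (hinj ⟨hz.2.1, z.1, hz.1, hz.2.2.trans (heq' _ hz.2.1)⟩
      ⟨hw.2.1, w.1, hw.1, hw.2.2.trans (heq' _ hw.2.1)⟩ e2)
  · intro z hz
    obtain ⟨u, hu, e⟩ := hsurj _ hz.2.1 ⟨_, hz.1, hz.2.2⟩
    exact ⟨(z.1, u), ⟨hz.1, hu, by rw [heq' u hu, e]; exact hz.2.2⟩, by simp [e]⟩
  · intro z hz
    have e := hz.2.2.trans (heq' _ hz.2.1)
    obtain ⟨k, hk, hd⟩ := hder _ hz.2.1 ⟨_, hz.1, e⟩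
    simp only
    rw [csign_swap hz.2.2.symm, csign_reparam (heq _ hz.2.1) hd hk, ← csign_swap e.symm]

variable [T2Space M]

lemma finite_crossingSet {f h : Curve M} (H : IsTransverse f h) (s s' t t' : ℝ) :
    (crossingSet f h (Icc s s') (Icc t t')).Finite := by
  refine (finite_crossings (f := f) (h := h) (isCompact_Icc.prod isCompact_Icc :
    IsCompact (Icc s s' ×ˢ Icc t t')) fun z _ he => H _ _ he).subset ?_
  exact fun z hz => ⟨⟨hz.1, hz.2.1⟩, hz.2.2⟩

lemma pairing_split {f h : Curve M} (H : IsTransverse f h) (s s' : ℝ) {t t' t'' : ℝ}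
    (h1 : t ≤ t') (h2 : t' ≤ t'') (hoff : ∀ u, f u ≠ h t') (W : ℝ → ℝ → V) :
    pairing f h (Icc s s') (Icc t t'') W =
      pairing f h (Icc s s') (Icc t t') W + pairing f h (Icc s s') (Icc t' t'') W := by
  rw [← Icc_union_Icc_eq_Icc h1 h2, pairing_union_right W (finite_crossingSet H _ _ _ _)
    (finite_crossingSet H _ _ _ _)]
  rintro u - v ⟨h3, h4⟩
  rw [le_antisymm h3.2 h4.1]
  exact hoff u

/-- Additivity under concatenation of the second curve. -/
lemma pairing_trans {f : Curve M} {s s' : ℝ} {x y z : M} {b : FlatArc x y} {b' : FlatArc y z}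
    (H : IsTransverse f b.toCurve) (H' : IsTransverse f b'.toCurve) (W : ℝ → ℝ → V) :
    pairing f (b.trans b').toCurve (Icc s s') (Icc 0 1) W =
      pairing f b.toCurve (Icc s s') (Icc 0 1) (fun s t => W s (t / 2)) +
      pairing f b'.toCurve (Icc s s') (Icc 0 1) (fun s t => W s ((t + 1) / 2)) := by
  have H2 : IsTransverse f (b.trans b').toCurve :=
    (FlatArc.isTransverse_trans H.symm H'.symm).symm
  rw [pairing_split H2 s s' (t' := 1 / 2) (by norm_num) (by norm_num)]
  · congr 1
    · rw [← pairing_reindex (f := f) (h' := (b.trans b').toCurve) (h := b.toCurve) (I₁ := Icc 0 (1 / 2))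
        (σ := fun u => 2 * u)]
      · exact pairing_congr fun s _ t _ _ => by congr 1; ring
      · exact fun u hu => FlatArc.transFun_eventually_left b b' hu.2
      · exact fun u hu => ⟨by linarith [hu.1], by linarith [hu.2]⟩
      · exact fun u _ _ => ⟨2, two_pos, by simpa using (hasDerivAt_id u).const_mul 2⟩
      · intro u _ v _ e
        simpa using e
      · exact fun t ht _ => ⟨t / 2, ⟨by linarith [ht.1], by linarith [ht.2]⟩, by ring⟩
    · rw [← pairing_reindex (f := f) (h' := (b.trans b').toCurve) (h := b'.toCurve) (I₁ := Icc (1 / 2) 1)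
        (σ := fun u => 2 * u - 1)]
      · exact pairing_congr fun s _ t _ _ => by congr 1; ring
      · exact fun u hu => FlatArc.transFun_eventually_right b b' hu.1
      · exact fun u hu => ⟨by linarith [hu.1], by linarith [hu.2]⟩
      · exact fun u _ _ => ⟨2, two_pos, by simpa using ((hasDerivAt_id u).const_mul 2).sub_const 1⟩
      · intro u _ v _ e
        simpa using e
      · exact fun t ht _ => ⟨(t + 1) / 2, ⟨by linarith [ht.1], by linarith [ht.2]⟩, by ring⟩
  · intro u hu
    rw [FlatArc.trans_of_le b b' le_rfl] at hu
    have e : (2 * (1 / 2) : ℝ) = 1 := by norm_num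
    rw [e] at hu
    have := b.mem_Ioo_of_vdet_ne_zero' hu (H _ _ hu)
    exact absurd this.2 (lt_irrefl _)

/-- Invariance under flattening of the second curve. -/
lemma pairing_flatten {f h : Curve M} {s s' t t' : ℝ} (ht : t < t') (h0 : ∀ u, f u ≠ h t)
    (h1 : ∀ u, f u ≠ h t') (W : ℝ → ℝ → V) :
    pairing f (FlatArc.flatten h t t').toCurve (Icc s s') (Icc 0 1)
      (fun s u => W s (t + step u * (t' - t))) = pairing f h (Icc s s') (Icc t t') W := by
  have hpos : 0 < t' - t := by linarith
  have key : ∀ u, (∃ v ∈ Icc s s', f v = h (t + step u * (t' - t))) → 1 / 3 < u ∧ u < 2 / 3 := by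
    rintro u ⟨v, -, hv⟩
    refine ⟨one_third_lt_of_step_ne_zero fun h3 => ?_, lt_two_thirds_of_step_ne_one fun h3 => ?_⟩
    · rw [h3, zero_mul, add_zero] at hv
      exact h0 _ hv
    · rw [h3, one_mul, add_sub_cancel] at hv
      exact h1 _ hv
  refine pairing_reindex (σ := fun u => t + step u * (t' - t)) W ?_ ?_ ?_ ?_ ?_
  · exact fun u _ => Eventually.of_forall fun v => rfl
  · intro u _
    have i1 := mul_nonneg (step_nonneg u) hpos.le
    have i2 := mul_le_mul_of_nonneg_right (step_le_one u) hpos.le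
    exact ⟨by linarith, by linarith⟩
  · intro u _ hu
    obtain ⟨k1, k2⟩ := key u hu
    obtain ⟨k, hk, hd⟩ := step_hasDerivAt_pos k1 k2
    exact ⟨k * (t' - t), mul_pos hk hpos, (hd.mul_const _).const_add _⟩
  · rintro u ⟨-, hu⟩ v ⟨-, hv⟩ e
    refine strictMonoOn_step.injOn ⟨(key u hu).1.le, (key u hu).2.le⟩
      ⟨(key v hv).1.le, (key v hv).2.le⟩ ?_
    exact mul_right_cancel₀ hpos.ne' (add_left_cancel e)
  · intro v hv _
    obtain ⟨u, hu, e⟩ := exists_step_eq (v := (v - t) / (t' - t))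
      ⟨div_nonneg (by linarith [hv.1]) hpos.le, by rw [div_le_one hpos]; linarith [hv.2]⟩
    refine ⟨u, ⟨by linarith [hu.1], by linarith [hu.2]⟩, ?_⟩
    rw [e, div_mul_cancel₀ _ hpos.ne']
    ring

lemma isTransverse_flatten {f h : Curve M} (H : IsTransverse f h) {t t' : ℝ} (ht : t < t')
    (h0 : ∀ u, f u ≠ h t) (h1 : ∀ u, f u ≠ h t') :
    IsTransverse f (FlatArc.flatten h t t').toCurve := by
  refine IsTransverse.symm fun u v hv => ?_
  have hv' : h (t + step u * (t' - t)) = f v := hv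
  have k1 := one_third_lt_of_step_ne_zero (t := u) fun h3 => by
    rw [h3, zero_mul, add_zero] at hv'
    exact h0 _ hv'.symm
  have k2 := lt_two_thirds_of_step_ne_one (t := u) fun h3 => by
    rw [h3, one_mul, add_sub_cancel] at hv'
    exact h1 _ hv'.symm
  obtain ⟨k, hk, hd⟩ := step_hasDerivAt_pos k1 k2
  have e : ∀ᶠ w in 𝓝 u, (FlatArc.flatten h t t').toCurve w = h (t + step w * (t' - t)) :=
    Eventually.of_forall fun w => rfl
  rw [vdet_reparam (h := f) (t := v) e ((hd.mul_const _).const_add _)]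
  exact mul_ne_zero (mul_pos hk (by linarith)).ne' (H.symm _ _ hv')

end Manifold

end
end

noncomputable section

/-! ### The bracket of transverse closed arcs -/

open Set Filter Topology

section Algebra

variable {π : Type*} [Group π]

lemma classProj_single (g : π) (r : ℝ) :
    classProj π (MonoidAlgebra.single g r) = Finsupp.single (ConjClasses.mk g) r := by
  simp [classProj, Finsupp.mapDomain_single]

lemma ConjClasses.mk_mul_comm (g h : π) : ConjClasses.mk (g * h) = ConjClasses.mk (h * g) := by
  rw [ConjClasses.mk_eq_mk_iff_isConj, isConj_iff]
  exact ⟨h, by group⟩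

lemma classProj_mul_comm (a b : MonoidAlgebra ℝ π) :
    classProj π (a * b) = classProj π (b * a) := by
  induction a using MonoidAlgebra.induction_linear with
  | zero => simp
  | add a a' h h' => rw [add_mul, mul_add, map_add, map_add, h, h']
  | single g r =>
    induction b using MonoidAlgebra.induction_linear with
    | zero => simp
    | add b b' h h' => rw [add_mul, mul_add, map_add, map_add, h, h']
    | single g' r' =>
      rw [MonoidAlgebra.single_mul_single, MonoidAlgebra.single_mul_single, classProj_single,
        classProj_single, ConjClasses.mk_mul_comm, mul_comm]

end Algebra

section

variable {M : Type*} [TopologicalSpace M] [ChartedSpace Plane M] [PathConnectedSpace M] (x₀ : M)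

/-- The curve `b` is inserted, together with the element `θ` of the group ring, at the crossings
of `a` and `b`. -/
def derT (b : Curve M) (θ : MonoidAlgebra ℝ (FundamentalGroup M x₀)) (a : Curve M) :
    MonoidAlgebra ℝ (FundamentalGroup M x₀) :=
  pairing a b (Icc 0 1) (Icc 0 1) fun s t =>
    MonoidAlgebra.of ℝ _ (tr x₀ a.cont s 1) * MonoidAlgebra.of ℝ _ (tr x₀ b.cont 0 t) * θ *
      MonoidAlgebra.of ℝ _ (tr x₀ b.cont t 1) * MonoidAlgebra.of ℝ _ (tr x₀ a.cont 0 s)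

/-- The sum over the crossings of the classes of the products of two closed curves. -/
def loopSum (a b : Curve M) : ClassSpace (FundamentalGroup M x₀) :=
  pairing a b (Icc 0 1) (Icc 0 1) fun s t =>
    Finsupp.single (ConjClasses.mk (ins x₀ a s * ins x₀ b t)) 1

variable [IsManifold (𝓡 2) ∞ M]

lemma loopSum_swap (a b : Curve M) : loopSum x₀ a b = -loopSum x₀ b a := by
  rw [loopSum, pairing_swap, loopSum]
  congr 2
  ext1 t
  ext1 s
  rw [ConjClasses.mk_mul_comm]

variable [T2Space M]

lemma pairing_trans_left {V : Type*} [AddCommGroup V] [Module ℝ V] {f : Curve M} {s s' : ℝ}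
    {x y z : M} {b : FlatArc x y} {b' : FlatArc y z}
    (H : IsTransverse b.toCurve f) (H' : IsTransverse b'.toCurve f) (W : ℝ → ℝ → V) :
    pairing (b.trans b').toCurve f (Icc 0 1) (Icc s s') W =
      pairing b.toCurve f (Icc 0 1) (Icc s s') (fun t s => W (t / 2) s) +
      pairing b'.toCurve f (Icc 0 1) (Icc s s') (fun t s => W ((t + 1) / 2) s) := by
  rw [pairing_swap, pairing_trans H.symm H'.symm, neg_add, ← pairing_swap b.toCurve,
    ← pairing_swap b'.toCurve]

variable {x y z w : M}

lemma der_eq_derT {a : FlatArc x y} {b : FlatArc z w} (H : IsTransverse a.toCurve b.toCurve) :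
    der x₀ b.toCurve a.toCurve 0 1 = derT x₀ b.toCurve 1 a.toCurve := by
  rw [der, derT, pairing]
  refine finsum_mem_congr ?_ fun z _ => ?_
  · ext z
    exact ⟨fun h => ⟨h.1, Ioo_subset_Icc_self (b.mem_Ioo_of_vdet_ne_zero' h.2 (H _ _ h.2)), h.2⟩,
      fun h => ⟨h.1, h.2.2⟩⟩
  · rw [mul_one, ← map_mul, ← map_mul, ← map_mul, MonoidAlgebra.of_apply,
      MonoidAlgebra.smul_single, ins]
    simp only [mul_assoc, mul_one, smul_eq_mul]

namespace FlatArc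

variable (a : FlatArc x y) (a' : FlatArc y z) {t : ℝ}

lemma tr_trans_zero_half (h1 : t ≤ 1) :
    tr x₀ (a.trans a').cont 0 (t / 2) = tr x₀ a.cont 0 t := by
  rw [tr_trans_left x₀ a a' (by norm_num) (by linarith), mul_zero, mul_div_cancel₀ _ two_ne_zero]

lemma tr_trans_half_one (h0 : 0 ≤ t) :
    tr x₀ (a.trans a').cont ((t + 1) / 2) 1 = tr x₀ a'.cont t 1 := by
  rw [tr_trans_right x₀ a a' (by linarith) (by norm_num), mul_div_cancel₀ _ two_ne_zero]
  norm_num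

lemma tr_trans_half_left (h1 : t ≤ 1) :
    tr x₀ (a.trans a').cont (t / 2) 1 = tr x₀ a'.cont 0 1 * tr x₀ a.cont t 1 := by
  have e1 := tr_mul x₀ (a.trans a').cont 0 (t / 2) 1
  have e2 := tr_mul x₀ a.cont 0 t 1
  rw [tr_trans, tr_trans_zero_half x₀ a a' h1, ← e2, ← mul_assoc] at e1
  exact mul_right_cancel e1

lemma tr_trans_half_right (h0 : 0 ≤ t) :
    tr x₀ (a.trans a').cont 0 ((t + 1) / 2) = tr x₀ a'.cont 0 t * tr x₀ a.cont 0 1 := by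
  have e1 := tr_mul x₀ (a.trans a').cont 0 ((t + 1) / 2) 1
  have e2 := tr_mul x₀ a'.cont 0 t 1
  rw [tr_trans, tr_trans_half_one x₀ a a' h0, ← e2, mul_assoc] at e1
  exact mul_left_cancel e1

end FlatArc

lemma derT_trans_left {f : Curve M} (θ : MonoidAlgebra ℝ (FundamentalGroup M x₀))
    {a : FlatArc x y} {a' : FlatArc y z}
    (H : IsTransverse a.toCurve f) (H' : IsTransverse a'.toCurve f) :
    derT x₀ f θ (a.trans a').toCurve =
      derT x₀ f θ a'.toCurve * MonoidAlgebra.of ℝ _ (tr x₀ a.cont 0 1) +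
      MonoidAlgebra.of ℝ _ (tr x₀ a'.cont 0 1) * derT x₀ f θ a.toCurve := by
  rw [derT, pairing_trans_left H H', add_comm, ← LinearMap.mulRight_apply ℝ,
    ← LinearMap.mulLeft_apply (R := ℝ), derT, derT, pairing_map (finite_crossingSet H' 0 1 0 1),
    pairing_map (finite_crossingSet H 0 1 0 1)]
  congr 1
  · refine pairing_congr fun s hs t ht _ => ?_
    rw [LinearMap.mulRight_apply, FlatArc.tr_trans_half_one x₀ a a' hs.1,
      FlatArc.tr_trans_half_right x₀ a a' hs.1, map_mul]
    simp only [mul_assoc]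
  · refine pairing_congr fun s hs t ht _ => ?_
    rw [LinearMap.mulLeft_apply, FlatArc.tr_trans_half_left x₀ a a' hs.2,
      FlatArc.tr_trans_zero_half x₀ a a' hs.2, map_mul]
    simp only [mul_assoc]

lemma derT_trans_right {f : Curve M} (θ : MonoidAlgebra ℝ (FundamentalGroup M x₀))
    {b : FlatArc x y} {b' : FlatArc y z}
    (H : IsTransverse f b.toCurve) (H' : IsTransverse f b'.toCurve) :
    derT x₀ (b.trans b').toCurve θ f =
      derT x₀ b.toCurve (θ * MonoidAlgebra.of ℝ _ (tr x₀ b'.cont 0 1)) f +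
      derT x₀ b'.toCurve (MonoidAlgebra.of ℝ _ (tr x₀ b.cont 0 1) * θ) f := by
  rw [derT, pairing_trans H H']
  congr 1
  · refine pairing_congr fun s hs t ht _ => ?_
    rw [FlatArc.tr_trans_half_left x₀ b b' ht.2, FlatArc.tr_trans_zero_half x₀ b b' ht.2, map_mul]
    simp only [mul_assoc]
  · refine pairing_congr fun s hs t ht _ => ?_
    rw [FlatArc.tr_trans_half_one x₀ b b' ht.1, FlatArc.tr_trans_half_right x₀ b b' ht.1, map_mul]
    simp only [mul_assoc]

lemma derT_add {f h : Curve M} (H : IsTransverse f h)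
    (θ θ' : MonoidAlgebra ℝ (FundamentalGroup M x₀)) :
    derT x₀ h (θ + θ') f = derT x₀ h θ f + derT x₀ h θ' f := by
  rw [derT, derT, derT, ← pairing_add (finite_crossingSet H 0 1 0 1)]
  exact pairing_congr fun s _ t _ _ => by rw [mul_add, add_mul, add_mul]

lemma derT_const {f : Curve M} {p : M} (h : ∀ t, f t ≠ p)
    (θ : MonoidAlgebra ℝ (FundamentalGroup M x₀)) :
    derT x₀ f θ (FlatArc.const p).toCurve = 0 := by
  refine finsum_mem_eq_zero_of_forall_eq_zero ?_
  rintro z ⟨-, -, h2⟩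
  exact absurd h2.symm (h _)

/-- The base point of an arc that is transverse to a curve is not on the curve. -/
lemma IsTransverse.left_ne {a : FlatArc x y} {f : Curve M} (H : IsTransverse a.toCurve f) (t : ℝ) :
    f t ≠ x := by
  intro e
  have := a.mem_Ioo_of_vdet_ne_zero (H 0 t (by rw [a.zero, e]))
  exact lt_irrefl _ this.1

lemma IsTransverse.right_ne {a : FlatArc x y} {f : Curve M} (H : IsTransverse a.toCurve f) (t : ℝ) :
    f t ≠ y := by
  intro e
  have := a.mem_Ioo_of_vdet_ne_zero (H 1 t (by rw [a.one, e]))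
  exact lt_irrefl _ this.2

lemma classProj_derT {a : FlatArc x x} {b : FlatArc y y} (H : IsTransverse a.toCurve b.toCurve) :
    classProj _ (derT x₀ b.toCurve 1 a.toCurve) = loopSum x₀ a.toCurve b.toCurve := by
  rw [derT, pairing_map (finite_crossingSet H 0 1 0 1), loopSum]
  refine pairing_congr fun s _ t _ _ => ?_
  rw [mul_one, classProj_mul_comm, ← map_mul, ← map_mul, ← map_mul, MonoidAlgebra.of_apply,
    classProj_single, ins, ins]
  simp only [mul_assoc]

lemma derT_eq_of_tr_eq [CompactSpace M] (hM : IsOrientedAtlas M) {b : FlatArc z z}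
    {a a' : FlatArc x y} (ha : IsTransverse a.toCurve b.toCurve)
    (ha' : IsTransverse a'.toCurve b.toCurve) (h : tr x₀ a.cont 0 1 = tr x₀ a'.cont 0 1) :
    derT x₀ b.toCurve 1 a.toCurve = derT x₀ b.toCurve 1 a'.toCurve := by
  rw [← der_eq_derT x₀ ha, ← der_eq_derT x₀ ha']
  exact der_eq_of_tr_eq x₀ hM (fun t => (ha.left_ne t).symm) (fun t => (ha.right_ne t).symm) ha ha' h

lemma loopSum_eq_of_left [CompactSpace M] (hM : IsOrientedAtlas M) {b : FlatArc z z}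
    {a : FlatArc x x} {a' : FlatArc y y} (ha : IsTransverse a.toCurve b.toCurve)
    (ha' : IsTransverse a'.toCurve b.toCurve)
    (h : ConjClasses.mk (tr x₀ a.cont 0 1) = ConjClasses.mk (tr x₀ a'.cont 0 1)) :
    loopSum x₀ a.toCurve b.toCurve = loopSum x₀ a'.toCurve b.toCurve := by
  rw [ConjClasses.mk_eq_mk_iff_isConj, isConj_iff] at h
  obtain ⟨c, hc⟩ := h
  have hx : IsOff {b.toCurve} x := fun _ hb t => mem_singleton_iff.1 hb ▸ ha.left_ne t
  have hy : IsOff {b.toCurve} y := fun _ hb t => mem_singleton_iff.1 hb ▸ ha'.left_ne t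
  obtain ⟨e, he, hec⟩ := exists_arc x₀ hM (countable_singleton b.toCurve) hx hy c
  obtain ⟨e', he', hec'⟩ := exists_arc x₀ hM (countable_singleton b.toCurve) hy hx c⁻¹
  have he := he _ rfl
  have he' := he' _ rfl
  have h1 : derT x₀ b.toCurve 1 a'.toCurve =
      derT x₀ b.toCurve 1 (e'.trans (a.trans e)).toCurve := by
    refine derT_eq_of_tr_eq x₀ hM ha' (FlatArc.isTransverse_trans he'
      (FlatArc.isTransverse_trans ha he)) ?_
    rw [FlatArc.tr_trans, FlatArc.tr_trans, hec, hec', ← hc]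
  have h2 : derT x₀ b.toCurve 1 (e'.trans e).toCurve = 0 := by
    rw [derT_eq_of_tr_eq x₀ hM (a' := FlatArc.const y) (FlatArc.isTransverse_trans he' he)
      (FlatArc.isTransverse_const fun t => ha'.left_ne t), derT_const x₀ fun t => ha'.left_ne t]
    rw [FlatArc.tr_trans, hec, hec', FlatArc.tr_const, mul_inv_cancel]
  rw [derT_trans_left x₀ 1 he' he, hec, hec'] at h2
  rw [derT_trans_left x₀ 1 he' (FlatArc.isTransverse_trans ha he), derT_trans_left x₀ 1 ha he,
    FlatArc.tr_trans, hec, hec'] at h1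
  rw [← classProj_derT x₀ ha, ← classProj_derT x₀ ha', h1]
  generalize derT x₀ b.toCurve 1 e'.toCurve = E', derT x₀ b.toCurve 1 e.toCurve = E,
    derT x₀ b.toCurve 1 a.toCurve = A at h2 ⊢
  have h3 : MonoidAlgebra.of ℝ _ c⁻¹ * MonoidAlgebra.of ℝ _ c = 1 := by
    rw [← map_mul, inv_mul_cancel, map_one]
  rw [map_mul]
  generalize MonoidAlgebra.of ℝ _ c⁻¹ = C', MonoidAlgebra.of ℝ _ c = C at h2 h3 ⊢
  have h4 : E' = -(C' * (E * C')) := by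
    rw [eq_neg_of_add_eq_zero_left h2, mul_neg, neg_neg, ← mul_assoc, h3, one_mul]
  rw [h4, mul_neg, add_mul, map_add, map_add, map_neg, classProj_mul_comm (C * A), ← mul_assoc C' C,
    h3, one_mul, classProj_mul_comm (C * _), mul_assoc C',
    classProj_mul_comm C', mul_assoc E C' (C * _), ← mul_assoc C' C, h3, one_mul]
  abel

end
end

noncomputable section

/-! ### The Goldman bracket -/

open Set Filter Topology

section

variable {M : Type*} [TopologicalSpace M] [ChartedSpace Plane M] [PathConnectedSpace M] (x₀ : M)

/-- The free homotopy class of a closed arc. -/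
def FlatArc.cls {x : M} (a : FlatArc x x) : ConjClasses (FundamentalGroup M x₀) :=
  ConjClasses.mk (tr x₀ a.cont 0 1)

/-- The bracket of two free homotopy classes. -/
def bracketCls (c d : ConjClasses (FundamentalGroup M x₀)) :
    ClassSpace (FundamentalGroup M x₀) := by
  classical
  exact if h : ∃ v, ∃ (x y : M) (a : FlatArc x x) (b : FlatArc y y),
    IsTransverse a.toCurve b.toCurve ∧ a.cls x₀ = c ∧ b.cls x₀ = d ∧
      loopSum x₀ a.toCurve b.toCurve = v then h.choose else 0

/-- The Goldman bracket. -/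
def goldmanBracket : ClassSpace (FundamentalGroup M x₀) →ₗ[ℝ]
    ClassSpace (FundamentalGroup M x₀) →ₗ[ℝ] ClassSpace (FundamentalGroup M x₀) :=
  Finsupp.linearCombination ℝ fun c => Finsupp.linearCombination ℝ fun d => bracketCls x₀ c d

lemma goldmanBracket_single (c d : ConjClasses (FundamentalGroup M x₀)) :
    goldmanBracket x₀ (Finsupp.single c 1) (Finsupp.single d 1) = bracketCls x₀ c d := by
  simp [goldmanBracket]

variable [IsManifold (𝓡 2) ∞ M]

lemma exists_closed_arc (hM : IsOrientedAtlas M) {𝓑 : Set (Curve M)} (h𝓑 : 𝓑.Countable)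
    (c : ConjClasses (FundamentalGroup M x₀)) :
    ∃ (x : M) (a : FlatArc x x), IsTransverseTo a.toCurve 𝓑 ∧ a.cls x₀ = c := by
  obtain ⟨g, rfl⟩ := ConjClasses.exists_rep c
  have : Nonempty M := ⟨x₀⟩
  obtain ⟨p, hp⟩ := (dense_isOff (M := M) h𝓑).nonempty
  obtain ⟨a, ha, hg⟩ := exists_arc x₀ hM h𝓑 hp hp g
  exact ⟨p, a, ha, by rw [FlatArc.cls, hg]⟩

variable [T2Space M] [CompactSpace M]

lemma loopSum_eq_of_cls (hM : IsOrientedAtlas M) {x y x' y' : M} {a : FlatArc x x}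
    {b : FlatArc y y} {a' : FlatArc x' x'} {b' : FlatArc y' y'}
    (H : IsTransverse a.toCurve b.toCurve) (H' : IsTransverse a'.toCurve b'.toCurve)
    (ha : a.cls x₀ = a'.cls x₀) (hb : b.cls x₀ = b'.cls x₀) :
    loopSum x₀ a.toCurve b.toCurve = loopSum x₀ a'.toCurve b'.toCurve := by
  obtain ⟨z, c, hc, hca⟩ := exists_closed_arc x₀ hM
    ((countable_singleton b'.toCurve).insert b.toCurve) (a.cls x₀)
  have h1 := hc b.toCurve (Or.inl rfl)
  have h2 := hc b'.toCurve (Or.inr rfl)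
  rw [loopSum_eq_of_left x₀ hM H h1 hca.symm, loopSum_swap,
    loopSum_eq_of_left x₀ hM h1.symm h2.symm hb, ← loopSum_swap,
    loopSum_eq_of_left x₀ hM h2 H' (hca.trans ha)]

lemma bracketCls_eq (hM : IsOrientedAtlas M) {x y : M} {a : FlatArc x x} {b : FlatArc y y}
    (H : IsTransverse a.toCurve b.toCurve) :
    bracketCls x₀ (a.cls x₀) (b.cls x₀) = loopSum x₀ a.toCurve b.toCurve := by
  have h : ∃ v, ∃ (x y : M) (a' : FlatArc x x) (b' : FlatArc y y),
    IsTransverse a'.toCurve b'.toCurve ∧ a'.cls x₀ = a.cls x₀ ∧ b'.cls x₀ = b.cls x₀ ∧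
      loopSum x₀ a'.toCurve b'.toCurve = v := ⟨_, x, y, a, b, H, rfl, rfl, rfl⟩
  rw [bracketCls, dif_pos h]
  obtain ⟨x', y', a', b', H', h1, h2, h3⟩ := h.choose_spec
  rw [← h3]
  exact loopSum_eq_of_cls x₀ hM H' H h1 h2

lemma goldmanBracket_arc (hM : IsOrientedAtlas M) {x y : M} {a : FlatArc x x} {b : FlatArc y y}
    (H : IsTransverse a.toCurve b.toCurve) :
    goldmanBracket x₀ (Finsupp.single (a.cls x₀) 1) (Finsupp.single (b.cls x₀) 1) =
      loopSum x₀ a.toCurve b.toCurve := by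
  rw [goldmanBracket_single, bracketCls_eq x₀ hM H]

lemma goldmanBracket_derT (hM : IsOrientedAtlas M) {x y : M} {a : FlatArc x x} {b : FlatArc y y}
    (H : IsTransverse a.toCurve b.toCurve) :
    goldmanBracket x₀ (Finsupp.single (a.cls x₀) 1) (Finsupp.single (b.cls x₀) 1) =
      classProj _ (derT x₀ b.toCurve 1 a.toCurve) := by
  rw [goldmanBracket_arc x₀ hM H, classProj_derT x₀ H]

set_option maxSynthPendingDepth 4 in
lemma goldmanBracket_swap (hM : IsOrientedAtlas M) (u v : ClassSpace (FundamentalGroup M x₀)) :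
    goldmanBracket x₀ u v = -goldmanBracket x₀ v u := by
  have : goldmanBracket x₀ = -(goldmanBracket x₀).flip := by
    ext c d : 4
    obtain ⟨x, a, -, rfl⟩ := exists_closed_arc x₀ hM countable_empty c
    obtain ⟨y, b, hb, rfl⟩ := exists_closed_arc x₀ hM (countable_singleton a.toCurve) d
    have H := hb _ rfl
    simp only [LinearMap.comp_apply, Finsupp.lsingle_apply, LinearMap.neg_apply,
      LinearMap.flip_apply]
    rw [goldmanBracket_arc x₀ hM H, goldmanBracket_arc x₀ hM H.symm, loopSum_swap]
  conv_lhs => rw [this]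
  rfl

end

/-! ### Closed curves and closed arcs -/

section

variable {M : Type*} [TopologicalSpace M] [ChartedSpace Plane M]

/-- A closed curve, as a closed flat arc which starts at the parameter `s`. -/
def SmoothLoop.arc (α : SmoothLoop M) (s : ℝ) : FlatArc (α s) (α s) where
  toCurve := (FlatArc.flatten α.curve s (s + 1)).toCurve
  flat := by
    obtain ⟨ε, hε, h0, h1⟩ := (FlatArc.flatten α.curve s (s + 1)).flat
    exact ⟨ε, hε, h0, fun t ht => (h1 t ht).trans (α.periodic s)⟩

lemma SmoothLoop.curve_periodic (α : SmoothLoop M) : Function.Periodic α.curve.cont 1 :=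
  α.periodic

variable [PathConnectedSpace M] (x₀ : M)

lemma elt_loopAt (α : SmoothLoop M) (s : ℝ) :
    elt x₀ (α.loopAt s) = tr x₀ α.curve.cont s (s + 1) := by
  let γ : Path s (s + 1) := ⟨⟨fun t => s + t, by fun_prop⟩, by simp, by simp⟩
  rw [← elt_map_eq_tr x₀ α.curve.cont γ]
  exact elt_congr x₀ fun t => rfl

lemma tr_arc (α : SmoothLoop M) (s u v : ℝ) : tr x₀ (α.arc s).cont u v =
    tr x₀ α.curve.cont (s + step u) (s + step v) := by
  have := tr_comp x₀ α.curve.cont ⟨fun u => s + step u * (s + 1 - s), by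
    have := contDiff_step.continuous
    fun_prop⟩ u v
  have e : ∀ u, s + step u * (s + 1 - s) = s + step u := fun u => by ring
  simp only [ContinuousMap.coe_mk, e] at this
  rw [← this, ← elt_map_eq_tr x₀ _ (Path.segment u v), ← elt_map_eq_tr x₀ _ (Path.segment u v)]
  refine elt_congr x₀ fun t => ?_
  change α (s + step _ * (s + 1 - s)) = α (s + step _)
  rw [e]

lemma cls_arc (α : SmoothLoop M) (s : ℝ) :
    (α.arc s).cls x₀ = freeClass x₀ (α.loopAt 0) := by
  rw [freeClass_eq, elt_loopAt, FlatArc.cls, tr_arc, step_eq_zero (by norm_num),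
    step_eq_one (by norm_num), add_zero, ConjClasses.mk_eq_mk_iff_isConj, isConj_iff]
  refine ⟨tr x₀ α.curve.cont s 0, ?_⟩
  rw [tr_inv, mul_assoc, tr_mul, ← tr_periodic x₀ α.curve_periodic s 0, tr_mul, zero_add]

end
end

noncomputable section

/-! ### Goldman's formula -/

open Set Filter Topology

section

variable {M : Type*} [TopologicalSpace M] [ChartedSpace Plane M]

lemma SmoothLoop.apply_sub_int (α : SmoothLoop M) (s : ℝ) (n : ℤ) : α (s - n) = α s := by
  have := (α.periodic.int_mul n).sub_eq s
  simpa using this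

lemma SmoothLoop.apply_fract (α : SmoothLoop M) (s : ℝ) : α (Int.fract s) = α s :=
  α.apply_sub_int s ⌊s⌋

lemma tr_add_int [PathConnectedSpace M] (x₀ : M) (α : SmoothLoop M) (s t : ℝ) (n : ℤ) :
    tr x₀ α.curve.cont (s - n) (t - n) = tr x₀ α.curve.cont s t := by
  have e : α.curve.cont.comp ⟨fun u => u - n, by fun_prop⟩ = α.curve.cont := by
    ext u; exact α.apply_sub_int u n
  have := tr_comp x₀ α.curve.cont ⟨fun u => u - n, by fun_prop⟩ s t
  rw [e] at this
  exact this.symm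

variable [IsManifold (𝓡 2) ∞ M]

lemma SmoothLoop.Transverse.isTransverse {α β : SmoothLoop M} (H : α.Transverse β) :
    IsTransverse α.curve β.curve := fun s t e => by
  rw [← velocityDet_eq α β e]
  exact H s t e

lemma csign_fract (α β : SmoothLoop M) {s t : ℝ} (h : α s = β t) :
    csign α.curve β.curve (Int.fract s) (Int.fract t) = csign α.curve β.curve s t := by
  have e : ∀ (γ : SmoothLoop M) (f : Curve M) (s t : ℝ),
      csign γ.curve f s t = csign γ.curve f (Int.fract s) t := by
    intro γ f s t
    refine csign_reparam (σ := fun u => u - ⌊s⌋) (k := 1) (Eventually.of_forall fun u => ?_)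
      ((hasDerivAt_id s).sub_const _) one_pos
    exact (γ.apply_sub_int u _).symm
  rw [← e, csign_swap, ← e, ← csign_swap]
  · exact h.symm
  · change β (Int.fract t) = α s
    rw [β.apply_fract, h]

/-- A closed flat arc as a smooth closed curve. -/
def FlatArc.loop {x : M} (a : FlatArc x x) : SmoothLoop M where
  toFun t := a (Int.fract t)
  smooth := by
    intro t
    by_cases ht : Int.fract t = 0
    · have : (fun t => a (Int.fract t)) =ᶠ[𝓝 t] fun _ => x := by
        have h1 : ∀ᶠ u : ℝ in 𝓝 t, u - ⌊t⌋ ∈ {v : ℝ | a v = x} := by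
          have hc : ContinuousAt (fun u : ℝ => u - ⌊t⌋) t := by fun_prop
          refine hc.eventually ?_
          have := a.eventually_left (t := t - ⌊t⌋) ht.le
          exact this
        have h2 : ∀ᶠ u : ℝ in 𝓝 t, u - ⌊t⌋ + 1 ∈ {v : ℝ | a v = x} := by
          have hc : ContinuousAt (fun u : ℝ => u - ⌊t⌋ + 1) t := by fun_prop
          refine hc.eventually ?_
          have h3 : t - ⌊t⌋ = 0 := ht
          have := a.eventually_right (t := t - ⌊t⌋ + 1) (by rw [h3, zero_add])
          exact this
        have ht' : (⌊t⌋ : ℝ) = t := by rw [← Int.self_sub_fract, ht, sub_zero]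
        filter_upwards [h1, h2, Ioo_mem_nhds (show t - 1 < t by linarith)
          (show t < t + 1 by linarith)] with u h1 h2 h3
        rcases le_or_gt t u with h | h
        · have : ⌊u⌋ = ⌊t⌋ := by
            rw [Int.floor_eq_iff, ht']; exact ⟨h, h3.2⟩
          rw [Int.fract, this]; exact h1
        · have : ⌊u⌋ = ⌊t⌋ - 1 := by
            rw [Int.floor_eq_iff]; push_cast; rw [ht']; exact ⟨h3.1.le, by linarith⟩
          rw [Int.fract, this]; push_cast
          rw [sub_sub_eq_add_sub, add_sub_right_comm]; exact h2
      exact contMDiffAt_const.congr_of_eventuallyEq this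
    · have : (fun t => a (Int.fract t)) =ᶠ[𝓝 t] fun u => a (u - ⌊t⌋) := by
        have h1 : (⌊t⌋ : ℝ) < t := lt_of_le_of_ne (Int.floor_le t) fun e => ht (by
          rw [Int.fract, e, sub_self])
        filter_upwards [Ioo_mem_nhds h1 (Int.lt_floor_add_one t)] with u hu
        have : ⌊u⌋ = ⌊t⌋ := by
          rw [Int.floor_eq_iff]; exact ⟨hu.1.le, hu.2⟩
        rw [Int.fract, this]
      refine ContMDiffAt.congr_of_eventuallyEq ?_ this
      exact (a.smooth.comp (f := fun u : ℝ => u - ⌊t⌋) (ContDiff.contMDiff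
        (by fun_prop))).contMDiffAt
  periodic t := by
    simp only [Int.fract_add_one]

lemma FlatArc.loop_eventually {x : M} (a : FlatArc x x) {t : ℝ} (ht : Int.fract t ∈ Ioo (0 : ℝ) 1) :
    ∀ᶠ u in 𝓝 t, a.loop.curve u = a.toCurve (u - ⌊t⌋) := by
  have h1 : (⌊t⌋ : ℝ) < t := by have := ht.1; rw [Int.fract] at this; linarith
  filter_upwards [Ioo_mem_nhds h1 (Int.lt_floor_add_one t)] with u hu
  have : ⌊u⌋ = ⌊t⌋ := by
    rw [Int.floor_eq_iff]; exact ⟨hu.1.le, hu.2⟩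
  change a (Int.fract u) = _
  rw [Int.fract, this]

lemma FlatArc.transverse_loop {x y : M} {a : FlatArc x x} {b : FlatArc y y}
    (H : IsTransverse a.toCurve b.toCurve) : a.loop.Transverse b.loop := by
  intro s t e
  rw [velocityDet_eq _ _ e]
  have e' : a (Int.fract s) = b (Int.fract t) := e
  have hd := H _ _ e'
  have hs := a.mem_Ioo_of_vdet_ne_zero hd
  have ht := b.mem_Ioo_of_vdet_ne_zero' e' hd
  rw [vdet_reparam (σ := fun u => u - ⌊s⌋) (k := 1) (a.loop_eventually hs)
    ((hasDerivAt_id s).sub_const _), one_mul]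
  have e2 : a.toCurve (s - ⌊s⌋) = b.loop.curve t := e'
  rw [vdet_swap e2.symm, vdet_reparam (σ := fun u => u - ⌊t⌋) (k := 1) (b.loop_eventually ht)
    ((hasDerivAt_id t).sub_const _), one_mul, ← vdet_swap]
  · exact hd
  · exact e'.symm

variable [PathConnectedSpace M] (x₀ : M)

lemma FlatArc.freeClass_loop {x : M} (a : FlatArc x x) :
    freeClass x₀ (a.loop.loopAt 0) = a.cls x₀ := by
  rw [freeClass_eq, FlatArc.cls, ← FlatArc.elt_path]
  congr 1
  refine elt_congr x₀ fun t => ?_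
  change a (Int.fract (0 + (t : ℝ))) = a t
  rw [zero_add]
  rcases eq_or_lt_of_le t.2.2 with h | h
  · rw [h, Int.fract_one, a.zero, a.one]
  · rw [Int.fract_eq_self.2 ⟨t.2.1, h⟩]

variable [T2Space M]

lemma goldmanSum_eq_pairing (α β : SmoothLoop M) : goldmanSum x₀ α β =
    pairing α.curve β.curve (Ico 0 1) (Ico 0 1) fun s t =>
      Finsupp.single (ConjClasses.mk (tr x₀ α.curve.cont s (s + 1) *
        tr x₀ β.curve.cont t (t + 1))) 1 := by
  rw [pairing, ← finsum_set_coe_eq_finsum_mem]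
  refine finsum_congr fun z : SmoothLoop.Crossing α β => ?_
  rw [Finsupp.smul_single, smul_eq_mul, mul_one, ← ConjClasses.mk_mul_comm, ← elt_loopAt x₀ α,
    ← elt_loopAt x₀ β, freeClass_eq, SmoothLoop.crossingLoop, elt_trans, elt_cast,
    SmoothLoop.crossingSign, velocityDet_eq α β z.2.2.2]
  rfl

lemma goldmanSum_eq_loopSum {α β : SmoothLoop M} {s₀ t₀ : ℝ}
    (hs : ∀ t, α s₀ ≠ β t) (ht : ∀ s, α s ≠ β t₀) :
    goldmanSum x₀ α β = loopSum x₀ (α.arc s₀).toCurve (β.arc t₀).toCurve := by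
  have hs1 : ∀ t, α (s₀ + 1) ≠ β t := fun t => by rw [α.periodic]; exact hs t
  have ht1 : ∀ s, α s ≠ β (t₀ + 1) := fun t => by rw [β.periodic]; exact ht t
  have i1 : s₀ < s₀ + 1 := by linarith
  have i2 : t₀ < t₀ + 1 := by linarith
  let W : ℝ → ℝ → ClassSpace (FundamentalGroup M x₀) := fun s t =>
    Finsupp.single (ConjClasses.mk (tr x₀ α.curve.cont s (s + 1) *
        tr x₀ β.curve.cont t (t + 1))) 1
  have h1 : goldmanSum x₀ α β =
      pairing α.curve β.curve (Icc s₀ (s₀ + 1)) (Icc t₀ (t₀ + 1)) W := by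
    rw [goldmanSum_eq_pairing]
    symm
    refine finsum_mem_eq_of_bijOn (fun z : ℝ × ℝ => (Int.fract z.1, Int.fract z.2)) ⟨?_, ?_, ?_⟩ ?_
    · rintro z ⟨-, -, h⟩
      refine ⟨⟨Int.fract_nonneg _, Int.fract_lt_one _⟩, ⟨Int.fract_nonneg _, Int.fract_lt_one _⟩, ?_⟩
      exact (α.apply_fract _).trans (h.trans (β.apply_fract _).symm)
    · have key : ∀ {c u v : ℝ}, u ∈ Icc c (c + 1) → v ∈ Icc c (c + 1) → u ≠ c + 1 → v ≠ c + 1 →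
          Int.fract u = Int.fract v → u = v := by
        intro c u v hu hv hu' hv' e
        obtain ⟨n, hn⟩ := Int.fract_eq_fract.1 e
        have k1 := lt_of_le_of_ne hu.2 hu'
        have k2 := lt_of_le_of_ne hv.2 hv'
        have l1 : (n : ℝ) < 1 := by linarith [hv.1]
        have l2 : (-1 : ℝ) < n := by linarith [hu.1]
        have : n = 0 := by
          have l1' : n < 1 := by exact_mod_cast l1
          have l2' : -1 < n := by exact_mod_cast l2
          omega
        rw [this, Int.cast_zero] at hn
        linarith
      rintro z ⟨hz1, hz2, hz⟩ w ⟨hw1, hw2, hw⟩ e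
      obtain ⟨e1, e2⟩ := Prod.mk.inj e
      refine Prod.ext (key hz1 hw1 ?_ ?_ e1) (key hz2 hw2 ?_ ?_ e2)
      · intro h; rw [h] at hz; exact hs1 _ hz
      · intro h; rw [h] at hw; exact hs1 _ hw
      · intro h; rw [h] at hz; exact ht1 _ hz
      · intro h; rw [h] at hw; exact ht1 _ hw
    · have key : ∀ {c u : ℝ}, u ∈ Ico (0 : ℝ) 1 → ∃ v ∈ Icc c (c + 1), Int.fract v = u := by
        intro c u hu
        refine ⟨u + ⌈c - u⌉, ⟨by linarith [Int.le_ceil (c - u)],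
          by linarith [Int.ceil_lt_add_one (c - u)]⟩, ?_⟩
        rw [Int.fract_add_intCast, Int.fract_eq_self.2 hu]
      rintro z ⟨hz1, hz2, hz⟩
      obtain ⟨u, hu, eu⟩ := key (c := s₀) hz1
      obtain ⟨v, hv, ev⟩ := key (c := t₀) hz2
      refine ⟨(u, v), ⟨hu, hv, ?_⟩, Prod.ext eu ev⟩
      change α u = β v
      rw [← α.apply_fract, ← β.apply_fract, eu, ev]
      exact hz
    · rintro z ⟨-, -, hz⟩
      have key : ∀ (γ : SmoothLoop M) (u : ℝ), tr x₀ γ.curve.cont u (u + 1) =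
          tr x₀ γ.curve.cont (Int.fract u) (Int.fract u + 1) := fun γ u => by
        rw [← tr_add_int x₀ γ u (u + 1) ⌊u⌋, add_sub_right_comm]
        rfl
      simp only [W]
      rw [csign_fract α β hz, key α, key β]
  have h2 := pairing_flatten (f := α.curve) (h := β.curve) (s := s₀) (s' := s₀ + 1) i2 ht ht1 W
  have h3 := pairing_flatten (f := (β.arc t₀).toCurve) (h := α.curve) (s := 0) (s' := 1) i1
    (fun u e => hs _ e.symm) (fun u e => hs1 _ e.symm)
    (fun t s => W s (t₀ + step t * (t₀ + 1 - t₀)))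
  rw [h1, ← h2, pairing_swap]
  refine (congrArg Neg.neg h3.symm).trans ?_
  rw [pairing_swap, neg_neg, loopSum]
  refine pairing_congr fun s _ t _ _ => ?_
  have key : ∀ (γ : SmoothLoop M) (c u : ℝ), tr x₀ γ.curve.cont (c + step u * (c + 1 - c))
      (c + step u * (c + 1 - c) + 1) = ins x₀ (γ.arc c).toCurve u := by
    intro γ c u
    have e : c + step u * (c + 1 - c) = c + step u := by ring
    have j0 : c + step 0 = c := by rw [step_eq_zero (by norm_num), add_zero]
    have j1 : c + step 1 = c + 1 := by rw [step_eq_one (by norm_num)]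
    have e1 : tr x₀ (γ.arc c).toCurve.cont 0 u = _ := tr_arc x₀ γ c 0 u
    have e2 : tr x₀ (γ.arc c).toCurve.cont u 1 = _ := tr_arc x₀ γ c u 1
    rw [ins, e1, e2, e, j0, j1, ← tr_periodic x₀ γ.curve_periodic c, tr_mul]
  simp only [W]
  rw [key α, key β]

end
end

noncomputable section

/-! ### Existence and uniqueness of the bracket -/

open Set Filter Topology

section

variable {M : Type*} [TopologicalSpace M] [ChartedSpace Plane M] [IsManifold (𝓡 2) ∞ M] [T2Space M]

lemma SmoothLoop.Transverse.exists_off {α β : SmoothLoop M} (H : α.Transverse β) :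
    ∃ s₀, ∀ t, α s₀ ≠ β t := by
  have hfin := finite_crossingSet H.isTransverse 0 1 0 1
  obtain ⟨s, hs, hs'⟩ := (Ioo_infinite (zero_lt_one (α := ℝ))).exists_notMem_finite
    (hfin.image Prod.fst)
  refine ⟨s, fun t e => hs' ⟨(s, Int.fract t), ⟨Ioo_subset_Icc_self hs, ⟨Int.fract_nonneg _,
    (Int.fract_lt_one _).le⟩, ?_⟩, rfl⟩⟩
  exact e.trans (β.apply_fract t).symm

lemma SmoothLoop.Transverse.symm {α β : SmoothLoop M} (H : α.Transverse β) : β.Transverse α := by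
  intro s t e
  rw [velocityDet_eq _ _ e]
  exact H.isTransverse.symm s t e

lemma isTransverse_arc {α β : SmoothLoop M} (H : α.Transverse β) {s₀ t₀ : ℝ}
    (hs : ∀ t, α s₀ ≠ β t) (ht : ∀ s, α s ≠ β t₀) :
    IsTransverse (α.arc s₀).toCurve (β.arc t₀).toCurve := by
  have i1 : s₀ < s₀ + 1 := by linarith
  have i2 : t₀ < t₀ + 1 := by linarith
  have h1 : IsTransverse α.curve (β.arc t₀).toCurve :=
    isTransverse_flatten H.isTransverse i2 ht fun s => by
      change α s ≠ β (t₀ + 1)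
      rw [β.periodic]; exact ht s
  refine (isTransverse_flatten h1.symm i1 (fun t e => hs _ e.symm) fun t e => ?_).symm
  refine hs (t₀ + step t * (t₀ + 1 - t₀)) ?_
  rw [← α.periodic]
  exact e.symm

variable [PathConnectedSpace M] [CompactSpace M] (x₀ : M)

theorem isGoldmanBracket_iff (hM : IsOrientedAtlas M)
    (br : ClassSpace (FundamentalGroup M x₀) →ₗ[ℝ] ClassSpace (FundamentalGroup M x₀) →ₗ[ℝ]
      ClassSpace (FundamentalGroup M x₀)) :
    IsGoldmanBracket x₀ br ↔ br = goldmanBracket x₀ := by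
  have key : IsGoldmanBracket x₀ (goldmanBracket x₀) := by
    intro α β H
    obtain ⟨s₀, hs⟩ := H.exists_off
    obtain ⟨t₀, ht⟩ := H.symm.exists_off
    have ht' : ∀ s, α s ≠ β t₀ := fun s e => ht s e.symm
    rw [goldmanSum_eq_loopSum x₀ hs ht', ← goldmanBracket_arc x₀ hM (isTransverse_arc H hs ht'),
      cls_arc, cls_arc]
  refine ⟨fun h => ?_, fun h => h ▸ key⟩
  ext c d : 4
  obtain ⟨x, a, -, rfl⟩ := exists_closed_arc x₀ hM countable_empty c
  obtain ⟨y, b, hb, rfl⟩ := exists_closed_arc x₀ hM (countable_singleton a.toCurve) d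
  have H := FlatArc.transverse_loop (hb _ rfl).symm
  have h1 := h _ _ H
  rw [← key _ _ H, FlatArc.freeClass_loop, FlatArc.freeClass_loop] at h1
  exact h1

end
end

noncomputable section

/-! ### The bracket and the filtration -/

open Set Filter Topology

section Algebra

variable {π : Type*} [Group π]

instance : (augmentationIdeal π).IsTwoSided := inferInstanceAs (RingHom.ker _).IsTwoSided

lemma of_sub_one_mem (g : π) : MonoidAlgebra.of ℝ π g - 1 ∈ augmentationIdeal π := by
  have : MonoidAlgebra.lift ℝ ℝ π (1 : π →* ℝ) (MonoidAlgebra.of ℝ π g - 1) = 0 := by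
    rw [map_sub, map_one (MonoidAlgebra.lift ℝ ℝ π (1 : π →* ℝ)), MonoidAlgebra.lift_of,
      MonoidHom.one_apply, sub_self]
  exact this

lemma mul_mem_augmentation_pow {x y : MonoidAlgebra ℝ π} {i j : ℕ}
    (hx : x ∈ augmentationIdeal π ^ i) (hy : y ∈ augmentationIdeal π ^ j) :
    x * y ∈ augmentationIdeal π ^ (i + j) := by
  rw [Ideal.IsTwoSided.pow_add]
  exact Ideal.mul_mem_mul hx hy

lemma mem_augmentation_pow_zero (x : MonoidAlgebra ℝ π) : x ∈ augmentationIdeal π ^ 0 := by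
  rw [Submodule.pow_zero]
  exact (Ideal.one_eq_top (R := MonoidAlgebra ℝ π)).symm ▸ trivial

lemma mul_mem_augmentation_pow_left {x : MonoidAlgebra ℝ π} {i : ℕ}
    (hx : x ∈ augmentationIdeal π ^ i) (y : MonoidAlgebra ℝ π) :
    x * y ∈ augmentationIdeal π ^ i := Ideal.mul_mem_right _ _ hx

lemma augmentation_pow_succ_induction {p : MonoidAlgebra ℝ π → Prop} {n : ℕ}
    (hmul : ∀ x ∈ augmentationIdeal π ^ n, ∀ y ∈ augmentationIdeal π, p (x * y))
    (hadd : ∀ x y, p x → p y → p (x + y)) {x : MonoidAlgebra ℝ π}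
    (hx : x ∈ augmentationIdeal π ^ (n + 1)) : p x := by
  rw [Submodule.pow_succ] at hx
  exact Submodule.smul_induction_on hx hmul hadd

lemma span_of_eq_top :
    Submodule.span ℝ (range (MonoidAlgebra.of ℝ π)) = ⊤ := by
  refine eq_top_iff.2 fun x _ => ?_
  induction x using MonoidAlgebra.induction_linear with
  | zero => exact Submodule.zero_mem _
  | add a b ha hb => exact Submodule.add_mem _ (ha trivial) (hb trivial)
  | single g r =>
    have : MonoidAlgebra.single g r = r • MonoidAlgebra.of ℝ π g := by simp
    rw [this]
    exact Submodule.smul_mem _ _ (Submodule.subset_span ⟨g, rfl⟩)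

lemma augmentationIdeal_le_span : (augmentationIdeal π).restrictScalars ℝ ≤
    Submodule.span ℝ (range fun g => MonoidAlgebra.of ℝ π g - 1) := by
  intro x hx
  have key : ∀ x : MonoidAlgebra ℝ π, x - MonoidAlgebra.lift ℝ ℝ π (1 : π →* ℝ) x • 1 ∈
      Submodule.span ℝ (range fun g => MonoidAlgebra.of ℝ π g - 1) := by
    intro x
    induction x using MonoidAlgebra.induction_linear with
    | zero => simp
    | add a b ha hb =>
      rw [map_add, add_smul, add_sub_add_comm]
      exact Submodule.add_mem _ ha hb
    | single g r =>
      have : MonoidAlgebra.single g r - MonoidAlgebra.lift ℝ ℝ π (1 : π →* ℝ)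
          (MonoidAlgebra.single g r) • (1 : MonoidAlgebra ℝ π) =
          r • (MonoidAlgebra.of ℝ π g - 1) := by
        rw [smul_sub]
        simp
      rw [this]
      exact Submodule.smul_mem _ _ (Submodule.subset_span ⟨g, rfl⟩)
  have h := key x
  have hx' : MonoidAlgebra.lift ℝ ℝ π (1 : π →* ℝ) x = 0 := hx
  rwa [hx', zero_smul, sub_zero] at h

/-- The product of the elements `g - 1` of the group ring, for `g` in a list. -/
def differenceProd : List π → MonoidAlgebra ℝ π
  | [] => 1
  | g :: l => differenceProd l * (MonoidAlgebra.of ℝ π g - 1)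

lemma differenceProd_mem (l : List π) : differenceProd l ∈ augmentationIdeal π ^ l.length := by
  induction l with
  | nil => exact mem_augmentation_pow_zero _
  | cons g l ih =>
    exact mul_mem_augmentation_pow (j := 1) ih (by
      rw [Submodule.pow_one]; exact of_sub_one_mem g)

lemma augmentation_pow_le_span (n : ℕ) : (augmentationIdeal π ^ n).restrictScalars ℝ ≤
    Submodule.span ℝ {x | ∃ (l : List π) (g : π), l.length = n ∧
      x = differenceProd l * MonoidAlgebra.of ℝ π g} := by
  induction n with
  | zero =>
    have : Submodule.span ℝ (range (MonoidAlgebra.of ℝ π)) ≤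
        Submodule.span ℝ {x | ∃ (l : List π) (g : π), l.length = 0 ∧
          x = differenceProd l * MonoidAlgebra.of ℝ π g} := by
      refine Submodule.span_mono ?_
      rintro _ ⟨g, rfl⟩
      exact ⟨[], g, rfl, by rw [differenceProd, one_mul]⟩
    exact fun x _ => this (span_of_eq_top (π := π) ▸ trivial)
  | succ n ih =>
    intro x hx
    refine augmentation_pow_succ_induction (fun x hx y hy => ?_)
      (fun x y => Submodule.add_mem _) hx
    replace hx := ih hx
    replace hy := augmentationIdeal_le_span hy
    induction hx using Submodule.span_induction with
    | zero => rw [zero_mul]; exact Submodule.zero_mem _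
    | add a b _ _ ha hb => rw [add_mul]; exact Submodule.add_mem _ ha hb
    | smul r a _ ha => rw [smul_mul_assoc]; exact Submodule.smul_mem _ _ ha
    | mem a ha =>
      obtain ⟨l, g, hl, rfl⟩ := ha
      induction hy using Submodule.span_induction with
      | zero => rw [mul_zero]; exact Submodule.zero_mem _
      | add a b _ _ ha hb => rw [mul_add]; exact Submodule.add_mem _ ha hb
      | smul r a _ ha => rw [mul_smul_comm]; exact Submodule.smul_mem _ _ ha
      | mem a ha =>
        obtain ⟨k, rfl⟩ := ha
        refine Submodule.subset_span ⟨(g * k * g⁻¹) :: l, g, by simp [hl], ?_⟩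
        rw [differenceProd, mul_assoc, mul_assoc]
        congr 1
        rw [mul_sub, sub_mul, ← map_mul, ← map_mul, inv_mul_cancel_right, mul_one, one_mul]

/-- A derivation of the group ring with values in the power `J ^ k` maps `J ^ (p + 1)` to
`J ^ (p + k)`. -/
lemma derivation_mem {D : MonoidAlgebra ℝ π →ₗ[ℝ] MonoidAlgebra ℝ π} {k : ℕ}
    (hD : ∀ g h, D (MonoidAlgebra.of ℝ π (g * h)) =
      D (MonoidAlgebra.of ℝ π g) * MonoidAlgebra.of ℝ π h +
      MonoidAlgebra.of ℝ π g * D (MonoidAlgebra.of ℝ π h))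
    (hk : ∀ g, D (MonoidAlgebra.of ℝ π g) ∈ augmentationIdeal π ^ k) (p : ℕ)
    {x : MonoidAlgebra ℝ π} (hx : x ∈ augmentationIdeal π ^ (p + 1)) :
    D x ∈ augmentationIdeal π ^ (p + k) := by
  have hmul : ∀ x y, D (x * y) = D x * y + x * D y := by
    intro x y
    have hx : x ∈ Submodule.span ℝ (range (MonoidAlgebra.of ℝ π)) :=
      span_of_eq_top (π := π) ▸ trivial
    have hy : y ∈ Submodule.span ℝ (range (MonoidAlgebra.of ℝ π)) :=
      span_of_eq_top (π := π) ▸ trivial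
    induction hx using Submodule.span_induction with
    | zero => simp
    | add a b _ _ ha hb => rw [add_mul, map_add, ha, hb, map_add, add_mul, add_mul]; abel
    | smul r a _ ha =>
      rw [smul_mul_assoc, map_smul, ha, map_smul, smul_mul_assoc, smul_mul_assoc, smul_add]
    | mem a ha =>
      obtain ⟨g, rfl⟩ := ha
      induction hy using Submodule.span_induction with
      | zero => simp
      | add a b _ _ ha hb => rw [mul_add, map_add, ha, hb, map_add, mul_add, mul_add]; abel
      | smul r a _ ha =>
        rw [mul_smul_comm, map_smul, ha, map_smul, mul_smul_comm, mul_smul_comm, smul_add]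
      | mem a ha =>
        obtain ⟨h, rfl⟩ := ha
        rw [← map_mul, hD]
  have hall : ∀ x, D x ∈ augmentationIdeal π ^ k := by
    intro x
    have hx : x ∈ Submodule.span ℝ (range (MonoidAlgebra.of ℝ π)) :=
      span_of_eq_top (π := π) ▸ trivial
    have : Submodule.span ℝ (range (MonoidAlgebra.of ℝ π)) ≤
        ((augmentationIdeal π ^ k).restrictScalars ℝ).comap D := by
      refine Submodule.span_le.2 ?_
      rintro _ ⟨g, rfl⟩
      exact hk g
    exact this hx
  induction p generalizing x with
  | zero => rw [zero_add]; exact hall x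
  | succ p ih =>
    refine augmentation_pow_succ_induction (p := fun x => D x ∈ augmentationIdeal π ^ (p + 1 + k))
      (fun x hx y hy => ?_) (fun x y h h' => ?_) hx
    · rw [hmul]
      refine Ideal.add_mem _ ?_ (mul_mem_augmentation_pow hx (hall y))
      have := mul_mem_augmentation_pow (j := 1) (ih hx) (by rw [Submodule.pow_one]; exact hy)
      rwa [add_right_comm] at this
    · rw [map_add]; exact Ideal.add_mem _ h h'

end Algebra

section

variable {M : Type*} [TopologicalSpace M] [ChartedSpace Plane M] [PathConnectedSpace M] (x₀ : M)
  {y : M} (A : FundamentalGroup M x₀ → FlatArc y y)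

/-- The alternating sum of the values of `derT` that is given by the expansion of a product of
differences `g - 1`. -/
def derExpansion (a : Curve M) : List (FundamentalGroup M x₀) → FlatArc y y →
    MonoidAlgebra ℝ (FundamentalGroup M x₀)
  | [], c => derT x₀ c.toCurve 1 a
  | h :: l, c => derExpansion a l (c.trans (A h)) - derExpansion a l c

/-- The value of `derExpansion` up to a term that involves the arc `c`. -/
def derRemainder (a : Curve M) : List (FundamentalGroup M x₀) →
    MonoidAlgebra ℝ (FundamentalGroup M x₀) → MonoidAlgebra ℝ (FundamentalGroup M x₀)
  | [], _ => 0
  | h :: l, g => derT x₀ (A h).toCurve (g * differenceProd l) a +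
      derRemainder a l ((MonoidAlgebra.of ℝ _ h - 1) * g)

lemma derT_mem (b a : Curve M) {θ : MonoidAlgebra ℝ (FundamentalGroup M x₀)} {k : ℕ}
    (h : θ ∈ augmentationIdeal (FundamentalGroup M x₀) ^ k) :
    derT x₀ b θ a ∈ augmentationIdeal (FundamentalGroup M x₀) ^ k :=
  pairing_mem (N := (augmentationIdeal (FundamentalGroup M x₀) ^ k).restrictScalars ℝ)
    fun _ _ _ _ => mul_mem_augmentation_pow_left (mul_mem_augmentation_pow_left
      (Ideal.mul_mem_left _ _ h) _) _

lemma derRemainder_mem (a : Curve M) (l : List (FundamentalGroup M x₀))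
    {g : MonoidAlgebra ℝ (FundamentalGroup M x₀)} {k : ℕ}
    (h : g ∈ augmentationIdeal (FundamentalGroup M x₀) ^ k) :
    derRemainder x₀ A a l g ∈ augmentationIdeal (FundamentalGroup M x₀) ^ (k + l.length - 1) := by
  induction l generalizing g k with
  | nil => exact Ideal.zero_mem _
  | cons f l ih =>
    rw [derRemainder]
    refine Ideal.add_mem _ ?_ ?_
    · refine derT_mem x₀ _ _ ?_
      have := mul_mem_augmentation_pow h (differenceProd_mem l)
      rwa [List.length_cons, ← add_assoc, Nat.add_sub_cancel]
    · have := ih (mul_mem_augmentation_pow (i := 1) (by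
        rw [Submodule.pow_one]; exact of_sub_one_mem f) h)
      rwa [List.length_cons, ← add_assoc, Nat.add_sub_cancel, ← Nat.add_sub_cancel (k + l.length) 1,
        add_right_comm, add_comm k 1]

variable [IsManifold (𝓡 2) ∞ M] [T2Space M]

lemma derT_sub {f h : Curve M} (H : IsTransverse f h)
    (θ θ' : MonoidAlgebra ℝ (FundamentalGroup M x₀)) :
    derT x₀ h (θ - θ') f = derT x₀ h θ f - derT x₀ h θ' f := by
  rw [eq_sub_iff_add_eq, ← derT_add x₀ H, sub_add_cancel]

/-- The arc `a` is transverse to the arcs that appear in `derExpansion`. -/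
def IsTransverseToExpansion (a : Curve M) (l : List (FundamentalGroup M x₀)) (c : FlatArc y y) :
    Prop := IsTransverse a c.toCurve ∧ ∀ g ∈ l, IsTransverse a (A g).toCurve

variable {A}

lemma IsTransverseToExpansion.trans {a : Curve M} {g : FundamentalGroup M x₀}
    {l : List (FundamentalGroup M x₀)} {c : FlatArc y y}
    (h : IsTransverseToExpansion x₀ A a (g :: l) c) :
    IsTransverseToExpansion x₀ A a l (c.trans (A g)) :=
  ⟨(FlatArc.isTransverse_trans h.1.symm (h.2 g List.mem_cons_self).symm).symm,
    fun k hk => h.2 k (List.mem_cons_of_mem _ hk)⟩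

lemma IsTransverseToExpansion.tail {a : Curve M} {g : FundamentalGroup M x₀}
    {l : List (FundamentalGroup M x₀)} {c : FlatArc y y}
    (h : IsTransverseToExpansion x₀ A a (g :: l) c) : IsTransverseToExpansion x₀ A a l c :=
  ⟨h.1, fun k hk => h.2 k (List.mem_cons_of_mem _ hk)⟩

lemma derRemainder_sub {a : Curve M} {l : List (FundamentalGroup M x₀)}
    (H : ∀ g ∈ l, IsTransverse a (A g).toCurve) (g g' : MonoidAlgebra ℝ (FundamentalGroup M x₀)) :
    derRemainder x₀ A a l (g - g') = derRemainder x₀ A a l g - derRemainder x₀ A a l g' := by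
  induction l generalizing g g' with
  | nil => simp [derRemainder]
  | cons h l ih =>
    simp only [derRemainder]
    rw [sub_mul g, derT_sub x₀ (H h List.mem_cons_self), mul_sub,
      ih (fun k hk => H k (List.mem_cons_of_mem _ hk))]
    abel

lemma derExpansion_eq (hA : ∀ g, tr x₀ (A g).cont 0 1 = g) {a : Curve M}
    {l : List (FundamentalGroup M x₀)} {c : FlatArc y y}
    (H : IsTransverseToExpansion x₀ A a l c) :
    derExpansion x₀ A a l c = derT x₀ c.toCurve (differenceProd l) a +
      derRemainder x₀ A a l (MonoidAlgebra.of ℝ _ (tr x₀ c.cont 0 1)) := by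
  induction l generalizing c with
  | nil => simp [derExpansion, derRemainder, differenceProd]
  | cons h l ih =>
    have hh := H.2 h List.mem_cons_self
    rw [derExpansion, ih H.trans, ih H.tail, derRemainder, differenceProd,
      derT_trans_right x₀ _ H.1 hh, hA, FlatArc.tr_trans, hA, mul_sub, mul_one,
      derT_sub x₀ H.1, sub_mul, derRemainder_sub x₀ H.tail.2, map_mul, one_mul]
    abel

lemma derExpansion_mem (hA : ∀ g, tr x₀ (A g).cont 0 1 = g) {a : Curve M}
    {l : List (FundamentalGroup M x₀)} {c : FlatArc y y}
    (H : IsTransverseToExpansion x₀ A a l c) :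
    derExpansion x₀ A a l c ∈ augmentationIdeal (FundamentalGroup M x₀) ^ (l.length - 1) := by
  rw [derExpansion_eq x₀ hA H]
  refine Ideal.add_mem _ ?_ ?_
  · exact Ideal.pow_le_pow_right (Nat.sub_le _ _) (derT_mem x₀ _ _ (differenceProd_mem l))
  · have := derRemainder_mem x₀ A a l (mem_augmentation_pow_zero
      (MonoidAlgebra.of ℝ _ (tr x₀ c.cont 0 1)))
    rwa [zero_add] at this

lemma derExpansion_trans {x z w : M} {a : FlatArc x z} {a' : FlatArc z w}
    {l : List (FundamentalGroup M x₀)} {c : FlatArc y y}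
    (H : IsTransverseToExpansion x₀ A a.toCurve l c)
    (H' : IsTransverseToExpansion x₀ A a'.toCurve l c) :
    derExpansion x₀ A (a.trans a').toCurve l c =
      derExpansion x₀ A a'.toCurve l c * MonoidAlgebra.of ℝ _ (tr x₀ a.cont 0 1) +
      MonoidAlgebra.of ℝ _ (tr x₀ a'.cont 0 1) * derExpansion x₀ A a.toCurve l c := by
  induction l generalizing c with
  | nil => exact derT_trans_left x₀ 1 H.1 H'.1
  | cons h l ih =>
    simp only [derExpansion]
    rw [ih H.trans H'.trans, ih H.tail H'.tail, sub_mul, mul_sub]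
    abel

variable [CompactSpace M]

lemma derExpansion_eq_of_tr_eq (hM : IsOrientedAtlas M) {x z : M} {a a' : FlatArc x z}
    {l : List (FundamentalGroup M x₀)} {c : FlatArc y y}
    (H : IsTransverseToExpansion x₀ A a.toCurve l c)
    (H' : IsTransverseToExpansion x₀ A a'.toCurve l c) (h : tr x₀ a.cont 0 1 = tr x₀ a'.cont 0 1) :
    derExpansion x₀ A a.toCurve l c = derExpansion x₀ A a'.toCurve l c := by
  induction l generalizing c with
  | nil => exact derT_eq_of_tr_eq x₀ hM H.1 H'.1 h
  | cons h l ih =>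
    simp only [derExpansion]
    rw [ih H.trans H'.trans, ih H.tail H'.tail]

lemma classProj_derExpansion (hM : IsOrientedAtlas M) (hA : ∀ g, tr x₀ (A g).cont 0 1 = g) {x : M}
    {a : FlatArc x x} {l : List (FundamentalGroup M x₀)} {c : FlatArc y y}
    (H : IsTransverseToExpansion x₀ A a.toCurve l c) :
    goldmanBracket x₀ (Finsupp.single (a.cls x₀) 1)
      (classProj _ (differenceProd l * MonoidAlgebra.of ℝ _ (tr x₀ c.cont 0 1))) =
      classProj _ (derExpansion x₀ A a.toCurve l c) := by
  induction l generalizing c with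
  | nil =>
    rw [differenceProd, one_mul, MonoidAlgebra.of_apply, classProj_single]
    exact goldmanBracket_derT x₀ hM H.1
  | cons h l ih =>
    rw [derExpansion, map_sub, ← ih H.trans, ← ih H.tail, ← map_sub, ← map_sub, FlatArc.tr_trans,
      hA, differenceProd, map_mul (MonoidAlgebra.of ℝ _)]
    congr 2
    rw [mul_assoc, sub_mul, mul_sub, one_mul]

theorem goldmanBracket_mem (hM : IsOrientedAtlas M) (p q : ℕ)
    {u v : ClassSpace (FundamentalGroup M x₀)}
    (hu : u ∈ classFiltration (FundamentalGroup M x₀) (p + 1))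
    (hv : v ∈ classFiltration (FundamentalGroup M x₀) q) :
    goldmanBracket x₀ u v ∈ classFiltration (FundamentalGroup M x₀) (p + (q - 1)) := by
  obtain ⟨v, hv, rfl⟩ := hv
  obtain ⟨u, hu, rfl⟩ := hu
  have hoff : ∀ x : M, IsOff ∅ x := fun x b hb => absurd hb (notMem_empty b)
  have hex : ∀ g, ∃ a : FlatArc x₀ x₀, tr x₀ a.cont 0 1 = g := fun g =>
    (exists_arc x₀ hM countable_empty (hoff x₀) (hoff x₀) g).imp fun a h => h.2
  choose A hA using hex
  suffices H : Submodule.span ℝ {x | ∃ (l : List (FundamentalGroup M x₀)) (g : FundamentalGroup M x₀),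
      l.length = q ∧ x = differenceProd l * MonoidAlgebra.of ℝ _ g} ≤
      (classFiltration (FundamentalGroup M x₀) (p + (q - 1))).comap
        (goldmanBracket x₀ (classProj _ u) ∘ₗ classProj _) from
    H (augmentation_pow_le_span q hv)
  refine Submodule.span_le.2 ?_
  rintro _ ⟨l, g, rfl, rfl⟩
  have h𝓑 : (insert (A g).toCurve ((fun h => (A h).toCurve) '' {h | h ∈ l})).Countable :=
    ((List.finite_toSet l).image _).insert _ |>.countable
  have : Nonempty M := ⟨x₀⟩
  obtain ⟨x, hx⟩ := (dense_isOff (M := M) h𝓑).nonempty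
  have hex : ∀ k, ∃ a : FlatArc x x, IsTransverseToExpansion x₀ A a.toCurve l (A g) ∧
      tr x₀ a.cont 0 1 = k := fun k =>
    (exists_arc x₀ hM h𝓑 hx hx k).imp fun a h =>
      ⟨⟨h.1 _ (Or.inl rfl), fun f hf => h.1 _ (Or.inr ⟨f, hf, rfl⟩)⟩, h.2⟩
  choose a ha hat using hex
  let D : MonoidAlgebra ℝ (FundamentalGroup M x₀) →ₗ[ℝ] MonoidAlgebra ℝ (FundamentalGroup M x₀) :=
    Finsupp.linearCombination ℝ (fun k => derExpansion x₀ A (a k).toCurve l (A g)) ∘ₗ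
      (MonoidAlgebra.coeffLinearEquiv ℝ).toLinearMap
  have hD : ∀ k, D (MonoidAlgebra.of ℝ _ k) = derExpansion x₀ A (a k).toCurve l (A g) := by
    intro k
    simp [D]
  have hbr : (goldmanBracket x₀).flip (classProj _ (differenceProd l * MonoidAlgebra.of ℝ _ g)) ∘ₗ
      classProj _ = classProj _ ∘ₗ D := by
    refine LinearMap.ext_on_range span_of_eq_top fun k => ?_
    rw [LinearMap.comp_apply, LinearMap.comp_apply, hD, LinearMap.flip_apply,
      ← classProj_derExpansion x₀ hM hA (ha k), hA, MonoidAlgebra.of_apply, classProj_single,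
      FlatArc.cls, hat]
  have hmem : D u ∈ augmentationIdeal (FundamentalGroup M x₀) ^ (p + (l.length - 1)) := by
    refine derivation_mem (fun k k' => ?_) (fun k => ?_) p hu
    · rw [hD, hD, hD, derExpansion_eq_of_tr_eq x₀ hM (a' := (a k').trans (a k)) (ha _),
        derExpansion_trans x₀ (ha k') (ha k), hat, hat]
      · refine ⟨FlatArc.isTransverse_trans (ha k').1 (ha k).1, fun f hf =>
          FlatArc.isTransverse_trans ((ha k').2 f hf) ((ha k).2 f hf)⟩
      · rw [FlatArc.tr_trans, hat, hat, hat]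
    · rw [hD]
      exact derExpansion_mem x₀ hA (ha k)
  refine ⟨D u, hmem, ?_⟩
  exact (LinearMap.congr_fun hbr u).symm

end
end

noncomputable section

/-! ### The Jacobi identity -/

open Set Filter Topology

section

variable {M : Type*} [TopologicalSpace M] [ChartedSpace Plane M]

lemma pairing_comm {V : Type*} [AddCommGroup V] [Module ℝ V] {f h f' h' : Curve M}
    {I J I' J' : Set ℝ} (hfin : (crossingSet f h I J).Finite)
    (hfin' : (crossingSet f' h' I' J').Finite) (W : ℝ → ℝ → ℝ → ℝ → V) :
    pairing f h I J (fun s t => pairing f' h' I' J' fun s' t' => W s t s' t') =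
      pairing f' h' I' J' (fun s' t' => pairing f h I J fun s t => W s t s' t') := by
  simp only [pairing, finsum_mem_eq_finite_toFinset_sum _ hfin,
    finsum_mem_eq_finite_toFinset_sum _ hfin', Finset.smul_sum]
  rw [Finset.sum_comm]
  exact Finset.sum_congr rfl fun _ _ => Finset.sum_congr rfl fun _ _ => smul_comm _ _ _

namespace FlatArc

variable {x y x' y' : M}

/-- A flat arc with other names for its ends. -/
def cast (a : FlatArc x y) (hx : x = x') (hy : y = y') : FlatArc x' y' where
  toCurve := a.toCurve
  flat := by subst hx hy; exact a.flat

/-- The closed arc `b`, run through once starting from the parameter `t`. -/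
def rotate (b : FlatArc y y) (t : ℝ) : FlatArc (b t) (b t) :=
  ((flatten b.toCurve t 1).cast rfl b.one).trans ((flatten b.toCurve 0 t).cast b.zero rfl)

end FlatArc

variable [PathConnectedSpace M] (x₀ : M)

lemma FlatArc.tr_flatten (f : Curve M) (t t' u v : ℝ) : tr x₀ (flatten f t t').cont u v =
    tr x₀ f.cont (t + step u * (t' - t)) (t + step v * (t' - t)) :=
  tr_comp x₀ f.cont ⟨fun u => t + step u * (t' - t), by
    have := contDiff_step.continuous
    fun_prop⟩ u v

/-- The transport along a closed arc, in the positive direction, between two parameters. -/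
def fwd {y : M} (b : FlatArc y y) (t t' : ℝ) : FundamentalGroup M x₀ :=
  if t ≤ t' then tr x₀ b.cont t t' else tr x₀ b.cont 0 t' * tr x₀ b.cont t 1

variable {y : M} (b : FlatArc y y)

lemma tr_rotate (t : ℝ) : tr x₀ (b.rotate t).cont 0 1 = ins x₀ b.toCurve t := by
  have h0 : step 0 = 0 := step_eq_zero (by norm_num)
  have h1 : step 1 = 1 := step_eq_one (by norm_num)
  have e1 := FlatArc.tr_flatten x₀ b.toCurve t 1 0 1
  have e2 := FlatArc.tr_flatten x₀ b.toCurve 0 t 0 1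
  rw [h0, h1, zero_mul, one_mul, add_zero, add_sub_cancel] at e1 e2
  rw [FlatArc.rotate, FlatArc.tr_trans, ins, ← e1, ← e2]
  rfl

variable [IsManifold (𝓡 2) ∞ M] [T2Space M] {b}

lemma isTransverse_rotate {f : Curve M} (H : IsTransverse f b.toCurve) {t : ℝ}
    (ht : t ∈ Ioo (0 : ℝ) 1) (hoff : ∀ s, f s ≠ b t) :
    IsTransverse f ((FlatArc.flatten b.toCurve t 1).cast rfl b.one).toCurve ∧
    IsTransverse f ((FlatArc.flatten b.toCurve 0 t).cast b.zero rfl).toCurve := by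
  have h0 : ∀ s, f s ≠ b 0 := fun s e => by
    rw [b.zero] at e
    exact H.symm.left_ne s e
  have h1 : ∀ s, f s ≠ b 1 := fun s e => by
    rw [b.one] at e
    exact H.symm.left_ne s e
  exact ⟨isTransverse_flatten H ht.2 hoff h1, isTransverse_flatten H ht.1 h0 hoff⟩

lemma pairing_rotate {V : Type*} [AddCommGroup V] [Module ℝ V] {f : Curve M}
    (H : IsTransverse f b.toCurve) {t : ℝ} (ht : t ∈ Ioo (0 : ℝ) 1) (hoff : ∀ s, f s ≠ b t)
    (W : ℝ → FundamentalGroup M x₀ → FundamentalGroup M x₀ → V) :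
    pairing f (b.rotate t).toCurve (Icc 0 1) (Icc 0 1)
      (fun s u => W s (tr x₀ (b.rotate t).cont 0 u) (tr x₀ (b.rotate t).cont u 1)) =
    pairing f b.toCurve (Icc 0 1) (Icc 0 1) fun s t' => W s (fwd x₀ b t t') (fwd x₀ b t' t) := by
  have h0 : step 0 = 0 := step_eq_zero (by norm_num)
  have h1 : step 1 = 1 := step_eq_one (by norm_num)
  obtain ⟨k1, k2⟩ := isTransverse_rotate H ht hoff
  have g0 : ∀ s, f s ≠ b 0 := fun s e => by
    rw [b.zero] at e
    exact H.symm.left_ne s e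
  have g1 : ∀ s, f s ≠ b 1 := fun s e => by
    rw [b.one] at e
    exact H.symm.left_ne s e
  rw [FlatArc.rotate, pairing_trans k1 k2, pairing_split H 0 1 ht.1.le ht.2.le hoff, add_comm]
  congr 1
  · rw [← pairing_flatten ht.1 g0 hoff]
    refine pairing_congr fun s _ u hu he => ?_
    have he' : f s = b (0 + step u * (t - 0)) := he
    have hlt : ¬ t ≤ 0 + step u * (t - 0) := by
      intro h
      have := mul_le_mul_of_nonneg_right (step_le_one u) ht.1.le
      refine hoff s (he'.trans ?_)
      congr 1
      linarith
    have hle : 0 + step u * (t - 0) ≤ t := (not_le.1 hlt).le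
    rw [FlatArc.tr_trans_half_right x₀ _ _ hu.1, FlatArc.tr_trans_half_one x₀ _ _ hu.1, fwd, fwd,
      if_neg hlt, if_pos hle]
    have e1 := FlatArc.tr_flatten x₀ b.toCurve t 1 0 1
    have e2 := FlatArc.tr_flatten x₀ b.toCurve 0 t 0 u
    have e3 := FlatArc.tr_flatten x₀ b.toCurve 0 t u 1
    rw [h0, zero_mul, add_zero] at e1 e2
    rw [h1, one_mul, add_sub_cancel] at e1 e3
    rw [← e1, ← e2, ← e3]
    rfl
  · rw [← pairing_flatten ht.2 hoff g1]
    refine pairing_congr fun s _ u hu he => ?_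
    have he' : f s = b (t + step u * (1 - t)) := he
    have hle : t ≤ t + step u * (1 - t) := by
      have := mul_nonneg (step_nonneg u) (show 0 ≤ 1 - t by linarith [ht.2])
      linarith
    have hlt : ¬ t + step u * (1 - t) ≤ t := fun h => hoff s (he'.trans (by
      congr 1
      linarith))
    rw [FlatArc.tr_trans_half_left x₀ _ _ hu.2, FlatArc.tr_trans_zero_half x₀ _ _ hu.2, fwd, fwd,
      if_neg hlt, if_pos hle]
    have e1 := FlatArc.tr_flatten x₀ b.toCurve 0 t 0 1
    have e2 := FlatArc.tr_flatten x₀ b.toCurve t 1 0 u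
    have e3 := FlatArc.tr_flatten x₀ b.toCurve t 1 u 1
    rw [h0, zero_mul, add_zero] at e1 e2
    rw [h1, one_mul, add_sub_cancel] at e1 e3
    rw [← e1, ← e2, ← e3]
    rfl

/-- The sum over the crossings of `a` and `b` of the classes of the curves obtained by inserting
`a` at the crossing and `h` at the parameter `t` into `b`. -/
def insertSum (a : Curve M) (b : FlatArc y y) (t : ℝ) (h : FundamentalGroup M x₀) :
    ClassSpace (FundamentalGroup M x₀) :=
  pairing a b.toCurve (Icc 0 1) (Icc 0 1) fun s t' =>
    Finsupp.single (ConjClasses.mk (ins x₀ a s * (fwd x₀ b t t' * h * fwd x₀ b t' t))) 1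

variable [CompactSpace M]

lemma goldmanBracket_product (hM : IsOrientedAtlas M) {x z : M} {a : FlatArc x x} {c : FlatArc z z}
    (hab : IsTransverse a.toCurve b.toCurve) (hac : IsTransverse a.toCurve c.toCurve) {t r : ℝ}
    (ht : t ∈ Ioo (0 : ℝ) 1) (hr : r ∈ Ioo (0 : ℝ) 1) (htr : c r = b t) (hoff : ∀ s, a s ≠ b t) :
    goldmanBracket x₀ (Finsupp.single (a.cls x₀) 1)
      (Finsupp.single (ConjClasses.mk (ins x₀ b.toCurve t * ins x₀ c.toCurve r)) 1) =
      insertSum x₀ a.toCurve b t (ins x₀ c.toCurve r) +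
        insertSum x₀ a.toCurve c r (ins x₀ b.toCurve t) := by
  have hoff' : ∀ s, a s ≠ c r := fun s => by rw [htr]; exact hoff s
  have kb := isTransverse_rotate hab ht hoff
  have kc := isTransverse_rotate hac hr hoff'
  have hb : IsTransverse a.toCurve (b.rotate t).toCurve :=
    (FlatArc.isTransverse_trans kb.1.symm kb.2.symm).symm
  have hc : IsTransverse a.toCurve ((c.rotate r).cast htr htr).toCurve :=
    (FlatArc.isTransverse_trans kc.1.symm kc.2.symm).symm
  have hcls : ((b.rotate t).trans ((c.rotate r).cast htr htr)).cls x₀ =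
      ConjClasses.mk (ins x₀ b.toCurve t * ins x₀ c.toCurve r) := by
    rw [FlatArc.cls, FlatArc.tr_trans, tr_rotate, ConjClasses.mk_mul_comm, ← tr_rotate x₀ c]
    rfl
  rw [← hcls, goldmanBracket_arc x₀ hM (FlatArc.isTransverse_trans hb.symm hc.symm).symm, loopSum,
    pairing_trans hb hc, insertSum, insertSum]
  congr 1
  · rw [← pairing_rotate x₀ hab ht hoff fun s u v => Finsupp.single (ConjClasses.mk
      (ins x₀ a.toCurve s * (u * ins x₀ c.toCurve r * v))) 1]
    refine pairing_congr fun s _ u hu _ => ?_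
    rw [ins.eq_def x₀ (FlatArc.trans _ _).toCurve, FlatArc.tr_trans_zero_half x₀ _ _ hu.2,
      FlatArc.tr_trans_half_left x₀ _ _ hu.2, ← tr_rotate x₀ c, mul_assoc (tr x₀ _ 0 u)]
    rfl
  · refine Eq.trans ?_ (pairing_rotate x₀ hac hr hoff' fun s u v => Finsupp.single (ConjClasses.mk
      (ins x₀ a.toCurve s * (u * ins x₀ b.toCurve t * v))) 1)
    refine pairing_congr fun s _ u hu _ => ?_
    rw [ins.eq_def x₀ (FlatArc.trans _ _).toCurve, FlatArc.tr_trans_half_right x₀ _ _ hu.1,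
      FlatArc.tr_trans_half_one x₀ _ _ hu.1, tr_rotate x₀ b]
    rfl

lemma goldmanBracket_bracket (hM : IsOrientedAtlas M) {x z : M} {a : FlatArc x x} {c : FlatArc z z}
    (hab : IsTransverse a.toCurve b.toCurve) (hac : IsTransverse a.toCurve c.toCurve)
    (hbc : IsTransverse b.toCurve c.toCurve) (hoff : ∀ s t r, b t = c r → a s ≠ b t) :
    goldmanBracket x₀ (Finsupp.single (a.cls x₀) 1) (goldmanBracket x₀
      (Finsupp.single (b.cls x₀) 1) (Finsupp.single (c.cls x₀) 1)) =
    pairing b.toCurve c.toCurve (Icc 0 1) (Icc 0 1)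
      (fun t r => insertSum x₀ a.toCurve b t (ins x₀ c.toCurve r)) -
    pairing c.toCurve a.toCurve (Icc 0 1) (Icc 0 1)
      (fun r s => insertSum x₀ b.toCurve c r (ins x₀ a.toCurve s)) := by
  have hfin := finite_crossingSet hbc 0 1 0 1
  have h1 : pairing c.toCurve a.toCurve (Icc 0 1) (Icc 0 1)
      (fun r s => insertSum x₀ b.toCurve c r (ins x₀ a.toCurve s)) =
      -pairing b.toCurve c.toCurve (Icc 0 1) (Icc 0 1)
        (fun t r => insertSum x₀ a.toCurve c r (ins x₀ b.toCurve t)) := by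
    rw [pairing_swap]
    congr 1
    simp only [insertSum]
    rw [pairing_comm (finite_crossingSet hac 0 1 0 1) hfin]
    refine pairing_congr fun t _ r _ _ => pairing_congr fun s _ r' _ _ => ?_
    rw [ConjClasses.mk_mul_comm]
    simp only [mul_assoc]
    rw [ConjClasses.mk_mul_comm]
    simp only [mul_assoc]
  rw [goldmanBracket_arc x₀ hM hbc, loopSum, pairing_map hfin, h1, sub_neg_eq_add,
    ← pairing_add hfin]
  refine pairing_congr fun t _ r _ he => ?_
  have hd := hbc t r he
  exact goldmanBracket_product x₀ hM hab hac (b.mem_Ioo_of_vdet_ne_zero hd)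
    (c.mem_Ioo_of_vdet_ne_zero' he hd) he.symm fun s => hoff s t r he

lemma jacobi_of_single {ι : Type*} (br : (ι →₀ ℝ) →ₗ[ℝ] (ι →₀ ℝ) →ₗ[ℝ] (ι →₀ ℝ))
    (H : ∀ i j k, br (.single i 1) (br (.single j 1) (.single k 1)) +
      br (.single j 1) (br (.single k 1) (.single i 1)) +
      br (.single k 1) (br (.single i 1) (.single j 1)) = 0) (u v w : ι →₀ ℝ) :
    br u (br v w) + br v (br w u) + br w (br u v) = 0 := by
  have hs : ∀ (i : ι) (r : ℝ), Finsupp.single i r = r • Finsupp.single i 1 := by simp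
  induction u using Finsupp.induction_linear with
  | zero => simp
  | add u u' hu hu' =>
    simp only [map_add, LinearMap.add_apply]
    linear_combination (norm := module) hu + hu'
  | single i r =>
    rw [hs]
    induction v using Finsupp.induction_linear with
    | zero => simp
    | add v v' hv hv' =>
      simp only [map_add, LinearMap.add_apply]
      linear_combination (norm := module) hv + hv'
    | single j r' =>
      rw [hs j]
      induction w using Finsupp.induction_linear with
      | zero => simp
      | add w w' hw hw' =>
        simp only [map_add, LinearMap.add_apply]
        linear_combination (norm := module) hw + hw'
      | single k r'' =>
        rw [hs k]
        simp only [map_smul, LinearMap.smul_apply]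
        linear_combination (norm := module) (r * r' * r'') • H i j k

lemma goldmanBracket_jacobi (hM : IsOrientedAtlas M) (u v w : ClassSpace (FundamentalGroup M x₀)) :
    goldmanBracket x₀ u (goldmanBracket x₀ v w) + goldmanBracket x₀ v (goldmanBracket x₀ w u) +
      goldmanBracket x₀ w (goldmanBracket x₀ u v) = 0 := by
  refine jacobi_of_single _ (fun i j k => ?_) u v w
  obtain ⟨x, a, -, rfl⟩ := exists_closed_arc x₀ hM countable_empty i
  obtain ⟨y, b, hb, rfl⟩ := exists_closed_arc x₀ hM (countable_singleton a.toCurve) j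
  have hba := hb _ rfl
  have h𝓑 : (insert a.toCurve (insert b.toCurve ((fun z : ℝ × ℝ => Curve.const (a z.1)) ''
      crossingSet a.toCurve b.toCurve (Icc 0 1) (Icc 0 1)))).Countable :=
    ((((finite_crossingSet hba.symm 0 1 0 1).image _).insert _).insert _).countable
  obtain ⟨z, c, hc, rfl⟩ := exists_closed_arc x₀ hM h𝓑 k
  have hca := hc _ (Or.inl rfl)
  have hcb := hc _ (Or.inr (Or.inl rfl))
  have hoff : ∀ s t r, a s = b t → b t = c r → False := by
    intro s t r h1 h2
    have hd := hba.symm _ _ h1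
    have hs := a.mem_Ioo_of_vdet_ne_zero hd
    have ht := b.mem_Ioo_of_vdet_ne_zero' h1 hd
    have h3 := hc (Curve.const (a s)) (Or.inr (Or.inr ⟨(s, t),
      ⟨Ioo_subset_Icc_self hs, Ioo_subset_Icc_self ht, h1⟩, rfl⟩)) r 0 (h2.symm.trans h1.symm)
    refine h3 ?_
    rw [vdet_swap (f := Curve.const (a s)) (s := 0) (h1.trans h2), vdet_eq_zero_of_eventually_const (x := a s)
      (Eventually.of_forall fun _ => rfl), neg_zero]
  rw [goldmanBracket_bracket x₀ hM hba.symm hca.symm hcb.symm fun s t r h h' => hoff s t r h' h,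
    goldmanBracket_bracket x₀ hM hcb.symm hba hca fun t r s h h' => hoff s t r (h.symm.trans h'.symm) h',
    goldmanBracket_bracket x₀ hM hca hcb hba.symm fun r s t h h' => hoff s t r h (h.symm.trans h'.symm)]
  abel

end
end

noncomputable section

/-! ### The bracket on the completion -/

section Algebra

variable {π : Type*} [Group π]

lemma mem_classFiltration_zero (v : ClassSpace π) : v ∈ classFiltration π 0 := by
  induction v using Finsupp.induction_linear with
  | zero => exact Submodule.zero_mem _
  | add u v hu hv => exact Submodule.add_mem _ hu hv
  | single c r =>
    obtain ⟨g, rfl⟩ := ConjClasses.exists_rep c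
    exact ⟨MonoidAlgebra.single g r, mem_augmentation_pow_zero _, classProj_single g r⟩

lemma ClassCompletion.exists_rep (x : ClassCompletion π) (p : ℕ) :
    ∃ a, x.1 p = (classFiltration π p).mkQ a :=
  (Submodule.mkQ_surjective _ (x.1 p)).imp fun _ h => h.symm

lemma ClassCompletion.rep_of_le {x : ClassCompletion π} {p q : ℕ} (h : p ≤ q) {a : ClassSpace π}
    (ha : x.1 q = (classFiltration π q).mkQ a) : x.1 p = (classFiltration π p).mkQ a := by
  rw [← x.2 p q h, ha]
  rfl

theorem exists_inducedBracket (br : ClassSpace π →ₗ[ℝ] ClassSpace π →ₗ[ℝ] ClassSpace π)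
    (hF : ∀ p, ∀ u ∈ classFiltration π (p + 1), ∀ v, br u v ∈ classFiltration π p)
    (hanti : ∀ u v, br u v = -br v u)
    (hjac : ∀ u v w, br u (br v w) + br v (br w u) + br w (br u v) = 0) :
    ∃ B : ClassCompletion π →ₗ[ℝ] ClassCompletion π →ₗ[ℝ] ClassCompletion π,
      (∀ B', IsInducedBracket br B' ↔ B' = B) ∧ IsLieBracket B := by
  have hcongr : ∀ {p : ℕ} {a a' b b' : ClassSpace π},
      (classFiltration π (p + 1)).mkQ a = (classFiltration π (p + 1)).mkQ a' →
      (classFiltration π (p + 1)).mkQ b = (classFiltration π (p + 1)).mkQ b' →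
      (classFiltration π p).mkQ (br a b) = (classFiltration π p).mkQ (br a' b') := by
    intro p a a' b b' ha hb
    rw [Submodule.mkQ_apply, Submodule.mkQ_apply, Submodule.Quotient.eq] at ha hb ⊢
    have e : br a b - br a' b' = br (a - a') b + br a' (b - b') := by
      rw [map_sub, map_sub, LinearMap.sub_apply]
      abel
    rw [e, hanti a' (b - b')]
    exact Submodule.add_mem _ (hF p _ ha b) (Submodule.neg_mem _ (hF p _ hb a'))
  choose rep hrep using fun (x : ClassCompletion π) p => ClassCompletion.exists_rep x p
  let f : ClassCompletion π → ClassCompletion π → ClassCompletion π := fun x y =>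
    ⟨fun p => (classFiltration π p).mkQ (br (rep x (p + 1)) (rep y (p + 1))), fun p q h => by
      have h1 := ClassCompletion.rep_of_le (Nat.succ_le_succ h) (hrep x (q + 1))
      have h2 := ClassCompletion.rep_of_le (Nat.succ_le_succ h) (hrep y (q + 1))
      exact hcongr (h1.symm.trans (hrep x (p + 1))) (h2.symm.trans (hrep y (p + 1)))⟩
  have hf : ∀ (x y : ClassCompletion π) (p : ℕ) (a b : ClassSpace π),
      x.1 (p + 1) = (classFiltration π (p + 1)).mkQ a →
      y.1 (p + 1) = (classFiltration π (p + 1)).mkQ b →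
      (f x y).1 p = (classFiltration π p).mkQ (br a b) := fun x y p a b ha hb =>
    hcongr ((hrep x _).symm.trans ha) ((hrep y _).symm.trans hb)
  let B : ClassCompletion π →ₗ[ℝ] ClassCompletion π →ₗ[ℝ] ClassCompletion π :=
    LinearMap.mk₂ ℝ f
      (fun x x' y => Subtype.ext <| funext fun p => by
        refine (hf _ _ p (rep x (p + 1) + rep x' (p + 1)) _ ?_ (hrep y _)).trans ?_
        · rw [map_add, ← hrep, ← hrep]; rfl
        · rw [map_add, LinearMap.add_apply, map_add]; rfl)
      (fun r x y => Subtype.ext <| funext fun p => by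
        refine (hf _ _ p (r • rep x (p + 1)) _ ?_ (hrep y _)).trans ?_
        · rw [map_smul, ← hrep]; rfl
        · rw [map_smul, LinearMap.smul_apply, map_smul]; rfl)
      (fun x y y' => Subtype.ext <| funext fun p => by
        refine (hf _ _ p _ (rep y (p + 1) + rep y' (p + 1)) (hrep x _) ?_).trans ?_
        · rw [map_add, ← hrep, ← hrep]; rfl
        · rw [map_add, map_add]; rfl)
      (fun r x y => Subtype.ext <| funext fun p => by
        refine (hf _ _ p _ (r • rep y (p + 1)) (hrep x _) ?_).trans ?_
        · rw [map_smul, ← hrep]; rfl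
        · rw [map_smul, map_smul]; rfl)
  refine ⟨B, fun B' => ⟨fun h => ?_, fun h => h ▸ hf⟩, ⟨fun x => ?_, fun x y z => ?_⟩⟩
  · refine LinearMap.ext₂ fun x y => Subtype.ext <| funext fun p => ?_
    exact h x y p _ _ (hrep x _) (hrep y _)
  · refine Subtype.ext <| funext fun p => ?_
    refine (hf x x p _ _ (hrep x _) (hrep x _)).trans ?_
    have : br (rep x (p + 1)) (rep x (p + 1)) = 0 := self_eq_neg.1 (hanti _ _)
    rw [this, map_zero]
    rfl
  · refine Subtype.ext <| funext fun p => ?_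
    have key : ∀ u v w : ClassCompletion π, (B u (B v w)).1 p = (classFiltration π p).mkQ
        (br (rep u (p + 2)) (br (rep v (p + 2)) (rep w (p + 2)))) := fun u v w =>
      hf u (B v w) p _ _ (ClassCompletion.rep_of_le (Nat.le_succ _) (hrep u (p + 2)))
        (hf v w (p + 1) _ _ (hrep v _) (hrep w _))
    have h := congrArg (classFiltration π p).mkQ
      (hjac (rep x (p + 2)) (rep y (p + 2)) (rep z (p + 2)))
    rw [map_add, map_add, ← key, ← key, ← key, map_zero] at h
    exact h

end Algebra

end

theorem proposition6p2 {M : Type*} [TopologicalSpace M] [T2Space M] [CompactSpace M]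
    [PathConnectedSpace M] [ChartedSpace Plane M] [IsManifold (𝓡 2) ∞ M]
    (hM : IsOrientedAtlas M) (x₀ : M) :
    ∃ br : ClassSpace (FundamentalGroup M x₀) →ₗ[ℝ] ClassSpace (FundamentalGroup M x₀) →ₗ[ℝ]
        ClassSpace (FundamentalGroup M x₀),
      -- there is exactly one Goldman bracket, namely `br`
      (∀ br', IsGoldmanBracket x₀ br' ↔ br' = br) ∧
      -- compatibility with the filtration
      (∀ p q : ℕ, 1 ≤ p → 2 ≤ q →
        ∀ a ∈ classFiltration (FundamentalGroup M x₀) p,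
        ∀ b ∈ classFiltration (FundamentalGroup M x₀) q,
          br a b ∈ classFiltration (FundamentalGroup M x₀) (p + q - 2)) ∧
      (∀ p : ℕ, 2 ≤ p →
        ∀ a ∈ classFiltration (FundamentalGroup M x₀) p,
        ∀ b : ClassSpace (FundamentalGroup M x₀),
          br a b ∈ classFiltration (FundamentalGroup M x₀) (p - 1)) ∧
      -- the induced Lie bracket on the completion
      (∃ B : ClassCompletion (FundamentalGroup M x₀) →ₗ[ℝ]
          ClassCompletion (FundamentalGroup M x₀) →ₗ[ℝ]
          ClassCompletion (FundamentalGroup M x₀),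
        (∀ B', IsInducedBracket br B' ↔ B' = B) ∧ IsLieBracket B) := by
  have hF : ∀ p, ∀ a ∈ classFiltration (FundamentalGroup M x₀) (p + 1), ∀ b,
      goldmanBracket x₀ a b ∈ classFiltration (FundamentalGroup M x₀) p := fun p a ha b =>
    goldmanBracket_mem x₀ hM p 0 ha (mem_classFiltration_zero b)
  refine ⟨goldmanBracket x₀, isGoldmanBracket_iff x₀ hM, fun p q hp hq a ha b hb => ?_,
    fun p hp a ha b => ?_, exists_inducedBracket _ hF (goldmanBracket_swap x₀ hM)
      (goldmanBracket_jacobi x₀ hM)⟩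
  · obtain ⟨p, rfl⟩ := Nat.exists_eq_add_of_le' hp
    have h := goldmanBracket_mem x₀ hM p q ha hb
    rwa [show p + 1 + q - 2 = p + (q - 1) by omega]
  · obtain ⟨p, rfl⟩ := Nat.exists_eq_add_of_le' (show 1 ≤ p by omega)
    exact hF p a ha b
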